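/- Let $0<\alpha_0<\alpha_1<\alpha_3$, put $\alpha_2=\alpha_1$, and consider the geodesic flow on the ellipsoid $\sum_{i=0}^3 x_i^2/\alpha_i=1$ in $\mathbb{R}^4$. Its phase space is $$M=\Big\{(x,y)\in\mathbb{R}^4\times\mathbb{R}^4:\ \sum_{i}\frac{x_i^2}{\alpha_i}=1,\ \sum_{i}\frac{x_iy_i}{\alpha_i}=0\Big\},$$ with the symplectic structure given by the Dirac bracket $\{x_i,x_j\}=0$, $\{x_i,y_j\}=\delta_{ij}-\frac{x_ix_j}{D\alpha_i\alpha_j}$, $\{y_i,y_j\}=-\frac{x_iy_j-x_jy_i}{D\alpha_i\alpha_j}$, where $D=\sum_i x_i^2/\alpha_i^2$. Let $\mathcal{EM}=(H,J,G):M\to\mathbb{R}^3$ be the energy-momentum map, where $H=\frac12\sum_i y_i^2$, $J=x_1y_2-x_2y_1$ and $$G=y_1^2+y_2^2+\frac{(x_0y_1-x_1y_0)^2+(x_0y_2-x_2y_0)^2}{\alpha_1-\alpha_0}+\frac{(x_1y_3-x_3y_1)^2+(x_2y_3-x_3y_2)^2}{\alpha_1-\alpha_3}.$$ A point of $M$ is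 critical if the rank of $d\mathcal{EM}$ on the tangent space of $M$ is less than $3$; the corank is $k=3-\mathrm{rank}$. A critical point $p$ is non-degenerate if the linearisations at $p$ of the Hamiltonian vector fields of those linear combinations of $H,J,G$ that are critical at $p$ induce, on the $2k$-dimensional symplectic space $\ker d\mathcal{EM}(p)/\mathrm{span}(X_H,X_J,X_G)(p)$, a Cartan subalgebra of the symplectic Lie algebra, that is, a commutative $k$-dimensional space containing an element with $2k$ distinct eigenvalues. If these eigenvalues are $\pm i\beta$ ($k=1$, $\beta\ne0$), the point is called elliptic; if they are $\pm i\beta_1,\pm i\beta_2$ ($k=2$), elliptic-elliptic; if they are $\pm a\pm i b$ ($k=2$, $a,b\neq0$), focus-focus. Fix an energy $h>0$. Then the following holds. (1) The image of $(J,G)$ on $M\cap\{H=h\}$ is the region in the $(j,g)$-plane bounded by the two parabolas $$g=\frac{2\alpha_1}{\alpha_1-\alpha_3}h-\frac{\alpha_3}{\alpha_1(\alpha_1-\alpha_3)}j^2,\qquad g=\frac{2\alpha_1}{\alpha_1-\alpha_0}h-\frac{\alpha_0}{\alpha_1(\alpha_1-\alpha_0)}j^2,$$ that is, the set of $(j,g)$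 for which $g$ is at least the first and at most the second right-hand side; its topological boundary consists of the arcs of the two parabolas contained in it. (2) The set of values $(j,g)$ of the critical points of $\mathcal{EM}$ with $H=h$ is exactly the union of these two boundary arcs and the origin $(0,0)$, which does not lie on the arcs and is an isolated point of this set. (3) Every critical point with $H=h$ is non-degenerate: it has corank $1$ and is elliptic if its value lies on exactly one of the boundary curves; it has corank $2$ and is elliptic-elliptic if its value is an intersection point of the two curves; it has corank $2$ and is focus-focus if its value is the origin. -/

import Mathlib

open Set Topology Filter

namespace EllipsoidGeodesic

noncomputable section

/-- The ambient space `ℝ⁸` with coordinates `(x, y)`: positions `p.1`, momenta `p.2`. -/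
abbrev Phase : Type := (Fin 4 → ℝ) × (Fin 4 → ℝ)

/-- The equation of the ellipsoid with squared semi-axes `α i`. -/
def C₁ (α : Fin 4 → ℝ) (p : Phase) : ℝ := ∑ i, p.1 i ^ 2 / α i - 1

/-- The equation of its tangent spaces. -/
def C₂ (α : Fin 4 → ℝ) (p : Phase) : ℝ := ∑ i, p.1 i * p.2 i / α i

/-- The denominator `⟨A⁻¹x, A⁻¹x⟩` of the Dirac bracket. -/
def diracD (α : Fin 4 → ℝ) (p : Phase) : ℝ := ∑ i, p.1 i ^ 2 / α i ^ 2

/-- The phase space: the symplectic leaf `C₁ = C₂ = 0` of the Dirac bracket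
(the tangent bundle of the ellipsoid, identified with its cotangent bundle). -/
def phaseSpace (α : Fin 4 → ℝ) : Set Phase := {p | C₁ α p = 0 ∧ C₂ α p = 0}

/-- The tangent space of the phase space at `p`. -/
def tangent (α : Fin 4 → ℝ) (p : Phase) : Submodule ℝ Phase :=
  (fderiv ℝ (C₁ α) p).ker ⊓ (fderiv ℝ (C₂ α) p).ker

/-- `∂f/∂x_i` -/
def dx (f : Phase → ℝ) (i : Fin 4) (p : Phase) : ℝ := fderiv ℝ f p (Pi.single i 1, 0)

/-- `∂f/∂y_i` -/
def dy (f : Phase → ℝ) (i : Fin 4) (p : Phase) : ℝ := fderiv ℝ f p (0, Pi.single i 1)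

/-- `{x_i, y_j}` -/
def bracketXY (α : Fin 4 → ℝ) (i j : Fin 4) (p : Phase) : ℝ :=
  (if i = j then 1 else 0) - p.1 i * p.1 j / (diracD α p * α i * α j)

/-- `{y_i, y_j}` -/
def bracketYY (α : Fin 4 → ℝ) (i j : Fin 4) (p : Phase) : ℝ :=
  -(p.1 i * p.2 j - p.1 j * p.2 i) / (diracD α p * α i * α j)

/-- The Dirac bracket `{f, g}`, where `{x_i, x_j} = 0`. -/
def diracBracket (α : Fin 4 → ℝ) (f g : Phase → ℝ) (p : Phase) : ℝ :=
  ∑ i, ∑ j, ((dx f i p * dy g j p - dy f j p * dx g i p) * bracketXY α i j p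
    + dy f i p * dy g j p * bracketYY α i j p)

/-- The Hamiltonian vector field `X_f`, i.e. `ẋ_i = {x_i, f}`, `ẏ_i = {y_i, f}`. -/
def hamVF (α : Fin 4 → ℝ) (f : Phase → ℝ) (p : Phase) : Phase :=
  (fun i => diracBracket α (fun q => q.1 i) f p, fun i => diracBracket α (fun q => q.2 i) f p)

/-! ### Singular points of a momentum map `F = (F₀, F₁, F₂)` on the 6-dimensional phase space -/

/-- The rank at `p` of the differential of `F` restricted to the tangent space of the phase
space. -/
def rankAt (α : Fin 4 → ℝ) (F : Phase → Fin 3 → ℝ) (p : Phase) : ℕ :=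
  Module.finrank ℝ ((tangent α p).map (fderiv ℝ F p : Phase →ₗ[ℝ] (Fin 3 → ℝ)))

/-- Critical points of the restriction of `F` to the phase space. -/
def IsCriticalPt (α : Fin 4 → ℝ) (F : Phase → Fin 3 → ℝ) (p : Phase) : Prop :=
  p ∈ phaseSpace α ∧ rankAt α F p < 3

/-- The common kernel of the differentials of the integrals in the tangent space; it is the
symplectic orthogonal of `orbitSpace`. -/
def kerSpace (α : Fin 4 → ℝ) (F : Phase → Fin 3 → ℝ) (p : Phase) : Submodule ℝ Phase :=
  tangent α p ⊓ (fderiv ℝ F p).ker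

/-- The span of the Hamiltonian vector fields of the integrals at `p`. -/
def orbitSpace (α : Fin 4 → ℝ) (F : Phase → Fin 3 → ℝ) (p : Phase) : Submodule ℝ Phase :=
  Submodule.span ℝ (range fun i => hamVF α (fun q => F q i) p)

/-- The reduced symplectic vector space at `p`, of dimension `2 (3 - rank)`. -/
abbrev Reduced (α : Fin 4 → ℝ) (F : Phase → Fin 3 → ℝ) (p : Phase) : Type :=
  kerSpace α F p ⧸ (orbitSpace α F p).submoduleOf (kerSpace α F p)

/-- The linear combination `∑ c_i F_i` of the integrals. -/
def combination (F : Phase → Fin 3 → ℝ) (c : Fin 3 → ℝ) (q : Phase) : ℝ := ∑ i, c i * F q i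

/-- `B` is induced on the reduced space by the linearisation at `p` of the Hamiltonian vector
field of `f = ∑ c_i F_i`, where `f` has a critical point at `p` on the phase space. -/
def IsLinearization (α : Fin 4 → ℝ) (F : Phase → Fin 3 → ℝ) (p : Phase) (c : Fin 3 → ℝ)
    (B : Module.End ℝ (Reduced α F p)) : Prop :=
  (∀ v ∈ tangent α p, fderiv ℝ (combination F c) p v = 0) ∧
  ∀ u : kerSpace α F p, ∃ v : kerSpace α F p,
    (v : Phase) = fderiv ℝ (hamVF α (combination F c)) p u ∧
    B (Submodule.Quotient.mk u) = Submodule.Quotient.mk v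

/-- The space of linearisations on the reduced space of all linear combinations of the integrals
that are critical at `p`. -/
def linearizations (α : Fin 4 → ℝ) (F : Phase → Fin 3 → ℝ) (p : Phase) :
    Submodule ℝ (Module.End ℝ (Reduced α F p)) :=
  Submodule.span ℝ {B | ∃ c, IsLinearization α F p c B}

/-- The set of complex eigenvalues of a real endomorphism. -/
def complexEigenvalues {V : Type*} [AddCommGroup V] [Module ℝ V] [Module.Finite ℝ V]
    (A : Module.End ℝ V) : Set ℂ := {z | Polynomial.aeval z A.charpoly = 0}

/-- `p` is a non-degenerate singular point of Williamson type `(ke, kh, kf)`.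
Non-degeneracy: the linearisations form a Cartan subalgebra of the symplectic Lie algebra of the
`2k`-dimensional reduced space (`k` the corank), i.e. they commute, have dimension `k`, and some
element `A` has `2k` pairwise distinct eigenvalues. The eigenvalues of `A` then consist of
`ke` pairs `±iβ` (elliptic), `kh` pairs `±a` (hyperbolic) and
`kf` quadruples `±a ± iβ` (focus-focus). -/
def IsNondegenerateOfType (α : Fin 4 → ℝ) (F : Phase → Fin 3 → ℝ) (p : Phase)
    (ke kh kf : ℕ) : Prop :=
  Module.finrank ℝ (linearizations α F p) = 3 - rankAt α F p ∧
  (∀ A ∈ linearizations α F p, ∀ B ∈ linearizations α F p, Commute A B) ∧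
  ∃ A ∈ linearizations α F p,
    (complexEigenvalues A).ncard = 2 * (3 - rankAt α F p) ∧
    {z ∈ complexEigenvalues A | z.re = 0 ∧ 0 < z.im}.ncard = ke ∧
    {z ∈ complexEigenvalues A | 0 < z.re ∧ z.im = 0}.ncard = kh ∧
    {z ∈ complexEigenvalues A | 0 < z.re ∧ 0 < z.im}.ncard = kf

/-! ### The ellipsoid with equal middle axes -/

/-- The squared semi-axes `α₀, α₁, α₂ = α₁, α₃`. -/
def axes (α₀ α₁ α₃ : ℝ) : Fin 4 → ℝ := ![α₀, α₁, α₁, α₃]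

/-- The energy. -/
def H (p : Phase) : ℝ := (p.2 0 ^ 2 + p.2 1 ^ 2 + p.2 2 ^ 2 + p.2 3 ^ 2) / 2

/-- The angular momentum. -/
def J (p : Phase) : ℝ := p.1 1 * p.2 2 - p.1 2 * p.2 1

/-- The third integral. -/
def G (α₀ α₁ α₃ : ℝ) (p : Phase) : ℝ :=
  p.2 1 ^ 2 + p.2 2 ^ 2
    + (p.1 0 * p.2 1 - p.1 1 * p.2 0) ^ 2 / (α₁ - α₀)
    + (p.1 0 * p.2 2 - p.1 2 * p.2 0) ^ 2 / (α₁ - α₀)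
    + (p.1 1 * p.2 3 - p.1 3 * p.2 1) ^ 2 / (α₁ - α₃)
    + (p.1 2 * p.2 3 - p.1 3 * p.2 2) ^ 2 / (α₁ - α₃)

/-- The energy-momentum map. -/
def EM (α₀ α₁ α₃ : ℝ) (p : Phase) : Fin 3 → ℝ := ![H p, J p, G α₀ α₁ α₃ p]

/-- The first boundary parabola `g = lowerCurve j`. -/
def lowerCurve (α₁ α₃ h j : ℝ) : ℝ :=
  2 * α₁ / (α₁ - α₃) * h - α₃ / (α₁ * (α₁ - α₃)) * j ^ 2

/-- The second boundary parabola `g = upperCurve j`. -/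
def upperCurve (α₀ α₁ h j : ℝ) : ℝ :=
  2 * α₁ / (α₁ - α₀) * h - α₀ / (α₁ * (α₁ - α₀)) * j ^ 2

/-- The region in the `(j, g)`-plane bounded by the two parabolas. -/
def region (α₀ α₁ α₃ h : ℝ) : Set (ℝ × ℝ) :=
  {q | lowerCurve α₁ α₃ h q.1 ≤ q.2 ∧ q.2 ≤ upperCurve α₀ α₁ h q.1}

/-- The two arcs of the parabolas that bound the region. -/
def boundaryCurves (α₀ α₁ α₃ h : ℝ) : Set (ℝ × ℝ) :=
  {q ∈ region α₀ α₁ α₃ h | q.2 = lowerCurve α₁ α₃ h q.1 ∨ q.2 = upperCurve α₀ α₁ h q.1}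

/-- The values `(j, g)` of the critical points of the energy-momentum map of energy `h`. -/
def criticalValues (α₀ α₁ α₃ h : ℝ) : Set (ℝ × ℝ) :=
  {q | ∃ p, IsCriticalPt (axes α₀ α₁ α₃) (EM α₀ α₁ α₃) p ∧ H p = h ∧
    (J p, G α₀ α₁ α₃ p) = q}

end

end EllipsoidGeodesic

open EllipsoidGeodesic

/-!
Write `z_i = (x_i, y_i)`. On the phase space the differences between `G` and the two parabolas are
sums of squares with positive coefficients: at positive energy, `(α₁ - α₀) * (upperCurve - G)`
vanishes exactly where `z₃ = 0`, and `(α₃ - α₁) * (G - lowerCurve)` exactly where `z₀ = 0`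
(`upperCurve_sub_G`, `G_sub_lowerCurve`). Hence the image lies in the region, and the points over
the boundary arcs are those of the two geodesic flows on the ellipsoids `x₃ = 0` and `x₀ = 0`.
Conversely, the geodesics through one point of the equator `x₀ = x₃ = 0` already reach every value
(`image_eq_region`).

A linear combination `c₀ H + c₁ J + c₂ G` is critical at `p` iff its ambient differential is a
combination of the differentials of the two constraints. The multiplier of the second constraint
always vanishes (`critSpace_multiplier`). If `c₂ ≠ 0` and neither `z₀` nor `z₃` nor `(z₁, z₂)` is
zero, eliminating the scalar products of `(x₁, x₂)` and `(y₁, y₂)` leaves a relation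
`a * J² + b * H * c₀² = 0` with `a, b > 0`, so `J = c₀ = 0`, which is impossible
(`critical_classification`). The case `c₂ = 0` is immediate. So the critical points are those with
`z₃ = 0`, with `z₀ = 0`, or with `z₁ = z₂ = 0`; the last ones have the value `(0, 0)`.

The type of a critical point is read off in the coordinate planes in which `p` vanishes. The
linearisation of the Hamiltonian vector field of a critical combination takes values in these
planes (`fderiv_hamVF`, `fderiv_hamVF_EM`), and the projection to them annihilates the orbit and is
onto. By a dimension count (`orbitSpace_eq`) it identifies the reduced space with these
coordinates, and the linearisations with explicit matrices (`isNondegenerateOfType_of_model`):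
* if only one of `z₀`, `z₃` vanishes, a single `2 × 2` matrix of trace zero and positive
  determinant, hence eigenvalues `±iβ`;
* if both vanish, two commuting matrices that are oscillators in both planes, one of them with the
  eigenvalues `±i√(m / α₀)`, `±i√(m / α₃)`, where `m = y₁² + y₂²`;
* if `z₁ = z₂ = 0`, the rotation generated by `J` and a hyperbolic matrix generated by `G`, with
  eigenvalues `±i` and `±a`, whose sum has the eigenvalues `±a ± i`.
-/

namespace EllipsoidGeodesic

/-! ### The Hamiltonian vector field and its linearisation -/

theorem fderiv_fst_coord (i : Fin 4) (p v : Phase) :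
    fderiv ℝ (fun q : Phase => q.1 i) p v = v.1 i := by
  have h : HasFDerivAt (fun q : Phase => q.1 i)
      ((ContinuousLinearMap.proj (R := ℝ) (φ := fun _ : Fin 4 => ℝ) i).comp
        (ContinuousLinearMap.fst ℝ (Fin 4 → ℝ) (Fin 4 → ℝ))) p :=
    ((ContinuousLinearMap.proj (R := ℝ) (φ := fun _ : Fin 4 => ℝ) i).comp
        (ContinuousLinearMap.fst ℝ (Fin 4 → ℝ) (Fin 4 → ℝ))).hasFDerivAt
  rw [h.fderiv]; rfl

theorem fderiv_snd_coord (i : Fin 4) (p v : Phase) :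
    fderiv ℝ (fun q : Phase => q.2 i) p v = v.2 i := by
  have h : HasFDerivAt (fun q : Phase => q.2 i)
      ((ContinuousLinearMap.proj (R := ℝ) (φ := fun _ : Fin 4 => ℝ) i).comp
        (ContinuousLinearMap.snd ℝ (Fin 4 → ℝ) (Fin 4 → ℝ))) p :=
    ((ContinuousLinearMap.proj (R := ℝ) (φ := fun _ : Fin 4 => ℝ) i).comp
        (ContinuousLinearMap.snd ℝ (Fin 4 → ℝ) (Fin 4 → ℝ))).hasFDerivAt
  rw [h.fderiv]; rfl

theorem fderiv_eq_sum (f : Phase → ℝ) (p v : Phase) :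
    fderiv ℝ f p v = ∑ i, (dx f i p * v.1 i + dy f i p * v.2 i) := by
  have hv : v =
      ∑ i, (v.1 i • ((Pi.single i 1, 0) : Phase) + v.2 i • ((0, Pi.single i 1) : Phase)) := by
    apply Prod.ext <;> ext j <;>
      simp [Prod.fst_sum, Prod.snd_sum, Finset.sum_apply, Pi.single_apply]
  conv_lhs => rw [hv]
  simp only [map_sum, map_add, map_smul, smul_eq_mul, dx, dy]
  exact Finset.sum_congr rfl fun i _ => by ring

/-- The coefficient `P` of the constraint terms in the Hamiltonian vector field `X_f`, see
`hamVF_eq`; it makes `X_f` preserve the first constraint. -/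
noncomputable def multP (α : Fin 4 → ℝ) (f : Phase → ℝ) (p : Phase) : ℝ :=
  (∑ j, dy f j p * (p.1 j / α j)) / diracD α p

/-- The coefficient `Q` of the constraint force in the Hamiltonian vector field `X_f`, see
`hamVF_eq`; given `P`, it makes `X_f` preserve the second constraint. -/
noncomputable def multQ (α : Fin 4 → ℝ) (f : Phase → ℝ) (p : Phase) : ℝ :=
  (∑ j, (dx f j p * (p.1 j / α j) - dy f j p * (p.2 j / α j))) / diracD α p

/-- The Dirac bracket amounts to the canonical one, corrected by two multipliers. -/
theorem hamVF_eq (α : Fin 4 → ℝ) (f : Phase → ℝ) (p : Phase) :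
    hamVF α f p = (fun i => dy f i p - multP α f p * (p.1 i / α i),
      fun i => -dx f i p + multQ α f p * (p.1 i / α i) + multP α f p * (p.2 i / α i)) := by
  have h1 : ∀ i j, dx (fun q : Phase => q.1 i) j p = if i = j then 1 else 0 := fun i j => by
    rw [dx, fderiv_fst_coord]; simp [Pi.single_apply]
  have h2 : ∀ i j, dy (fun q : Phase => q.1 i) j p = 0 := fun i j => by
    rw [dy, fderiv_fst_coord]; simp
  have h3 : ∀ i j, dx (fun q : Phase => q.2 i) j p = 0 := fun i j => by
    rw [dx, fderiv_snd_coord]; simp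
  have h4 : ∀ i j, dy (fun q : Phase => q.2 i) j p = if i = j then 1 else 0 := fun i j => by
    rw [dy, fderiv_snd_coord]; simp [Pi.single_apply]
  unfold hamVF diracBracket multP multQ bracketXY bracketYY
  simp only [h1, h2, h3, h4]
  refine Prod.ext (funext fun i => ?_) (funext fun i => ?_)
  · fin_cases i <;> simp [Fin.sum_univ_succ] <;> ring
  · fin_cases i <;> simp [Fin.sum_univ_succ] <;> ring

theorem fderiv_C₁ (α : Fin 4 → ℝ) (p v : Phase) :
    fderiv ℝ (C₁ α) p v = 2 * ∑ i, p.1 i * v.1 i / α i := by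
  unfold C₁
  simp only [Fin.sum_univ_four]
  simp (disch := fun_prop) [fderiv_fun_sub, fderiv_fun_add, fderiv_fun_mul, fderiv_fun_pow,
    div_eq_mul_inv, fderiv_fst_coord]
  ring

theorem fderiv_C₂ (α : Fin 4 → ℝ) (p v : Phase) :
    fderiv ℝ (C₂ α) p v = ∑ i, (p.2 i * v.1 i + p.1 i * v.2 i) / α i := by
  unfold C₂
  simp only [Fin.sum_univ_four]
  simp (disch := fun_prop) [fderiv_fun_add, fderiv_fun_mul, div_eq_mul_inv, fderiv_fst_coord,
    fderiv_snd_coord]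
  ring

theorem mem_tangent {α : Fin 4 → ℝ} {p v : Phase} :
    v ∈ tangent α p ↔ ∑ i, p.1 i * v.1 i / α i = 0 ∧
      ∑ i, (p.2 i * v.1 i + p.1 i * v.2 i) / α i = 0 := by
  simp [tangent, Submodule.mem_inf, LinearMap.mem_ker, fderiv_C₁, fderiv_C₂]

/-- The constraints are Casimir functions of the Dirac bracket, so Hamiltonian vector fields are
tangent to the phase space. -/
theorem hamVF_mem_tangent {α : Fin 4 → ℝ} {f : Phase → ℝ} {p : Phase} (hD : diracD α p ≠ 0) :
    hamVF α f p ∈ tangent α p := by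
  have hP : multP α f p * diracD α p = ∑ j, dy f j p * (p.1 j / α j) := by
    rw [multP, div_mul_cancel₀ _ hD]
  have hQ : multQ α f p * diracD α p =
      ∑ j, (dx f j p * (p.1 j / α j) - dy f j p * (p.2 j / α j)) := by
    rw [multQ, div_mul_cancel₀ _ hD]
  rw [mem_tangent, hamVF_eq]
  simp only [diracD, Fin.sum_univ_four, div_eq_mul_inv, ← inv_pow] at hP hQ ⊢
  constructor
  · linear_combination -hP
  · linear_combination hQ

/-- The Dirac bracket is non-degenerate on the phase space. -/
theorem fderiv_eq_zero_of_hamVF_eq_zero {α : Fin 4 → ℝ} {f : Phase → ℝ} {p v : Phase}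
    (h : hamVF α f p = 0) (hv : v ∈ tangent α p) : fderiv ℝ f p v = 0 := by
  rw [hamVF_eq] at h
  have h1 : ∀ i, dy f i p - multP α f p * (p.1 i / α i) = 0 := fun i =>
    congrFun (congrArg Prod.fst h) i
  have h2 : ∀ i, -dx f i p + multQ α f p * (p.1 i / α i) + multP α f p * (p.2 i / α i) = 0 :=
    fun i => congrFun (congrArg Prod.snd h) i
  obtain ⟨t1, t2⟩ := mem_tangent.1 hv
  have : fderiv ℝ f p v = multQ α f p * (∑ i, p.1 i * v.1 i / α i) +
      multP α f p * ∑ i, (p.2 i * v.1 i + p.1 i * v.2 i) / α i := by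
    rw [fderiv_eq_sum, Finset.mul_sum, Finset.mul_sum, ← Finset.sum_add_distrib]
    refine Finset.sum_congr rfl fun i _ => ?_
    linear_combination v.2 i * h1 i - v.1 i * h2 i
  rw [this, t1, t2]; simp

theorem finrank_tangent {α : Fin 4 → ℝ} {p : Phase} (hD : diracD α p ≠ 0) :
    Module.finrank ℝ (tangent α p) = 6 := by
  let Φ : Phase →ₗ[ℝ] ℝ × ℝ :=
    (fderiv ℝ (C₁ α) p : Phase →ₗ[ℝ] ℝ).prod (fderiv ℝ (C₂ α) p : Phase →ₗ[ℝ] ℝ)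
  have hΦ : tangent α p = LinearMap.ker Φ := by
    rw [LinearMap.ker_prod]; rfl
  have hsurj : LinearMap.range Φ = ⊤ := by
    rw [LinearMap.range_eq_top]
    rintro ⟨a, b⟩
    set E : ℝ := ∑ i, p.1 i * p.2 i / α i ^ 2 with hE
    -- it suffices to use the normal vector `x / α` of the ellipsoid in both factors
    refine ⟨((a / (2 * diracD α p)) • fun i => p.1 i / α i,
      ((b - a / (2 * diracD α p) * E) / diracD α p) • fun i => p.1 i / α i), ?_⟩
    have e1 : ∀ s t : ℝ, Φ (s • fun i => p.1 i / α i, t • fun i => p.1 i / α i) =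
        (2 * s * diracD α p, s * E + t * diracD α p) := by
      intro s t
      apply Prod.ext
      · change fderiv ℝ (C₁ α) p _ = _
        rw [fderiv_C₁]
        simp only [diracD, Fin.sum_univ_four, Pi.smul_apply, smul_eq_mul]
        ring
      · change fderiv ℝ (C₂ α) p _ = _
        rw [fderiv_C₂]
        simp only [hE, diracD, Fin.sum_univ_four, Pi.smul_apply, smul_eq_mul]
        ring
    rw [e1]
    apply Prod.ext
    · simp only; field_simp
    · simp only; field_simp; ring
  have := LinearMap.finrank_range_add_finrank_ker Φ
  rw [hsurj, ← hΦ] at this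
  simp at this
  omega

/-- The coefficients of the linear combinations of the integrals that are critical at `p`. -/
def critSpace (α : Fin 4 → ℝ) (F : Phase → Fin 3 → ℝ) (p : Phase) : Submodule ℝ (Fin 3 → ℝ) where
  carrier := {c | ∀ v ∈ tangent α p, ∑ i, c i * fderiv ℝ F p v i = 0}
  zero_mem' := by simp
  add_mem' := by
    intro a b ha hb v hv
    simp [add_mul, Finset.sum_add_distrib, ha v hv, hb v hv]
  smul_mem' := by
    intro t a ha v hv
    simp [mul_assoc, ← Finset.mul_sum, ha v hv]

theorem rankAt_add_finrank_critSpace (α : Fin 4 → ℝ) (F : Phase → Fin 3 → ℝ) (p : Phase) :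
    rankAt α F p + Module.finrank ℝ (critSpace α F p) = 3 := by
  set S := (tangent α p).map (fderiv ℝ F p : Phase →ₗ[ℝ] (Fin 3 → ℝ)) with hS
  have h : critSpace α F p =
      S.dualAnnihilator.comap (dotProductEquiv ℝ (Fin 3)).toLinearMap := by
    ext c
    simp only [Submodule.mem_comap, Submodule.mem_dualAnnihilator, hS, Submodule.mem_map,
      forall_exists_index, and_imp, forall_apply_eq_imp_iff₂]
    rfl
  have h1 := Subspace.finrank_add_finrank_dualAnnihilator_eq S
  rw [rankAt, h, Submodule.comap_equiv_eq_map_symm, LinearEquiv.finrank_map_eq, ← hS, h1]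
  simp

theorem finrank_kerSpace {α : Fin 4 → ℝ} {F : Phase → Fin 3 → ℝ} {p : Phase}
    (hD : diracD α p ≠ 0) :
    rankAt α F p + Module.finrank ℝ (kerSpace α F p) = 6 := by
  have h := LinearMap.finrank_range_add_finrank_ker
    ((fderiv ℝ F p : Phase →ₗ[ℝ] (Fin 3 → ℝ)).domRestrict (tangent α p))
  rw [finrank_tangent hD, LinearMap.range_domRestrict, LinearMap.ker_domRestrict] at h
  have h2 := Submodule.finrank_map_subtype_eq (tangent α p)
    (Submodule.comap (tangent α p).subtype
      (LinearMap.ker (fderiv ℝ F p : Phase →ₗ[ℝ] (Fin 3 → ℝ))))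
  rw [Submodule.map_comap_subtype] at h2
  rw [rankAt, ← h]
  exact congrArg _ h2

theorem fderiv_component {F : Phase → Fin 3 → ℝ} {p : Phase} (hF : DifferentiableAt ℝ F p)
    (i : Fin 3) (v : Phase) : fderiv ℝ (fun q => F q i) p v = fderiv ℝ F p v i := by
  rw [(hasFDerivAt_pi'.1 hF.hasFDerivAt i).fderiv]; rfl

theorem fderiv_combination {F : Phase → Fin 3 → ℝ} {p : Phase} (hF : DifferentiableAt ℝ F p)
    (c : Fin 3 → ℝ) (v : Phase) :
    fderiv ℝ (combination F c) p v = ∑ i, c i * fderiv ℝ F p v i := by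
  have hF' : ∀ i, DifferentiableAt ℝ (fun q => F q i) p := differentiableAt_pi.1 hF
  have : combination F c = fun q => ∑ i, c i * F q i := rfl
  rw [this, fderiv_fun_sum fun i _ => (hF' i).const_mul (c i)]
  rw [sum_apply]
  refine Finset.sum_congr rfl fun i _ => ?_
  rw [fderiv_const_mul (hF' i), smul_apply, fderiv_component hF, smul_eq_mul]

theorem hamVF_combination {F : Phase → Fin 3 → ℝ} {p : Phase} (hF : DifferentiableAt ℝ F p)
    (α : Fin 4 → ℝ) (c : Fin 3 → ℝ) :
    hamVF α (combination F c) p = ∑ i, c i • hamVF α (fun q => F q i) p := by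
  have hx : ∀ i, dx (combination F c) i p = ∑ k, c k * dx (fun q => F q k) i p := fun i => by
    simp only [dx, fderiv_combination hF, fderiv_component hF]
  have hy : ∀ i, dy (combination F c) i p = ∑ k, c k * dy (fun q => F q k) i p := fun i => by
    simp only [dy, fderiv_combination hF, fderiv_component hF]
  simp only [hamVF_eq, multP, multQ, hx, hy, Fin.sum_univ_three, Fin.sum_univ_four]
  apply Prod.ext <;> funext i <;> simp <;> ring

/-- A relation between the Hamiltonian vector fields at `p` gives a linear combination of the
integrals that is critical at `p`. -/
theorem rankAt_le_finrank_orbitSpace {α : Fin 4 → ℝ} {F : Phase → Fin 3 → ℝ} {p : Phase}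
    (hF : DifferentiableAt ℝ F p) :
    rankAt α F p ≤ Module.finrank ℝ (orbitSpace α F p) := by
  let T : (Fin 3 → ℝ) →ₗ[ℝ] Phase :=
    Fintype.linearCombination ℝ (fun i => hamVF α (fun q => F q i) p)
  have hr : LinearMap.range T = orbitSpace α F p := Fintype.range_linearCombination ..
  have hk : LinearMap.ker T ≤ critSpace α F p := by
    intro c hc v hv
    rw [← fderiv_combination hF]
    apply fderiv_eq_zero_of_hamVF_eq_zero _ hv
    rw [hamVF_combination hF]
    exact hc
  have h1 := LinearMap.finrank_range_add_finrank_ker T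
  have h2 := Submodule.finrank_mono hk
  have h3 := rankAt_add_finrank_critSpace α F p
  rw [hr] at h1
  simp at h1
  omega

theorem fderiv_fst_apply {g : Phase → Phase} {p : Phase} (hg : DifferentiableAt ℝ g p)
    (u : Phase) (i : Fin 4) : (fderiv ℝ g p u).1 i = fderiv ℝ (fun q => (g q).1 i) p u := by
  rw [(hasFDerivAt_pi'.1 hg.hasFDerivAt.fst i).fderiv]; rfl

theorem fderiv_snd_apply {g : Phase → Phase} {p : Phase} (hg : DifferentiableAt ℝ g p)
    (u : Phase) (i : Fin 4) : (fderiv ℝ g p u).2 i = fderiv ℝ (fun q => (g q).2 i) p u := by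
  rw [(hasFDerivAt_pi'.1 hg.hasFDerivAt.snd i).fderiv]; rfl

section Linearization

variable {α : Fin 4 → ℝ} {f : Phase → ℝ} {p : Phase}

theorem differentiableAt_diracD : DifferentiableAt ℝ (diracD α) p := by
  unfold diracD
  simp only [div_eq_mul_inv]
  fun_prop

theorem differentiableAt_multP (hD : diracD α p ≠ 0) (hy : ∀ i, DifferentiableAt ℝ (dy f i) p) :
    DifferentiableAt ℝ (multP α f) p := by
  unfold multP
  have := differentiableAt_diracD (α := α) (p := p)
  simp only [div_eq_mul_inv]
  fun_prop (disch := assumption)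

theorem differentiableAt_multQ (hD : diracD α p ≠ 0) (hx : ∀ i, DifferentiableAt ℝ (dx f i) p)
    (hy : ∀ i, DifferentiableAt ℝ (dy f i) p) : DifferentiableAt ℝ (multQ α f) p := by
  unfold multQ
  have := differentiableAt_diracD (α := α) (p := p)
  simp only [div_eq_mul_inv]
  fun_prop (disch := assumption)

theorem differentiableAt_hamVF (hD : diracD α p ≠ 0) (hx : ∀ i, DifferentiableAt ℝ (dx f i) p)
    (hy : ∀ i, DifferentiableAt ℝ (dy f i) p) : DifferentiableAt ℝ (hamVF α f) p := by
  have h1 := differentiableAt_multP hD hy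
  have h2 := differentiableAt_multQ hD hx hy
  rw [funext (hamVF_eq α f)]
  simp only [div_eq_mul_inv]
  fun_prop

/-- The linearisation of `X_f` at a point where `f - l * C₁` is critical in the ambient space.
Here `(γ, β)` is the derivative of the gradient of `f - l * C₁` in the direction `u`, up to a
multiple of the gradient of `C₁`, which a variation `l'` of the multiplier absorbs. If `β` and `γ`
live in coordinate planes in which `p` vanishes, the variation of the multipliers of `X_f` does not
contribute further. -/
theorem fderiv_hamVF (hD : diracD α p ≠ 0) (hx : ∀ i, DifferentiableAt ℝ (dx f i) p)
    (hy : ∀ i, DifferentiableAt ℝ (dy f i) p) {u : Phase} {l l' : ℝ} {β γ : Fin 4 → ℝ}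
    (hx0 : ∀ i, dx f i p = 2 * l * (p.1 i / α i)) (hy0 : ∀ i, dy f i p = 0)
    (hx1 : ∀ i, fderiv ℝ (dx f i) p u =
      2 * l * (u.1 i / α i) + 2 * l' * (p.1 i / α i) + γ i)
    (hy1 : ∀ i, fderiv ℝ (dy f i) p u = β i)
    (hβ : ∀ i, β i * p.1 i = 0 ∧ β i * p.2 i = 0) (hγ : ∀ i, γ i * p.1 i = 0) :
    fderiv ℝ (hamVF α f) p u = (β, -γ) := by
  have hdD := differentiableAt_diracD (α := α) (p := p)
  have hdP := differentiableAt_multP hD hy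
  have hdQ := differentiableAt_multQ hD hx hy
  have hP0 : multP α f p = 0 := by simp [multP, hy0]
  have hQ0 : multQ α f p = 2 * l := by
    rw [multQ, div_eq_iff hD]
    simp only [hx0, hy0, diracD, Fin.sum_univ_four]
    ring
  have hDu : fderiv ℝ (diracD α) p u = 2 * ∑ i, p.1 i * u.1 i / α i ^ 2 := by
    unfold diracD
    simp only [Fin.sum_univ_four]
    simp (disch := fun_prop) [fderiv_fun_add, fderiv_fun_mul, fderiv_fun_pow,
      div_eq_mul_inv, fderiv_fst_coord]
    ring
  -- the multipliers are differentiated through `multP * D = ∑ ...`, `multQ * D = ∑ ...`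
  have hev : ∀ᶠ q in 𝓝 p, diracD α q ≠ 0 := hdD.continuousAt.eventually_ne hD
  have hP1 : fderiv ℝ (multP α f) p u = 0 := by
    have e : (fun q => multP α f q * diracD α q) =ᶠ[𝓝 p]
        fun q => ∑ j, dy f j q * (q.1 j / α j) := by
      filter_upwards [hev] with q hq
      rw [multP, div_mul_cancel₀ _ hq]
    have e' := congrArg (fun L : Phase →L[ℝ] ℝ => L u) e.fderiv_eq
    simp only [Fin.sum_univ_four, div_eq_mul_inv] at e'
    simp (disch := fun_prop) [fderiv_fun_add, fderiv_fun_mul, hP0, hy0, hy1] at e'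
    have : diracD α p * fderiv ℝ (multP α f) p u = 0 := by
      rw [e']
      linear_combination (α 0)⁻¹ * (hβ 0).1 + (α 1)⁻¹ * (hβ 1).1 + (α 2)⁻¹ * (hβ 2).1 +
        (α 3)⁻¹ * (hβ 3).1
    exact (mul_eq_zero.1 this).resolve_left hD
  have hQ1 : fderiv ℝ (multQ α f) p u = 2 * l' := by
    have e : (fun q => multQ α f q * diracD α q) =ᶠ[𝓝 p]
        fun q => ∑ j, (dx f j q * (q.1 j / α j) - dy f j q * (q.2 j / α j)) := by
      filter_upwards [hev] with q hq
      rw [multQ, div_mul_cancel₀ _ hq]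
    have e' := congrArg (fun L : Phase →L[ℝ] ℝ => L u) e.fderiv_eq
    simp only [Fin.sum_univ_four, div_eq_mul_inv] at e'
    simp (disch := fun_prop) [fderiv_fun_add, fderiv_fun_sub, fderiv_fun_mul, fderiv_fst_coord,
      hQ0, hx0, hy0, hx1, hy1, hDu] at e'
    have : diracD α p * fderiv ℝ (multQ α f) p u = diracD α p * (2 * l') := by
      simp only [Fin.sum_univ_four] at e'
      rw [eq_sub_of_add_eq' e']
      simp only [diracD, Fin.sum_univ_four]
      linear_combination (α 0)⁻¹ * (hγ 0) + (α 1)⁻¹ * (hγ 1) + (α 2)⁻¹ * (hγ 2) +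
        (α 3)⁻¹ * (hγ 3) - (α 0)⁻¹ * (hβ 0).2 - (α 1)⁻¹ * (hβ 1).2 - (α 2)⁻¹ * (hβ 2).2 -
        (α 3)⁻¹ * (hβ 3).2
    exact mul_left_cancel₀ hD this
  have hdX := differentiableAt_hamVF hD hx hy
  apply Prod.ext
  · funext i
    rw [fderiv_fst_apply hdX]
    simp only [hamVF_eq, div_eq_mul_inv]
    simp (disch := fun_prop) [fderiv_fun_sub, fderiv_fun_mul, hP0, hP1, hy1]
  · funext i
    rw [fderiv_snd_apply hdX]
    simp only [hamVF_eq, div_eq_mul_inv]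
    simp (disch := fun_prop) [fderiv_fun_add, fderiv_fun_mul, fderiv_fst_coord,
      hP0, hP1, hQ0, hQ1, hx1]
    ring

end Linearization

/-! ### Non-degeneracy through coordinates on the reduced space -/

/-- The complex eigenvalues of a real matrix, as roots of its characteristic determinant, which
is the form in which they are computed for explicit matrices. -/
def matrixEigenvalues {ι : Type*} [Fintype ι] [DecidableEq ι] (A : Matrix ι ι ℝ) : Set ℂ :=
  {z | (Matrix.scalar ι z - A.map Complex.ofReal).det = 0}

section ModelEnd

variable {ι V : Type*} [Fintype ι] [DecidableEq ι] [AddCommGroup V] [Module ℝ V]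

/-- The endomorphism of `V` given by a matrix in the coordinates `e`. -/
noncomputable def modelEnd (e : V ≃ₗ[ℝ] (ι → ℝ)) : Matrix ι ι ℝ ≃ₗ[ℝ] Module.End ℝ V :=
  (Matrix.toLin' : Matrix ι ι ℝ ≃ₗ[ℝ] _).trans e.symm.conj

theorem apply_modelEnd (e : V ≃ₗ[ℝ] (ι → ℝ)) (N : Matrix ι ι ℝ) (x : V) :
    e (modelEnd e N x) = N.mulVec (e x) :=
  e.apply_symm_apply _

theorem modelEnd_mul (e : V ≃ₗ[ℝ] (ι → ℝ)) (N N' : Matrix ι ι ℝ) :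
    modelEnd e N * modelEnd e N' = modelEnd e (N * N') := by
  refine LinearMap.ext fun x => e.injective ?_
  rw [Module.End.mul_apply, apply_modelEnd, apply_modelEnd, apply_modelEnd, Matrix.mulVec_mulVec]

end ModelEnd

theorem complexEigenvalues_conj_toLin' {ι V : Type*} [Fintype ι] [DecidableEq ι]
    [AddCommGroup V] [Module ℝ V] [Module.Finite ℝ V] (e : (ι → ℝ) ≃ₗ[ℝ] V) (A : Matrix ι ι ℝ) :
    complexEigenvalues (e.conj (Matrix.toLin' A)) = matrixEigenvalues A := by
  ext z
  simp only [complexEigenvalues, matrixEigenvalues, mem_ofPred_eq, LinearEquiv.charpoly_conj]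
  have h : (A.map Complex.ofReal).charpoly = A.charpoly.map Complex.ofRealHom :=
    Matrix.charpoly_map A Complex.ofRealHom
  rw [← Matrix.eval_charpoly, h, Matrix.charpoly_toLin', Polynomial.eval_map]
  rfl

section Model

variable {α : Fin 4 → ℝ} {F : Phase → Fin 3 → ℝ} {p : Phase}

theorem fderiv_hamVF_combination (hF : Differentiable ℝ F)
    (hX : ∀ i, DifferentiableAt ℝ (hamVF α (fun q => F q i)) p) (c : Fin 3 → ℝ) :
    fderiv ℝ (hamVF α (combination F c)) p = ∑ i, c i • fderiv ℝ (hamVF α (fun q => F q i)) p := by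
  have : hamVF α (combination F c) = fun q => ∑ i, c i • hamVF α (fun q => F q i) q :=
    funext fun q => hamVF_combination (hF q) α c
  rw [this, fderiv_fun_sum (A := fun i q => c i • hamVF α (fun q => F q i) q)
    fun i _ => (hX i).const_smul (c i)]
  exact Finset.sum_congr rfl fun i _ => fderiv_const_smul (hX i) (c i)

theorem fderiv_hamVF_combination_sum (hF : Differentiable ℝ F)
    (hX : ∀ i, DifferentiableAt ℝ (hamVF α (fun q => F q i)) p) {k : ℕ} (t : Fin k → ℝ)
    (cb : Fin k → Fin 3 → ℝ) (u : Phase) :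
    fderiv ℝ (hamVF α (combination F (∑ i, t i • cb i))) p u =
      ∑ i, t i • fderiv ℝ (hamVF α (combination F (cb i))) p u := by
  simp only [fderiv_hamVF_combination hF hX, Finset.sum_apply, Pi.smul_apply, smul_eq_mul,
    sum_apply, smul_apply, Finset.smul_sum, Finset.sum_smul, mul_smul]
  exact Finset.sum_comm

/-- A linear map onto a space of the dimension of the reduced space that annihilates the
Hamiltonian vector fields of the integrals has no other kernel in `kerSpace`. -/
theorem orbitSpace_eq (hD : diracD α p ≠ 0) (hF : DifferentiableAt ℝ F p) {ι : Type*} [Fintype ι]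
    (hι : Fintype.card ι = 2 * Module.finrank ℝ (critSpace α F p)) (π : Phase →ₗ[ℝ] (ι → ℝ))
    (horb : ∀ i, hamVF α (fun q => F q i) p ∈ kerSpace α F p ⊓ LinearMap.ker π)
    (hsurj : ∀ w, ∃ u ∈ kerSpace α F p, π u = w) :
    orbitSpace α F p = kerSpace α F p ⊓ LinearMap.ker π := by
  have hle : orbitSpace α F p ≤ kerSpace α F p ⊓ LinearMap.ker π := by
    rw [orbitSpace, Submodule.span_le]
    rintro _ ⟨i, rfl⟩
    exact horb i
  apply Submodule.eq_of_le_of_finrank_le hle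
  have h1 := finrank_kerSpace (F := F) hD
  have h2 := rankAt_add_finrank_critSpace α F p
  have h3 := rankAt_le_finrank_orbitSpace (α := α) hF
  have h4 := LinearMap.finrank_range_add_finrank_ker (π.domRestrict (kerSpace α F p))
  have h5 : LinearMap.range (π.domRestrict (kerSpace α F p)) = ⊤ := by
    rw [LinearMap.range_eq_top]
    intro w
    obtain ⟨u, hu, rfl⟩ := hsurj w
    exact ⟨⟨u, hu⟩, rfl⟩
  have h6 := Submodule.finrank_map_subtype_eq (kerSpace α F p)
    (Submodule.comap (kerSpace α F p).subtype (LinearMap.ker π))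
  rw [Submodule.map_comap_subtype] at h6
  rw [h5, LinearMap.ker_domRestrict, finrank_top, Module.finrank_fintype_fun_eq_card, hι] at h4
  change _ + Module.finrank ℝ (Submodule.comap _ _) = _ at h4
  rw [← h6] at h4
  omega

/-- Coordinates on the reduced space. -/
theorem exists_reduced_equiv {ι : Type*} [Finite ι] (π : Phase →ₗ[ℝ] (ι → ℝ))
    (horbit : orbitSpace α F p = kerSpace α F p ⊓ LinearMap.ker π)
    (hsurj : ∀ w, ∃ u ∈ kerSpace α F p, π u = w) :
    ∃ e : Reduced α F p ≃ₗ[ℝ] (ι → ℝ), ∀ u : kerSpace α F p,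
      e (Submodule.Quotient.mk u) = π u := by
  have hker : (orbitSpace α F p).submoduleOf (kerSpace α F p) =
      LinearMap.ker (π.domRestrict (kerSpace α F p)) := by
    ext u
    simp [Submodule.submoduleOf, horbit]
  have hsur : Function.Surjective (π.domRestrict (kerSpace α F p)) := fun w => by
    obtain ⟨u, hu, rfl⟩ := hsurj w
    exact ⟨⟨u, hu⟩, rfl⟩
  exact ⟨(Submodule.quotEquivOfEq _ _ hker).trans
    ((π.domRestrict (kerSpace α F p)).quotKerEquivOfSurjective hsur), fun u => rfl⟩

/-- In the coordinates `e`, the linearisations are the span of the matrices of a spanning family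
of critical combinations. -/
theorem linearizations_eq_map (hF : Differentiable ℝ F)
    (hX : ∀ i, DifferentiableAt ℝ (hamVF α (fun q => F q i)) p)
    {k : ℕ} {cb : Fin k → Fin 3 → ℝ}
    (hspan : critSpace α F p = Submodule.span ℝ (range cb))
    {ι : Type*} [Fintype ι] [DecidableEq ι] (π : Phase →ₗ[ℝ] (ι → ℝ))
    (e : Reduced α F p ≃ₗ[ℝ] (ι → ℝ))
    (he : ∀ u : kerSpace α F p, e (Submodule.Quotient.mk u) = π u)
    {M : Fin k → Matrix ι ι ℝ}
    (hlin : ∀ i, ∀ u ∈ kerSpace α F p,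
      fderiv ℝ (hamVF α (combination F (cb i))) p u ∈ kerSpace α F p ∧
      π (fderiv ℝ (hamVF α (combination F (cb i))) p u) = (M i).mulVec (π u)) :
    linearizations α F p = (Submodule.span ℝ (range M)).map (modelEnd e).toLinearMap := by
  apply le_antisymm
  · rw [linearizations, Submodule.span_le]
    rintro B ⟨c, hc, hB⟩
    have hcc : c ∈ critSpace α F p := fun v hv => by
      rw [← fderiv_combination (hF p)]; exact hc v hv
    rw [hspan, Submodule.mem_span_range_iff_exists_fun] at hcc
    obtain ⟨t, rfl⟩ := hcc
    refine ⟨∑ i, t i • M i, Submodule.sum_mem _ fun i _ => Submodule.smul_mem _ _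
      (Submodule.subset_span ⟨i, rfl⟩), ?_⟩
    refine LinearMap.ext fun x => ?_
    obtain ⟨u, rfl⟩ := Submodule.Quotient.mk_surjective _ x
    obtain ⟨v, hv, hBv⟩ := hB u
    apply e.injective
    rw [hBv, he v, hv, LinearEquiv.coe_coe, apply_modelEnd, he u,
      fderiv_hamVF_combination_sum hF hX, map_sum, Matrix.sum_mulVec]
    exact Finset.sum_congr rfl fun i _ => by
      rw [Matrix.smul_mulVec, map_smul, (hlin i u u.2).2]
  · rw [Submodule.map_span, Submodule.span_le]
    rintro _ ⟨_, ⟨i, rfl⟩, rfl⟩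
    refine Submodule.subset_span ⟨cb i, fun v hv => ?_, fun u => ?_⟩
    · have : cb i ∈ critSpace α F p := by
        rw [hspan]; exact Submodule.subset_span ⟨i, rfl⟩
      rw [fderiv_combination (hF p)]; exact this v hv
    · refine ⟨⟨_, (hlin i u u.2).1⟩, rfl, ?_⟩
      apply e.injective
      rw [LinearEquiv.coe_coe, apply_modelEnd, he, he]
      exact (hlin i u u.2).2.symm

theorem commute_of_mem_span_range {ι : Type*} [Fintype ι] [DecidableEq ι] {k : ℕ}
    {M : Fin k → Matrix ι ι ℝ} (hcomm : ∀ i j, Commute (M i) (M j)) {N N' : Matrix ι ι ℝ}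
    (hN : N ∈ Submodule.span ℝ (range M)) (hN' : N' ∈ Submodule.span ℝ (range M)) :
    Commute N N' := by
  rw [Submodule.mem_span_range_iff_exists_fun] at hN hN'
  obtain ⟨s, rfl⟩ := hN
  obtain ⟨t, rfl⟩ := hN'
  exact Commute.sum_left _ _ _ fun i _ => Commute.sum_right _ _ _ fun j _ =>
    ((hcomm i j).smul_left _).smul_right _

/-- The type of a singular point of corank `k`, from a basis `cb` of the critical combinations, a
projection `π` that identifies the reduced space with `ι → ℝ`, the matrices `M` of the
linearisations in these coordinates, and the eigenvalues of one element `A` of their span. -/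
theorem isNondegenerateOfType_of_model (hD : diracD α p ≠ 0) (hF : Differentiable ℝ F)
    (hX : ∀ i, DifferentiableAt ℝ (hamVF α (fun q => F q i)) p)
    {k : ℕ} {cb : Fin k → Fin 3 → ℝ} (hcb : LinearIndependent ℝ cb)
    (hspan : critSpace α F p = Submodule.span ℝ (range cb))
    {ι : Type*} [Fintype ι] [DecidableEq ι] (hι : Fintype.card ι = 2 * k)
    (π : Phase →ₗ[ℝ] (ι → ℝ))
    (horb : ∀ i, hamVF α (fun q => F q i) p ∈ kerSpace α F p ⊓ LinearMap.ker π)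
    (hsurj : ∀ w, ∃ u ∈ kerSpace α F p, π u = w)
    {M : Fin k → Matrix ι ι ℝ} (hM : LinearIndependent ℝ M)
    (hcomm : ∀ i j, Commute (M i) (M j))
    (hlin : ∀ i, ∀ u ∈ kerSpace α F p,
      fderiv ℝ (hamVF α (combination F (cb i))) p u ∈ kerSpace α F p ∧
      π (fderiv ℝ (hamVF α (combination F (cb i))) p u) = (M i).mulVec (π u))
    {A : Matrix ι ι ℝ} (hA : A ∈ Submodule.span ℝ (range M)) {ke kh kf : ℕ}
    (hE : (matrixEigenvalues A).ncard = 2 * k)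
    (he : {z ∈ matrixEigenvalues A | z.re = 0 ∧ 0 < z.im}.ncard = ke)
    (hh : {z ∈ matrixEigenvalues A | 0 < z.re ∧ z.im = 0}.ncard = kh)
    (hf : {z ∈ matrixEigenvalues A | 0 < z.re ∧ 0 < z.im}.ncard = kf) :
    rankAt α F p = 3 - k ∧ IsNondegenerateOfType α F p ke kh kf := by
  have hk : Module.finrank ℝ (critSpace α F p) = k := by
    rw [hspan, finrank_span_eq_card hcb, Fintype.card_fin]
  have hrk : rankAt α F p = 3 - k := by
    have := rankAt_add_finrank_critSpace α F p
    omega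
  have hk3 : 3 - rankAt α F p = k := by
    have := rankAt_add_finrank_critSpace α F p
    omega
  obtain ⟨e, hmk⟩ := exists_reduced_equiv π
    (orbitSpace_eq hD (hF p) (by rw [hk, hι]) π horb hsurj) hsurj
  have hlins := linearizations_eq_map hF hX hspan π e hmk hlin
  have hEA : complexEigenvalues (modelEnd e A) = matrixEigenvalues A :=
    complexEigenvalues_conj_toLin' e.symm A
  refine ⟨hrk, ?_, ?_, modelEnd e A, ?_, ?_⟩
  · rw [hlins, LinearEquiv.finrank_map_eq, finrank_span_eq_card hM, Fintype.card_fin, hk3]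
  · rw [hlins]
    rintro _ ⟨N, hN, rfl⟩ _ ⟨N', hN', rfl⟩
    rw [LinearEquiv.coe_coe, Commute, SemiconjBy, modelEnd_mul, modelEnd_mul,
      (commute_of_mem_span_range hcomm hN hN').eq]
  · rw [hlins]; exact ⟨A, hA, rfl⟩
  · rw [hEA, hk3]; exact ⟨hE, he, hh, hf⟩

end Model

/-! ### Eigenvalues of the model matrices -/

section Eigenvalues

theorem sq_add_eq_zero_iff {d : ℝ} (hd : 0 < d) (z : ℂ) :
    z ^ 2 + d = 0 ↔ z = ⟨0, √d⟩ ∨ z = ⟨0, -√d⟩ := by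
  have h : z ^ 2 + d = (z - ⟨0, √d⟩) * (z - ⟨0, -√d⟩) := by
    have hs := Real.mul_self_sqrt hd.le
    apply Complex.ext <;> simp [sq]
    · linear_combination -hs
    · ring
  rw [h, mul_eq_zero, sub_eq_zero, sub_eq_zero]

theorem matrixEigenvalues_two (S P R : ℝ) : matrixEigenvalues !![-S, P; -R, S] =
    {z : ℂ | z ^ 2 + ((P * R - S ^ 2 : ℝ) : ℂ) = 0} := by
  ext z
  simp only [matrixEigenvalues, mem_ofPred_eq, Matrix.det_fin_two]
  simp
  refine Eq.congr ?_ rfl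
  ring

/-- The numbers of eigenvalues `±i√d` of each Williamson type. -/
theorem elliptic_counts {d : ℝ} (hd : 0 < d) {E : Set ℂ} (hE : E = {z : ℂ | z ^ 2 + (d : ℂ) = 0}) :
    E.ncard = 2 ∧ {z ∈ E | z.re = 0 ∧ 0 < z.im}.ncard = 1 ∧
      {z ∈ E | 0 < z.re ∧ z.im = 0}.ncard = 0 ∧ {z ∈ E | 0 < z.re ∧ 0 < z.im}.ncard = 0 := by
  have hs := Real.sqrt_pos.2 hd
  have hE' : E = {(⟨0, √d⟩ : ℂ), ⟨0, -√d⟩} := by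
    rw [hE]; ext z; simp [sq_add_eq_zero_iff hd]
  rw [hE']
  refine ⟨?_, ?_, ?_, ?_⟩
  · rw [ncard_pair]
    intro h
    have := congrArg Complex.im h
    simp at this
    linarith
  · rw [ncard_eq_one]
    refine ⟨⟨0, √d⟩, ?_⟩
    ext z
    simp only [mem_ofPred_eq, mem_insert_iff, mem_singleton_iff]
    constructor
    · rintro ⟨rfl | rfl, h⟩
      · rfl
      · simp at h; linarith
    · rintro rfl
      simp [hs]
  · rw [ncard_eq_zero]
    ext z
    simp only [mem_ofPred_eq, mem_insert_iff, mem_singleton_iff, mem_empty_iff_false, iff_false]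
    rintro ⟨rfl | rfl, h⟩ <;> simp at h
  · rw [ncard_eq_zero]
    ext z
    simp only [mem_ofPred_eq, mem_insert_iff, mem_singleton_iff, mem_empty_iff_false, iff_false]
    rintro ⟨rfl | rfl, h⟩ <;> simp at h

theorem matrixEigenvalues_oscillators (d e : ℝ) :
    matrixEigenvalues !![0, 1, 0, 0; -d, 0, 0, 0; 0, 0, 0, 1; 0, 0, -e, 0] =
      {z : ℂ | (z ^ 2 + (d : ℂ)) * (z ^ 2 + (e : ℂ)) = 0} := by
  ext z
  simp only [matrixEigenvalues, mem_ofPred_eq]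
  refine Eq.congr ?_ rfl
  simp [Matrix.det_succ_row_zero, Fin.sum_univ_succ, Fin.succAbove]
  ring

/-- The numbers of eigenvalues `±i√d`, `±i√e` of each Williamson type. -/
theorem elliptic_elliptic_counts {d e : ℝ} (hd : 0 < d) (he : 0 < e) (hde : d ≠ e) {E : Set ℂ}
    (hE : E = {z : ℂ | (z ^ 2 + (d : ℂ)) * (z ^ 2 + (e : ℂ)) = 0}) :
    E.ncard = 4 ∧ {z ∈ E | z.re = 0 ∧ 0 < z.im}.ncard = 2 ∧
      {z ∈ E | 0 < z.re ∧ z.im = 0}.ncard = 0 ∧ {z ∈ E | 0 < z.re ∧ 0 < z.im}.ncard = 0 := by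
  have hs := Real.sqrt_pos.2 hd
  have ht := Real.sqrt_pos.2 he
  have hst : √d ≠ √e := fun h => hde ((Real.sqrt_inj hd.le he.le).1 h)
  have hE' : E = {(⟨0, √d⟩ : ℂ), ⟨0, -√d⟩} ∪ {(⟨0, √e⟩ : ℂ), ⟨0, -√e⟩} := by
    rw [hE]; ext z; simp [sq_add_eq_zero_iff hd, sq_add_eq_zero_iff he, or_assoc]; tauto
  have hfin : E.Finite := by rw [hE']; exact toFinite _
  rw [hE']
  refine ⟨?_, ?_, ?_, ?_⟩
  · rw [ncard_union_eq, ncard_pair, ncard_pair]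
    · intro h
      have := congrArg Complex.im h
      simp at this
      linarith
    · intro h
      have := congrArg Complex.im h
      simp at this
      linarith
    · rw [Set.disjoint_left]
      simp only [mem_insert_iff, mem_singleton_iff]
      rintro z (rfl | rfl) (h | h) <;> have h := congrArg Complex.im h <;> simp at h
      · exact hst h
      · linarith
      · linarith
      · exact hst h
  · rw [ncard_eq_two]
    refine ⟨⟨0, √d⟩, ⟨0, √e⟩, fun h => hst (congrArg Complex.im h), ?_⟩
    ext z
    simp only [mem_ofPred_eq, mem_insert_iff, mem_singleton_iff, mem_union]
    constructor
    · rintro ⟨(rfl | rfl) | (rfl | rfl), h⟩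
      · simp
      · simp at h; linarith
      · simp
      · simp at h; linarith
    · rintro (rfl | rfl)
      · simp [hs]
      · simp [ht]
  · rw [ncard_eq_zero]
    ext z
    simp only [mem_ofPred_eq, mem_insert_iff, mem_singleton_iff, mem_union, mem_empty_iff_false,
      iff_false]
    rintro ⟨(rfl | rfl) | (rfl | rfl), h⟩ <;> simp at h
  · rw [ncard_eq_zero]
    ext z
    simp only [mem_ofPred_eq, mem_insert_iff, mem_singleton_iff, mem_union, mem_empty_iff_false,
      iff_false]
    rintro ⟨(rfl | rfl) | (rfl | rfl), h⟩ <;> simp at h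

theorem matrixEigenvalues_focus (A B C : ℝ) :
    matrixEigenvalues !![-2 * B, -1, 2 * A, 0; 1, -2 * B, 0, 2 * A;
      -2 * C, 0, 2 * B, -1; 0, -2 * C, 1, 2 * B] =
      {z : ℂ | (z ^ 2 - 1 - ((4 * (B ^ 2 - A * C) : ℝ) : ℂ)) ^ 2 + 4 * z ^ 2 = 0} := by
  ext z
  simp only [matrixEigenvalues, mem_ofPred_eq]
  refine Eq.congr ?_ rfl
  simp [Matrix.det_succ_row_zero, Fin.sum_univ_succ, Fin.succAbove]
  ring

/-- The numbers of eigenvalues `±√d ± i` of each Williamson type. -/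
theorem focus_focus_counts {d : ℝ} (hd : 0 < d) {E : Set ℂ}
    (hE : E = {z : ℂ | (z ^ 2 - 1 - (d : ℂ)) ^ 2 + 4 * z ^ 2 = 0}) :
    E.ncard = 4 ∧ {z ∈ E | z.re = 0 ∧ 0 < z.im}.ncard = 0 ∧
      {z ∈ E | 0 < z.re ∧ z.im = 0}.ncard = 0 ∧ {z ∈ E | 0 < z.re ∧ 0 < z.im}.ncard = 1 := by
  have hs := Real.sqrt_pos.2 hd
  have hss : ((√d : ℝ) : ℂ) ^ 2 = d := by
    rw [← Complex.ofReal_pow, Real.sq_sqrt hd.le]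
  have hE' : E = {(⟨√d, 1⟩ : ℂ), ⟨-√d, 1⟩} ∪ {(⟨√d, -1⟩ : ℂ), ⟨-√d, -1⟩} := by
    rw [hE]; ext z
    have e1 : (⟨√d, 1⟩ : ℂ) = √d + Complex.I := by apply Complex.ext <;> simp
    have e2 : (⟨-√d, 1⟩ : ℂ) = -√d + Complex.I := by apply Complex.ext <;> simp
    have e3 : (⟨√d, -1⟩ : ℂ) = √d - Complex.I := by apply Complex.ext <;> simp
    have e4 : (⟨-√d, -1⟩ : ℂ) = -√d - Complex.I := by apply Complex.ext <;> simp
    have key : (z ^ 2 - 1 - (d : ℂ)) ^ 2 + 4 * z ^ 2 = (z - ⟨√d, 1⟩) * (z - ⟨-√d, 1⟩) *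
        ((z - ⟨√d, -1⟩) * (z - ⟨-√d, -1⟩)) := by
      have hI := Complex.I_sq
      rw [e1, e2, e3, e4]
      have f1 : (z - (√d + Complex.I)) * (z - (-√d + Complex.I)) =
          z ^ 2 - 1 - d - 2 * z * Complex.I := by linear_combination hI - hss
      have f2 : (z - (√d - Complex.I)) * (z - (-√d - Complex.I)) =
          z ^ 2 - 1 - d + 2 * z * Complex.I := by linear_combination hI - hss
      rw [f1, f2]
      linear_combination 4 * z ^ 2 * hI
    simp only [mem_ofPred_eq, key, mul_eq_zero, sub_eq_zero, mem_union, mem_insert_iff,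
      mem_singleton_iff]
  rw [hE']
  refine ⟨?_, ?_, ?_, ?_⟩
  · rw [ncard_union_eq, ncard_pair, ncard_pair]
    · intro h
      have := congrArg Complex.re h
      simp at this
      linarith
    · intro h
      have := congrArg Complex.re h
      simp at this
      linarith
    · rw [Set.disjoint_left]
      simp only [mem_insert_iff, mem_singleton_iff]
      rintro z (rfl | rfl) (h | h) <;> have h := congrArg Complex.im h <;> norm_num at h
  · rw [ncard_eq_zero]
    ext z
    simp only [mem_ofPred_eq, mem_insert_iff, mem_singleton_iff, mem_union, mem_empty_iff_false,
      iff_false]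
    rintro ⟨(rfl | rfl) | (rfl | rfl), h⟩ <;> simp [hs.ne'] at h
  · rw [ncard_eq_zero]
    ext z
    simp only [mem_ofPred_eq, mem_insert_iff, mem_singleton_iff, mem_union, mem_empty_iff_false,
      iff_false]
    rintro ⟨(rfl | rfl) | (rfl | rfl), h⟩ <;> simp at h
  · rw [ncard_eq_one]
    refine ⟨⟨√d, 1⟩, ?_⟩
    ext z
    simp only [mem_ofPred_eq, mem_insert_iff, mem_singleton_iff, mem_union]
    constructor
    · rintro ⟨(rfl | rfl) | (rfl | rfl), h⟩
      · rfl
      · have := h.1; simp only at this; linarith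
      · have := h.2; norm_num at this
      · have := h.2; norm_num at this
    · rintro rfl
      simp [hd]

end Eigenvalues

/-! ### Gradients and Hessians of the integrals -/

/-- The angular momentum `x_i y_j - x_j y_i` in the plane of the coordinates `i`, `j`. -/
def angMom (i j : Fin 4) (p : Phase) : ℝ := p.1 i * p.2 j - p.1 j * p.2 i

/-- The derivative of `angMom i j` at `p` in the direction `u`. -/
def angMomD (i j : Fin 4) (p u : Phase) : ℝ :=
  u.1 i * p.2 j + p.1 i * u.2 j - u.1 j * p.2 i - p.1 j * u.2 i

section Gradient

variable (α₀ α₁ α₃ : ℝ) (c : Fin 3 → ℝ)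

/-- The derivatives of `c₀ H + c₁ J + c₂ G` with respect to the positions. -/
noncomputable def gradX : Fin 4 → Phase → ℝ := ![
  fun p => 2 * (α₁ - α₀)⁻¹ * c 2 * (angMom 0 1 p * p.2 1 + angMom 0 2 p * p.2 2),
  fun p => c 1 * p.2 2 + 2 * c 2 *
    (-(α₁ - α₀)⁻¹ * (p.2 0 * angMom 0 1 p) + (α₁ - α₃)⁻¹ * (p.2 3 * angMom 1 3 p)),
  fun p => -c 1 * p.2 1 + 2 * c 2 *
    (-(α₁ - α₀)⁻¹ * (p.2 0 * angMom 0 2 p) + (α₁ - α₃)⁻¹ * (p.2 3 * angMom 2 3 p)),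
  fun p => -2 * (α₁ - α₃)⁻¹ * c 2 * (angMom 1 3 p * p.2 1 + angMom 2 3 p * p.2 2)]

/-- The derivatives of `c₀ H + c₁ J + c₂ G` with respect to the momenta. -/
noncomputable def gradY : Fin 4 → Phase → ℝ := ![
  fun p => c 0 * p.2 0 - 2 * (α₁ - α₀)⁻¹ * c 2 * (angMom 0 1 p * p.1 1 + angMom 0 2 p * p.1 2),
  fun p => c 0 * p.2 1 - c 1 * p.1 2 + 2 * c 2 *
    (p.2 1 + (α₁ - α₀)⁻¹ * (p.1 0 * angMom 0 1 p) - (α₁ - α₃)⁻¹ * (p.1 3 * angMom 1 3 p)),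
  fun p => c 0 * p.2 2 + c 1 * p.1 1 + 2 * c 2 *
    (p.2 2 + (α₁ - α₀)⁻¹ * (p.1 0 * angMom 0 2 p) - (α₁ - α₃)⁻¹ * (p.1 3 * angMom 2 3 p)),
  fun p => c 0 * p.2 3 + 2 * (α₁ - α₃)⁻¹ * c 2 * (angMom 1 3 p * p.1 1 + angMom 2 3 p * p.1 2)]

/-- The derivative of `gradX` at `p` in the direction `u`. -/
noncomputable def hessX (p u : Phase) : Fin 4 → ℝ := ![
  2 * (α₁ - α₀)⁻¹ * c 2 * (angMomD 0 1 p u * p.2 1 + angMom 0 1 p * u.2 1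
    + angMomD 0 2 p u * p.2 2 + angMom 0 2 p * u.2 2),
  c 1 * u.2 2 + 2 * c 2 *
    (-(α₁ - α₀)⁻¹ * (u.2 0 * angMom 0 1 p + p.2 0 * angMomD 0 1 p u)
      + (α₁ - α₃)⁻¹ * (u.2 3 * angMom 1 3 p + p.2 3 * angMomD 1 3 p u)),
  -c 1 * u.2 1 + 2 * c 2 *
    (-(α₁ - α₀)⁻¹ * (u.2 0 * angMom 0 2 p + p.2 0 * angMomD 0 2 p u)
      + (α₁ - α₃)⁻¹ * (u.2 3 * angMom 2 3 p + p.2 3 * angMomD 2 3 p u)),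
  -2 * (α₁ - α₃)⁻¹ * c 2 * (angMomD 1 3 p u * p.2 1 + angMom 1 3 p * u.2 1
    + angMomD 2 3 p u * p.2 2 + angMom 2 3 p * u.2 2)]

/-- The derivative of `gradY` at `p` in the direction `u`. -/
noncomputable def hessY (p u : Phase) : Fin 4 → ℝ := ![
  c 0 * u.2 0 - 2 * (α₁ - α₀)⁻¹ * c 2 * (angMomD 0 1 p u * p.1 1 + angMom 0 1 p * u.1 1
    + angMomD 0 2 p u * p.1 2 + angMom 0 2 p * u.1 2),
  c 0 * u.2 1 - c 1 * u.1 2 + 2 * c 2 *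
    (u.2 1 + (α₁ - α₀)⁻¹ * (u.1 0 * angMom 0 1 p + p.1 0 * angMomD 0 1 p u)
      - (α₁ - α₃)⁻¹ * (u.1 3 * angMom 1 3 p + p.1 3 * angMomD 1 3 p u)),
  c 0 * u.2 2 + c 1 * u.1 1 + 2 * c 2 *
    (u.2 2 + (α₁ - α₀)⁻¹ * (u.1 0 * angMom 0 2 p + p.1 0 * angMomD 0 2 p u)
      - (α₁ - α₃)⁻¹ * (u.1 3 * angMom 2 3 p + p.1 3 * angMomD 2 3 p u)),
  c 0 * u.2 3 + 2 * (α₁ - α₃)⁻¹ * c 2 * (angMomD 1 3 p u * p.1 1 + angMom 1 3 p * u.1 1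
    + angMomD 2 3 p u * p.1 2 + angMom 2 3 p * u.1 2)]

theorem fderiv_EM_combination (p v : Phase) :
    fderiv ℝ (combination (EM α₀ α₁ α₃) c) p v =
      ∑ i, (gradX α₀ α₁ α₃ c i p * v.1 i + gradY α₀ α₁ α₃ c i p * v.2 i) := by
  have : combination (EM α₀ α₁ α₃) c = fun q => c 0 * H q + c 1 * J q + c 2 * G α₀ α₁ α₃ q := by
    funext q
    simp [combination, EM, Fin.sum_univ_three]
  rw [this]
  simp only [H, J, G, Fin.sum_univ_four, gradX, gradY, angMom, div_eq_mul_inv]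
  simp (disch := fun_prop) [fderiv_fun_add, fderiv_fun_sub, fderiv_fun_mul, fderiv_fun_pow,
    fderiv_fst_coord, fderiv_snd_coord]
  ring

theorem dx_EM_combination (i : Fin 4) :
    dx (combination (EM α₀ α₁ α₃) c) i = gradX α₀ α₁ α₃ c i := by
  funext p
  rw [dx, fderiv_EM_combination]
  simp [Pi.single_apply]

theorem dy_EM_combination (i : Fin 4) :
    dy (combination (EM α₀ α₁ α₃) c) i = gradY α₀ α₁ α₃ c i := by
  funext p
  rw [dy, fderiv_EM_combination]
  simp [Pi.single_apply]

theorem differentiable_gradX (i : Fin 4) : Differentiable ℝ (gradX α₀ α₁ α₃ c i) := by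
  fin_cases i <;> simp only [gradX, angMom] <;> simp <;> fun_prop

theorem differentiable_gradY (i : Fin 4) : Differentiable ℝ (gradY α₀ α₁ α₃ c i) := by
  fin_cases i <;> simp only [gradY, angMom] <;> simp <;> fun_prop

theorem fderiv_gradX (i : Fin 4) (p u : Phase) :
    fderiv ℝ (gradX α₀ α₁ α₃ c i) p u = hessX α₀ α₁ α₃ c p u i := by
  fin_cases i <;> simp only [gradX, hessX, angMom, angMomD] <;>
  simp (disch := fun_prop) [fderiv_fun_add, fderiv_fun_sub, fderiv_fun_mul,
    fderiv_fst_coord, fderiv_snd_coord, -mul_eq_mul_left_iff] <;>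
  ring

theorem fderiv_gradY (i : Fin 4) (p u : Phase) :
    fderiv ℝ (gradY α₀ α₁ α₃ c i) p u = hessY α₀ α₁ α₃ c p u i := by
  fin_cases i <;> simp only [gradY, hessY, angMom, angMomD] <;>
  simp (disch := fun_prop) [fderiv_fun_add, fderiv_fun_sub, fderiv_fun_mul,
    fderiv_fst_coord, fderiv_snd_coord, -mul_eq_mul_left_iff] <;>
  ring

theorem differentiable_EM : Differentiable ℝ (EM α₀ α₁ α₃) := by
  rw [differentiable_pi]
  intro i
  fin_cases i <;> simp [EM, H, J, G, div_eq_mul_inv] <;> fun_prop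

theorem combination_single (F : Phase → Fin 3 → ℝ) (i : Fin 3) :
    combination F (Pi.single i 1) = fun q => F q i := by
  funext q
  simp [combination, Pi.single_apply]

theorem differentiableAt_hamVF_EM {α : Fin 4 → ℝ} {p : Phase} (hD : diracD α p ≠ 0) (i : Fin 3) :
    DifferentiableAt ℝ (hamVF α (fun q => EM α₀ α₁ α₃ q i)) p := by
  rw [← combination_single]
  exact differentiableAt_hamVF hD
    (fun i => by rw [dx_EM_combination]; exact differentiable_gradX _ _ _ _ i p)
    (fun i => by rw [dy_EM_combination]; exact differentiable_gradY _ _ _ _ i p)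

end Gradient

/-! ### The boundary parabolas and the classification of critical points -/

section Ellipsoid

variable {α₀ α₁ α₃ : ℝ} {p : Phase}

theorem mem_phaseSpace_axes : p ∈ phaseSpace (axes α₀ α₁ α₃) ↔
    p.1 0 ^ 2 / α₀ + (p.1 1 ^ 2 + p.1 2 ^ 2) / α₁ + p.1 3 ^ 2 / α₃ = 1 ∧
    p.1 0 * p.2 0 / α₀ + (p.1 1 * p.2 1 + p.1 2 * p.2 2) / α₁ + p.1 3 * p.2 3 / α₃ = 0 := by
  simp only [phaseSpace, C₁, C₂, mem_ofPred_eq, Fin.sum_univ_four, axes]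
  simp only [Matrix.cons_val]
  constructor <;> rintro ⟨h1, h2⟩ <;> constructor <;> linarith [add_div (p.1 1 ^ 2) (p.1 2 ^ 2) α₁,
    add_div (p.1 1 * p.2 1) (p.1 2 * p.2 2) α₁]

theorem mem_tangent_axes {v : Phase} : v ∈ tangent (axes α₀ α₁ α₃) p ↔
    p.1 0 * v.1 0 / α₀ + (p.1 1 * v.1 1 + p.1 2 * v.1 2) / α₁ + p.1 3 * v.1 3 / α₃ = 0 ∧
    (p.2 0 * v.1 0 + p.1 0 * v.2 0) / α₀ + (p.2 1 * v.1 1 + p.1 1 * v.2 1 + p.2 2 * v.1 2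
      + p.1 2 * v.2 2) / α₁ + (p.2 3 * v.1 3 + p.1 3 * v.2 3) / α₃ = 0 := by
  simp only [mem_tangent, Fin.sum_univ_four, axes, Matrix.cons_val]
  constructor <;> rintro ⟨h1, h2⟩ <;> constructor
  · rw [← h1]; ring
  · rw [← h2]; ring
  · rw [← h1]; ring
  · rw [← h2]; ring

theorem diracD_ne_zero {α : Fin 4 → ℝ} (hp : p ∈ phaseSpace α) : diracD α p ≠ 0 := by
  intro hD
  have h := (Finset.sum_eq_zero_iff_of_nonneg (fun i _ => by positivity)).1 hD
  have h1 : ∑ i, p.1 i ^ 2 / α i - 1 = 0 := hp.1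
  have h2 : ∀ i, p.1 i ^ 2 / α i = 0 := fun i => by
    have := h i (Finset.mem_univ i)
    rw [← div_pow, sq_eq_zero_iff, div_eq_zero_iff] at this
    rcases this with h | h <;> simp [h]
  simp [h2] at h1

/-- Lagrange multipliers for the two constraints of the phase space. -/
theorem exists_multipliers {α : Fin 4 → ℝ} {f : Phase → ℝ}
    (hf : ∀ v ∈ tangent α p, fderiv ℝ f p v = 0) :
    ∃ l μ : ℝ, ∀ i, dx f i p = l * (p.1 i / α i) + μ * (p.2 i / α i) ∧
      dy f i p = μ * (p.1 i / α i) := by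
  have h : (fderiv ℝ f p : Phase →ₗ[ℝ] ℝ) ∈ Submodule.span ℝ
      (range ![(fderiv ℝ (C₁ α) p : Phase →ₗ[ℝ] ℝ), (fderiv ℝ (C₂ α) p : Phase →ₗ[ℝ] ℝ)]) := by
    apply mem_span_of_iInf_ker_le_ker
    intro v hv
    simp only [Submodule.mem_iInf, Fin.forall_fin_two] at hv
    exact hf v hv
  rw [Submodule.mem_span_range_iff_exists_fun] at h
  obtain ⟨t, ht⟩ := h
  have hv : ∀ v, fderiv ℝ f p v = t 0 * (2 * ∑ i, p.1 i * v.1 i / α i) +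
      t 1 * ∑ i, (p.2 i * v.1 i + p.1 i * v.2 i) / α i := fun v => by
    have := congrArg (fun L : Phase →ₗ[ℝ] ℝ => L v) ht
    simp only [Fin.sum_univ_two] at this
    rw [← fderiv_C₁, ← fderiv_C₂]
    exact this.symm
  refine ⟨2 * t 0, t 1, fun i => ⟨?_, ?_⟩⟩
  · rw [dx, hv]
    simp [Pi.single_apply, ite_div]
    ring
  · rw [dy, hv]
    simp [Pi.single_apply, ite_div]

/-- At a critical point of a combination of the integrals the multiplier of the second constraint
vanishes: it is computed by pairing the momentum gradient with the normal vector `x / α`, and this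
pairing is zero on the phase space. -/
theorem critSpace_multiplier {c : Fin 3 → ℝ} (h01 : α₀ ≠ α₁) (h13 : α₁ ≠ α₃) (h0 : α₀ ≠ 0)
    (h1 : α₁ ≠ 0) (h3 : α₃ ≠ 0)
    (hp : p ∈ phaseSpace (axes α₀ α₁ α₃))
    (hc : c ∈ critSpace (axes α₀ α₁ α₃) (EM α₀ α₁ α₃) p) :
    ∃ l : ℝ, ∀ i, gradX α₀ α₁ α₃ c i p = l * (p.1 i / axes α₀ α₁ α₃ i) ∧
      gradY α₀ α₁ α₃ c i p = 0 := by
  obtain ⟨l, μ, h⟩ := exists_multipliers (f := combination (EM α₀ α₁ α₃) c) fun v hv => by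
    rw [fderiv_combination (differentiable_EM _ _ _ p)]; exact hc v hv
  simp only [dx_EM_combination, dy_EM_combination] at h
  obtain ⟨m1, m2⟩ := mem_phaseSpace_axes.1 hp
  have hμ : μ = 0 := by
    have hD := diracD_ne_zero hp
    have : μ * diracD (axes α₀ α₁ α₃) p = 0 := by
      have e0 := (h 0).2
      have e1 := (h 1).2
      have e2 := (h 2).2
      have e3 := (h 3).2
      simp only [diracD, Fin.sum_univ_four]
      simp only [gradY, axes, angMom, Matrix.cons_val] at e0 e1 e2 e3 ⊢
      have k0 : α₁ - α₀ ≠ 0 := sub_ne_zero.2 h01.symm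
      have k3 : α₁ - α₃ ≠ 0 := sub_ne_zero.2 h13
      have g0 : (α₁ - α₀)⁻¹ * (α₀⁻¹ - α₁⁻¹) = α₀⁻¹ * α₁⁻¹ := by field_simp
      have g3 : (α₁ - α₃)⁻¹ * (α₃⁻¹ - α₁⁻¹) = α₃⁻¹ * α₁⁻¹ := by field_simp
      have : μ * (p.1 0 ^ 2 / α₀ ^ 2 + p.1 1 ^ 2 / α₁ ^ 2 + p.1 2 ^ 2 / α₁ ^ 2
          + p.1 3 ^ 2 / α₃ ^ 2) = p.1 0 / α₀ * (μ * (p.1 0 / α₀)) + p.1 1 / α₁ * (μ * (p.1 1 / α₁))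
          + p.1 2 / α₁ * (μ * (p.1 2 / α₁)) + p.1 3 / α₃ * (μ * (p.1 3 / α₃)) := by ring
      rw [this, ← e0, ← e1, ← e2, ← e3]
      simp only [div_eq_mul_inv] at m1 m2 ⊢
      linear_combination (c 0 + 2 * c 2 * α₁⁻¹ * (p.1 1 ^ 2 + p.1 2 ^ 2)) * m2
        - 2 * c 2 * α₁⁻¹ * (p.1 1 * p.2 1 + p.1 2 * p.2 2) * m1
        - 2 * c 2 * p.1 0 * ((p.1 0 * p.2 1 - p.1 1 * p.2 0) * p.1 1
          + (p.1 0 * p.2 2 - p.1 2 * p.2 0) * p.1 2) * g0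
        + 2 * c 2 * p.1 3 * ((p.1 1 * p.2 3 - p.1 3 * p.2 1) * p.1 1
          + (p.1 2 * p.2 3 - p.1 3 * p.2 2) * p.1 2) * g3
    exact (mul_eq_zero.1 this).resolve_right hD
  subst hμ
  exact ⟨l, fun i => by simpa using h i⟩

/-- The form of `G` in which all denominators are positive. -/
theorem G_eq (p : Phase) : G α₀ α₁ α₃ p = p.2 1 ^ 2 + p.2 2 ^ 2
    + (angMom 0 1 p ^ 2 + angMom 0 2 p ^ 2) / (α₁ - α₀)
    - (angMom 1 3 p ^ 2 + angMom 2 3 p ^ 2) / (α₃ - α₁) := by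
  have e : (α₁ - α₃)⁻¹ = -(α₃ - α₁)⁻¹ := by rw [← inv_neg, neg_sub]
  simp only [G, angMom, div_eq_mul_inv, e]
  ring

/-- All terms on the right are nonnegative; each of them vanishes where `x₃ = y₃ = 0`. -/
theorem upperCurve_sub_G (h0 : 0 < α₀) (h01 : α₀ < α₁) (h13 : α₁ < α₃)
    (hp : p ∈ phaseSpace (axes α₀ α₁ α₃)) :
    (α₁ - α₀) * (upperCurve α₀ α₁ (H p) (J p) - G α₀ α₁ α₃ p) =
      α₁ * p.2 3 ^ 2 + p.1 3 ^ 2 * (α₀ * (p.2 1 ^ 2 + p.2 2 ^ 2) + α₁ * p.2 0 ^ 2) / α₃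
      + α₀ * α₁ * (p.1 3 * p.2 3 / α₃) ^ 2
      + (α₁ - α₀) / (α₃ - α₁) * (angMom 1 3 p ^ 2 + angMom 2 3 p ^ 2) := by
  obtain ⟨m1, m2⟩ := mem_phaseSpace_axes.1 hp
  have k0 : α₁ - α₀ ≠ 0 := by linarith
  have k3 : α₃ - α₁ ≠ 0 := by linarith
  have h1 : 0 < α₁ := h0.trans h01
  have h3 : 0 < α₃ := h1.trans h13
  have hu : (α₁ - α₀) * upperCurve α₀ α₁ (H p) (J p) = 2 * α₁ * H p - α₀ / α₁ * J p ^ 2 := by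
    rw [upperCurve]; field_simp
  have hG : (α₁ - α₀) * G α₀ α₁ α₃ p = (α₁ - α₀) * (p.2 1 ^ 2 + p.2 2 ^ 2) +
      angMom 0 1 p ^ 2 + angMom 0 2 p ^ 2
      - (α₁ - α₀) / (α₃ - α₁) * (angMom 1 3 p ^ 2 + angMom 2 3 p ^ 2) := by
    rw [G_eq]
    field_simp
    ring
  rw [mul_sub, hu, hG]
  simp only [H, J, angMom]
  have f1 : α₀ * α₀⁻¹ = 1 := mul_inv_cancel₀ h0.ne'
  have f2 : α₁ * α₁⁻¹ = 1 := mul_inv_cancel₀ h1.ne'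
  simp only [div_eq_mul_inv] at m1 m2 ⊢
  linear_combination -(α₀ * (p.2 1 ^ 2 + p.2 2 ^ 2) + α₁ * p.2 0 ^ 2) * m1
    + (p.2 1 ^ 2 + p.2 2 ^ 2) * p.1 0 ^ 2 * f1 + p.2 0 ^ 2 * (p.1 1 ^ 2 + p.1 2 ^ 2) * f2
    + α₀ * α₁ * (p.1 0 * p.2 0 * α₀⁻¹ + (p.1 1 * p.2 1 + p.1 2 * p.2 2) * α₁⁻¹
      - p.1 3 * p.2 3 * α₃⁻¹) * m2
    - α₁ * α₀⁻¹ * (p.1 0 * p.2 0) ^ 2 * f1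
    - 2 * (p.1 0 * p.2 0) * (p.1 1 * p.2 1 + p.1 2 * p.2 2) * (α₀ * α₀⁻¹ * f2 + f1)
    - α₀ * α₁⁻¹ * (p.1 1 * p.2 1 + p.1 2 * p.2 2) ^ 2 * f2

/-- All terms on the right are nonnegative; each of them vanishes where `x₀ = y₀ = 0`. -/
theorem G_sub_lowerCurve (h0 : 0 < α₀) (h01 : α₀ < α₁) (h13 : α₁ < α₃)
    (hp : p ∈ phaseSpace (axes α₀ α₁ α₃)) :
    (α₃ - α₁) * (G α₀ α₁ α₃ p - lowerCurve α₁ α₃ (H p) (J p)) =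
      α₁ * p.2 0 ^ 2 + p.1 0 ^ 2 * (α₃ * (p.2 1 ^ 2 + p.2 2 ^ 2) + α₁ * p.2 3 ^ 2) / α₀
      + α₃ * α₁ * (p.1 0 * p.2 0 / α₀) ^ 2
      + (α₃ - α₁) / (α₁ - α₀) * (angMom 0 1 p ^ 2 + angMom 0 2 p ^ 2) := by
  obtain ⟨m1, m2⟩ := mem_phaseSpace_axes.1 hp
  have k0 : α₁ - α₀ ≠ 0 := by linarith
  have k3 : α₃ - α₁ ≠ 0 := by linarith
  have h1 : 0 < α₁ := h0.trans h01
  have h3 : 0 < α₃ := h1.trans h13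
  have hl : (α₃ - α₁) * lowerCurve α₁ α₃ (H p) (J p) = -(2 * α₁ * H p) + α₃ / α₁ * J p ^ 2 := by
    have : α₁ - α₃ ≠ 0 := by linarith
    rw [lowerCurve]; field_simp; ring
  have hG : (α₃ - α₁) * G α₀ α₁ α₃ p = (α₃ - α₁) * (p.2 1 ^ 2 + p.2 2 ^ 2) -
      angMom 1 3 p ^ 2 - angMom 2 3 p ^ 2
      + (α₃ - α₁) / (α₁ - α₀) * (angMom 0 1 p ^ 2 + angMom 0 2 p ^ 2) := by
    rw [G_eq]
    field_simp
    ring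
  rw [mul_sub, hl, hG]
  simp only [H, J, angMom]
  have f1 : α₃ * α₃⁻¹ = 1 := mul_inv_cancel₀ h3.ne'
  have f2 : α₁ * α₁⁻¹ = 1 := mul_inv_cancel₀ h1.ne'
  simp only [div_eq_mul_inv] at m1 m2 ⊢
  linear_combination -(α₃ * (p.2 1 ^ 2 + p.2 2 ^ 2) + α₁ * p.2 3 ^ 2) * m1
    + (p.2 1 ^ 2 + p.2 2 ^ 2) * p.1 3 ^ 2 * f1 + p.2 3 ^ 2 * (p.1 1 ^ 2 + p.1 2 ^ 2) * f2
    + α₃ * α₁ * (p.1 3 * p.2 3 * α₃⁻¹ + (p.1 1 * p.2 1 + p.1 2 * p.2 2) * α₁⁻¹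
      - p.1 0 * p.2 0 * α₀⁻¹) * m2
    - α₁ * α₃⁻¹ * (p.1 3 * p.2 3) ^ 2 * f1
    - 2 * (p.1 3 * p.2 3) * (p.1 1 * p.2 1 + p.1 2 * p.2 2) * (α₃ * α₃⁻¹ * f2 + f1)
    - α₃ * α₁⁻¹ * (p.1 1 * p.2 1 + p.1 2 * p.2 2) ^ 2 * f2

theorem mem_region_of_mem_phaseSpace (h0 : 0 < α₀) (h01 : α₀ < α₁) (h13 : α₁ < α₃)
    (hp : p ∈ phaseSpace (axes α₀ α₁ α₃)) : (J p, G α₀ α₁ α₃ p) ∈ region α₀ α₁ α₃ (H p) := by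
  have k0 : 0 < α₁ - α₀ := by linarith
  have k3 : 0 < α₃ - α₁ := by linarith
  have h1 : 0 < α₁ := h0.trans h01
  have h3 : 0 < α₃ := h1.trans h13
  constructor
  · have : 0 ≤ (α₃ - α₁) * (G α₀ α₁ α₃ p - lowerCurve α₁ α₃ (H p) (J p)) := by
      rw [G_sub_lowerCurve h0 h01 h13 hp]; positivity
    exact sub_nonneg.1 (nonneg_of_mul_nonneg_right this k3)
  · have : 0 ≤ (α₁ - α₀) * (upperCurve α₀ α₁ (H p) (J p) - G α₀ α₁ α₃ p) := by
      rw [upperCurve_sub_G h0 h01 h13 hp]; positivity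
    exact sub_nonneg.1 (nonneg_of_mul_nonneg_right this k0)

theorem eq_upperCurve_iff (h0 : 0 < α₀) (h01 : α₀ < α₁) (h13 : α₁ < α₃)
    (hp : p ∈ phaseSpace (axes α₀ α₁ α₃)) (hH : 0 < H p) :
    G α₀ α₁ α₃ p = upperCurve α₀ α₁ (H p) (J p) ↔ p.1 3 = 0 ∧ p.2 3 = 0 := by
  have k0 : 0 < α₁ - α₀ := by linarith
  have k3 : 0 < α₃ - α₁ := by linarith
  have h1 : 0 < α₁ := h0.trans h01
  have h3 : 0 < α₃ := h1.trans h13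
  have key := upperCurve_sub_G h0 h01 h13 hp
  have hsq : 0 ≤ (α₁ - α₀) / (α₃ - α₁) * (angMom 1 3 p ^ 2 + angMom 2 3 p ^ 2) := by positivity
  constructor
  · intro h
    rw [h, sub_self, mul_zero] at key
    have t1 : 0 ≤ α₁ * p.2 3 ^ 2 := by positivity
    have t2 : 0 ≤ p.1 3 ^ 2 * (α₀ * (p.2 1 ^ 2 + p.2 2 ^ 2) + α₁ * p.2 0 ^ 2) / α₃ := by
      positivity
    have t3 : 0 ≤ α₀ * α₁ * (p.1 3 * p.2 3 / α₃) ^ 2 := by positivity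
    have hy : p.2 3 = 0 := by
      have : α₁ * p.2 3 ^ 2 = 0 := by linarith
      simpa [h1.ne'] using this
    refine ⟨?_, hy⟩
    have : p.1 3 ^ 2 * (α₀ * (p.2 1 ^ 2 + p.2 2 ^ 2) + α₁ * p.2 0 ^ 2) / α₃ = 0 := by linarith
    rw [div_eq_zero_iff, mul_eq_zero, sq_eq_zero_iff] at this
    rcases this with (h | h) | h
    · exact h
    · exfalso
      have u1 : p.2 1 ^ 2 + p.2 2 ^ 2 = 0 := by
        have a1 : 0 ≤ α₀ * (p.2 1 ^ 2 + p.2 2 ^ 2) := by positivity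
        have a2 : 0 ≤ α₁ * p.2 0 ^ 2 := by positivity
        have : α₀ * (p.2 1 ^ 2 + p.2 2 ^ 2) = 0 := by linarith
        exact (mul_eq_zero.1 this).resolve_left h0.ne'
      have u2 : p.2 0 ^ 2 = 0 := by
        rw [u1, mul_zero, zero_add] at h
        exact (mul_eq_zero.1 h).resolve_left h1.ne'
      rw [H, hy, u2] at hH
      linarith
    · exact absurd h h3.ne'
  · rintro ⟨hx, hy⟩
    have : (α₁ - α₀) * (upperCurve α₀ α₁ (H p) (J p) - G α₀ α₁ α₃ p) = 0 := by
      rw [key]; simp [angMom, hx, hy]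
    exact (sub_eq_zero.1 ((mul_eq_zero.1 this).resolve_left k0.ne')).symm

theorem eq_lowerCurve_iff (h0 : 0 < α₀) (h01 : α₀ < α₁) (h13 : α₁ < α₃)
    (hp : p ∈ phaseSpace (axes α₀ α₁ α₃)) (hH : 0 < H p) :
    G α₀ α₁ α₃ p = lowerCurve α₁ α₃ (H p) (J p) ↔ p.1 0 = 0 ∧ p.2 0 = 0 := by
  have k0 : 0 < α₁ - α₀ := by linarith
  have k3 : 0 < α₃ - α₁ := by linarith
  have h1 : 0 < α₁ := h0.trans h01
  have h3 : 0 < α₃ := h1.trans h13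
  have key := G_sub_lowerCurve h0 h01 h13 hp
  have hsq : 0 ≤ (α₃ - α₁) / (α₁ - α₀) * (angMom 0 1 p ^ 2 + angMom 0 2 p ^ 2) := by positivity
  constructor
  · intro h
    rw [h, sub_self, mul_zero] at key
    have t1 : 0 ≤ α₁ * p.2 0 ^ 2 := by positivity
    have t2 : 0 ≤ p.1 0 ^ 2 * (α₃ * (p.2 1 ^ 2 + p.2 2 ^ 2) + α₁ * p.2 3 ^ 2) / α₀ := by
      positivity
    have t3 : 0 ≤ α₃ * α₁ * (p.1 0 * p.2 0 / α₀) ^ 2 := by positivity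
    have hy : p.2 0 = 0 := by
      have : α₁ * p.2 0 ^ 2 = 0 := by linarith
      simpa [h1.ne'] using this
    refine ⟨?_, hy⟩
    have : p.1 0 ^ 2 * (α₃ * (p.2 1 ^ 2 + p.2 2 ^ 2) + α₁ * p.2 3 ^ 2) / α₀ = 0 := by linarith
    rw [div_eq_zero_iff, mul_eq_zero, sq_eq_zero_iff] at this
    rcases this with (h | h) | h
    · exact h
    · exfalso
      have u1 : p.2 1 ^ 2 + p.2 2 ^ 2 = 0 := by
        have a1 : 0 ≤ α₃ * (p.2 1 ^ 2 + p.2 2 ^ 2) := by positivity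
        have a2 : 0 ≤ α₁ * p.2 3 ^ 2 := by positivity
        have : α₃ * (p.2 1 ^ 2 + p.2 2 ^ 2) = 0 := by linarith
        exact (mul_eq_zero.1 this).resolve_left h3.ne'
      have u2 : p.2 3 ^ 2 = 0 := by
        rw [u1, mul_zero, zero_add] at h
        exact (mul_eq_zero.1 h).resolve_left h1.ne'
      rw [H, hy, u2] at hH
      linarith
    · exact absurd h h0.ne'
  · rintro ⟨hx, hy⟩
    have : (α₃ - α₁) * (G α₀ α₁ α₃ p - lowerCurve α₁ α₃ (H p) (J p)) = 0 := by
      rw [key]; simp [angMom, hx, hy]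
    exact sub_eq_zero.1 ((mul_eq_zero.1 this).resolve_left k3.ne')

theorem eq_zero_of_sq_add_sq_eq_zero {a b : ℝ} (h : a ^ 2 + b ^ 2 = 0) : a = 0 ∧ b = 0 := by
  constructor <;> nlinarith [sq_nonneg a, sq_nonneg b]

/-- The critical points of combinations that involve `G`: the point lies over one of the
boundary arcs or in the plane of the coordinates `0`, `3`. -/
theorem critical_classification (h0 : 0 < α₀) (h01 : α₀ < α₁) (h13 : α₁ < α₃)
    (hp : p ∈ phaseSpace (axes α₀ α₁ α₃)) (hH : 0 < H p) {c : Fin 3 → ℝ} (hc2 : c 2 ≠ 0)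
    (hc : c ∈ critSpace (axes α₀ α₁ α₃) (EM α₀ α₁ α₃) p) :
    (p.1 3 = 0 ∧ p.2 3 = 0) ∨ (p.1 0 = 0 ∧ p.2 0 = 0) ∨
      (p.1 1 = 0 ∧ p.1 2 = 0 ∧ p.2 1 = 0 ∧ p.2 2 = 0) := by
  -- with this normalisation the gradients have no factors `2`
  wlog h2 : c 2 = 1 / 2 generalizing c
  · refine this (c := (1 / (2 * c 2)) • c) ?_ (Submodule.smul_mem _ _ hc) ?_
    · simp [hc2]
    · simp only [Pi.smul_apply, smul_eq_mul]; field_simp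
  have h1 : 0 < α₁ := h0.trans h01
  have h3 : 0 < α₃ := h1.trans h13
  have k0 : α₁ - α₀ ≠ 0 := by linarith
  have k3 : α₁ - α₃ ≠ 0 := by linarith
  obtain ⟨l, hl⟩ := critSpace_multiplier h01.ne h13.ne h0.ne' h1.ne' h3.ne' hp hc
  obtain ⟨m1, m2⟩ := mem_phaseSpace_axes.1 hp
  by_contra hcon
  obtain ⟨n3, n0, n12⟩ : ¬(p.1 3 = 0 ∧ p.2 3 = 0) ∧ ¬(p.1 0 = 0 ∧ p.2 0 = 0) ∧
      ¬(p.1 1 = 0 ∧ p.1 2 = 0 ∧ p.2 1 = 0 ∧ p.2 2 = 0) := by tauto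
  have x0 := (hl 0).1
  have x1 := (hl 1).1
  have x2 := (hl 2).1
  have x3 := (hl 3).1
  have y0 := (hl 0).2
  have y1 := (hl 1).2
  have y2 := (hl 2).2
  have y3 := (hl 3).2
  simp only [gradX, gradY, axes, angMom, Matrix.cons_val, h2] at x0 x1 x2 x3 y0 y1 y2 y3
  have hE : 2 * H p = p.2 0 ^ 2 + p.2 1 ^ 2 + p.2 2 ^ 2 + p.2 3 ^ 2 := by rw [H]; ring
  have hJ : J p = p.1 1 * p.2 2 - p.1 2 * p.2 1 := rfl
  generalize H p = h at *
  generalize J p = j at *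
  generalize c 0 = c₀ at *
  generalize c 1 = c₁ at *
  obtain ⟨x, y⟩ := p
  simp only at *
  -- `r`, `m`, `s` are the scalar products of `(x₁, x₂)` and `(y₁, y₂)`
  obtain ⟨r, hr⟩ : ∃ r, r = x 1 ^ 2 + x 2 ^ 2 := ⟨_, rfl⟩
  obtain ⟨m, hm⟩ : ∃ m, m = y 1 ^ 2 + y 2 ^ 2 := ⟨_, rfl⟩
  obtain ⟨s, hs⟩ : ∃ s, s = x 1 * y 1 + x 2 * y 2 := ⟨_, rfl⟩
  have hj : j ^ 2 = r * m - s ^ 2 := by rw [hJ, hr, hm, hs]; ring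
  -- the difference of the homogeneity relations for the momenta and the positions
  have euler : l + m + 2 * h * c₀ = 0 := by
    rw [hE, hm]
    linear_combination y 0 * y0 + y 1 * y1 + y 2 * y2 + y 3 * y3
      - x 0 * x0 - x 1 * x1 - x 2 * x2 - x 3 * x3 - l * m1
  have q0 := mul_inv_cancel₀ k0
  have q3 := mul_inv_cancel₀ k3
  have e1 : x 0 * (m - l * (α₁ - α₀) / α₀) = s * y 0 := by
    rw [hm, hs]
    linear_combination (α₁ - α₀) * x0
      - ((x 0 * y 1 - x 1 * y 0) * y 1 + (x 0 * y 2 - x 2 * y 0) * y 2) * q0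
  have e2 : y 0 * (r + c₀ * (α₁ - α₀)) = x 0 * s := by
    rw [hr, hs]
    linear_combination (α₁ - α₀) * y0
      + ((x 0 * y 1 - x 1 * y 0) * x 1 + (x 0 * y 2 - x 2 * y 0) * x 2) * q0
  have e3 : x 3 * (m + l * (α₃ - α₁) / α₃) = s * y 3 := by
    rw [hm, hs]
    linear_combination (α₁ - α₃) * x3
      + ((x 1 * y 3 - x 3 * y 1) * y 1 + (x 2 * y 3 - x 3 * y 2) * y 2) * q3
  have e4 : y 3 * (r - c₀ * (α₃ - α₁)) = x 3 * s := by
    rw [hr, hs]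
    linear_combination (α₁ - α₃) * y3
      - ((x 1 * y 3 - x 3 * y 1) * x 1 + (x 2 * y 3 - x 3 * y 2) * x 2) * q3
  -- as `(x₀, y₀) ≠ 0` and `(x₃, y₃) ≠ 0`, the two linear systems are singular
  have d0 : s ^ 2 = (m - l * (α₁ - α₀) / α₀) * (r + c₀ * (α₁ - α₀)) := by
    by_cases hx : x 0 = 0
    · have hy : y 0 ≠ 0 := fun hy => n0 ⟨hx, hy⟩
      apply mul_left_cancel₀ hy
      linear_combination -s * e1 - (m - l * (α₁ - α₀) / α₀) * e2
    · apply mul_left_cancel₀ hx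
      linear_combination -s * e2 - (r + c₀ * (α₁ - α₀)) * e1
  have d3 : s ^ 2 = (m + l * (α₃ - α₁) / α₃) * (r - c₀ * (α₃ - α₁)) := by
    by_cases hx : x 3 = 0
    · have hy : y 3 ≠ 0 := fun hy => n3 ⟨hx, hy⟩
      apply mul_left_cancel₀ hy
      linear_combination -s * e3 - (m + l * (α₃ - α₁) / α₃) * e4
    · apply mul_left_cancel₀ hx
      linear_combination -s * e4 - (r - c₀ * (α₃ - α₁)) * e3
  have i0 : α₀ * j ^ 2 + (α₁ - α₀) * (α₀ * m * c₀ - l * (r + c₀ * (α₁ - α₀))) = 0 := by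
    field_simp at d0
    rw [hj]; linear_combination -d0
  have i3 : α₃ * j ^ 2 - (α₃ - α₁) * (α₃ * m * c₀ - l * (r - c₀ * (α₃ - α₁))) = 0 := by
    field_simp at d3
    rw [hj]; linear_combination -d3
  have iv : α₀ * α₃ * j ^ 2 = (α₁ - α₀) * (α₃ - α₁) * (l * (α₁ * c₀ + r)) := by
    have : α₃ - α₀ ≠ 0 := by linarith
    apply mul_left_cancel₀ this
    linear_combination α₃ * (α₃ - α₁) * i0 + α₀ * (α₁ - α₀) * i3
  have v : α₀ * α₃ * c₀ * m = l * (α₁ * r + c₀ * (α₁ ^ 2 - α₀ * α₃)) := by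
    have : α₃ - α₀ ≠ 0 := by linarith
    apply mul_left_cancel₀ this
    linear_combination α₃ * i0 - α₀ * i3
  -- eliminating `l * (α₁ * c₀ + r)` leaves a sum of two squares
  have fin : α₀ * α₃ * α₁ * j ^ 2 +
      2 * h * α₀ * α₃ * ((α₁ - α₀) * (α₃ - α₁)) * c₀ ^ 2 = 0 := by
    linear_combination α₁ * iv - (α₁ - α₀) * (α₃ - α₁) * v
      + (α₁ - α₀) * (α₃ - α₁) * α₀ * α₃ * c₀ * euler
  have p0 : 0 < α₁ - α₀ := by linarith
  have p3 : 0 < α₃ - α₁ := by linarith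
  have t1 : 0 ≤ α₀ * α₃ * α₁ * j ^ 2 := by positivity
  have t2 : 0 ≤ 2 * h * α₀ * α₃ * ((α₁ - α₀) * (α₃ - α₁)) * c₀ ^ 2 := by positivity
  have hj0 : j = 0 := by
    have : α₀ * α₃ * α₁ * j ^ 2 = 0 := by linarith
    simpa [h0.ne', h1.ne', h3.ne'] using this
  have hc0 : c₀ = 0 := by
    have : 2 * h * α₀ * α₃ * ((α₁ - α₀) * (α₃ - α₁)) * c₀ ^ 2 = 0 := by linarith
    simpa [h0.ne', h3.ne', hH.ne', p0.ne', p3.ne'] using this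
  subst hc0 hj0
  -- the remaining cases `m = 0` and `r = 0` contradict `h > 0` and the ellipsoid equation
  have hlm : l = -m := by linarith
  have hmr : m * r = 0 := by
    have : (α₁ - α₀) * (α₃ - α₁) * (m * r) = 0 := by rw [hlm] at iv; linarith
    simpa [p0.ne', p3.ne'] using this
  have hs0 : s = 0 := by
    have : s ^ 2 = 0 := by linarith
    simpa using this
  rw [hs0] at e1 e2 e3 e4
  rcases mul_eq_zero.1 hmr with hm0 | hr0
  · obtain ⟨a1, a2⟩ := eq_zero_of_sq_add_sq_eq_zero (hm.symm.trans hm0)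
    have hr0 : r ≠ 0 := fun hr0 => by
      obtain ⟨b1, b2⟩ := eq_zero_of_sq_add_sq_eq_zero (hr.symm.trans hr0)
      exact n12 ⟨b1, b2, a1, a2⟩
    have a0 : y 0 = 0 := by simpa [hr0] using e2
    have a3 : y 3 = 0 := by simpa [hr0] using e4
    rw [a0, a1, a2, a3] at hE
    linarith
  · obtain ⟨a1, a2⟩ := eq_zero_of_sq_add_sq_eq_zero (hr.symm.trans hr0)
    have hm0 : m ≠ 0 := fun hm0 => by
      obtain ⟨b1, b2⟩ := eq_zero_of_sq_add_sq_eq_zero (hm.symm.trans hm0)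
      exact n12 ⟨a1, a2, b1, b2⟩
    have a0 : x 0 = 0 := by
      have : x 0 * (m * α₁) = 0 := by
        rw [hlm] at e1; field_simp at e1; linear_combination e1
      simpa [hm0, h1.ne'] using this
    have a3 : x 3 = 0 := by
      have : x 3 * (m * α₁) = 0 := by
        rw [hlm] at e3; field_simp at e3; linear_combination e3
      simpa [hm0, h1.ne'] using this
    rw [a0, a1, a2, a3] at m1
    norm_num at m1

end Ellipsoid

/-! ### Reduced spaces at the critical points of the energy-momentum map -/

section Singular

variable {α₀ α₁ α₃ : ℝ} {p : Phase}

theorem fderiv_EM_apply (p v : Phase) (i : Fin 3) : fderiv ℝ (EM α₀ α₁ α₃) p v i =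
    ∑ k, (gradX α₀ α₁ α₃ (Pi.single i 1) k p * v.1 k
      + gradY α₀ α₁ α₃ (Pi.single i 1) k p * v.2 k) := by
  rw [← fderiv_EM_combination, combination_single,
    fderiv_component (differentiable_EM _ _ _ p)]

theorem fderiv_EM_zero (p v : Phase) : fderiv ℝ (EM α₀ α₁ α₃) p v 0 =
    p.2 0 * v.2 0 + p.2 1 * v.2 1 + p.2 2 * v.2 2 + p.2 3 * v.2 3 := by
  rw [fderiv_EM_apply]
  simp [Fin.sum_univ_four, gradX, gradY]

theorem fderiv_EM_one (p v : Phase) : fderiv ℝ (EM α₀ α₁ α₃) p v 1 = angMomD 1 2 p v := by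
  rw [fderiv_EM_apply]
  simp [Fin.sum_univ_four, gradX, gradY, angMomD]
  ring

/-- The multiplier is written `2 * l` because `C₁` has the gradient `2 x / α`. -/
theorem mem_critSpace_of_multiplier {α : Fin 4 → ℝ} {c : Fin 3 → ℝ} {l : ℝ}
    (h : ∀ i, gradX α₀ α₁ α₃ c i p = 2 * l * (p.1 i / α i) ∧ gradY α₀ α₁ α₃ c i p = 0) :
    c ∈ critSpace α (EM α₀ α₁ α₃) p := by
  intro v hv
  rw [← fderiv_combination (differentiable_EM _ _ _ p), fderiv_EM_combination]
  have h1 := (mem_tangent.1 hv).1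
  simp only [Fin.sum_univ_four] at h1 ⊢
  rw [(h 0).1, (h 1).1, (h 2).1, (h 3).1, (h 0).2, (h 1).2, (h 2).2, (h 3).2]
  linear_combination 2 * l * h1

theorem hamVF_combination_eq_zero {α : Fin 4 → ℝ} {c : Fin 3 → ℝ} {l : ℝ} (hD : diracD α p ≠ 0)
    (h : ∀ i, gradX α₀ α₁ α₃ c i p = 2 * l * (p.1 i / α i) ∧ gradY α₀ α₁ α₃ c i p = 0) :
    hamVF α (combination (EM α₀ α₁ α₃) c) p = 0 := by
  have hP : multP α (combination (EM α₀ α₁ α₃) c) p = 0 := by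
    simp [multP, dy_EM_combination, fun i => (h i).2]
  have hQ : multQ α (combination (EM α₀ α₁ α₃) c) p = 2 * l := by
    rw [multQ, div_eq_iff hD]
    simp only [dx_EM_combination, dy_EM_combination, fun i => (h i).1, fun i => (h i).2, diracD,
      Fin.sum_univ_four]
    ring
  rw [hamVF_eq, hP, hQ]
  simp only [dx_EM_combination, dy_EM_combination, fun i => (h i).1, fun i => (h i).2]
  apply Prod.ext <;> funext i <;> simp

/-- Where a combination involving `G` is critical, the differential of `G` depends on those of
`H` and `J`. -/
theorem mem_kerSpace_iff {α : Fin 4 → ℝ} {c : Fin 3 → ℝ} (hc : c ∈ critSpace α (EM α₀ α₁ α₃) p)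
    (hc2 : c 2 ≠ 0) {v : Phase} : v ∈ kerSpace α (EM α₀ α₁ α₃) p ↔ v ∈ tangent α p ∧
      p.2 0 * v.2 0 + p.2 1 * v.2 1 + p.2 2 * v.2 2 + p.2 3 * v.2 3 = 0 ∧
      angMomD 1 2 p v = 0 := by
  rw [← fderiv_EM_zero (α₀ := α₀) (α₁ := α₁) (α₃ := α₃), ← fderiv_EM_one (α₀ := α₀) (α₁ := α₁)
    (α₃ := α₃), kerSpace, Submodule.mem_inf]
  refine and_congr_right fun hv => ?_
  have hsum := hc v hv
  rw [Fin.sum_univ_three] at hsum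
  rw [LinearMap.mem_ker, ContinuousLinearMap.coe_coe]
  constructor
  · intro h; simp [h]
  · rintro ⟨h0, h1⟩
    have h2 : fderiv ℝ (EM α₀ α₁ α₃) p v 2 = 0 := by
      rw [h0, h1] at hsum
      simpa [hc2] using hsum
    funext i
    fin_cases i
    · exact h0
    · exact h1
    · exact h2

/-- The geodesic equations: the acceleration is normal to the ellipsoid. -/
theorem hamVF_H {α : Fin 4 → ℝ} (hp : p ∈ phaseSpace α) :
    ∃ Q : ℝ, hamVF α (fun q => EM α₀ α₁ α₃ q 0) p = (p.2, fun i => Q * (p.1 i / α i)) := by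
  have hP : multP α (fun q => EM α₀ α₁ α₃ q 0) p = 0 := by
    have : ∑ i, p.1 i * p.2 i / α i = 0 := hp.2
    rw [← combination_single, multP]
    simp only [dy_EM_combination, Fin.sum_univ_four] at this ⊢
    rw [div_eq_zero_iff]
    left
    simp [gradY]
    linear_combination this
  refine ⟨multQ α (fun q => EM α₀ α₁ α₃ q 0) p, ?_⟩
  rw [hamVF_eq, hP, ← combination_single]
  simp only [dx_EM_combination, dy_EM_combination]
  apply Prod.ext <;> funext i <;> fin_cases i <;> simp [gradX, gradY]

/-- `J` generates the rotations in the plane of the coordinates `1`, `2`. -/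
theorem hamVF_J : hamVF (axes α₀ α₁ α₃) (fun q => EM α₀ α₁ α₃ q 1) p =
    (![0, -p.1 2, p.1 1, 0], ![0, -p.2 2, p.2 1, 0]) := by
  have hP : multP (axes α₀ α₁ α₃) (fun q => EM α₀ α₁ α₃ q 1) p = 0 := by
    rw [← combination_single, multP]
    simp only [dy_EM_combination, Fin.sum_univ_four]
    rw [div_eq_zero_iff]
    left
    simp [gradY, axes]
    ring
  have hQ : multQ (axes α₀ α₁ α₃) (fun q => EM α₀ α₁ α₃ q 1) p = 0 := by
    rw [← combination_single, multQ]
    simp only [dy_EM_combination, dx_EM_combination, Fin.sum_univ_four]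
    rw [div_eq_zero_iff]
    left
    simp [gradX, gradY, axes]
    ring
  rw [hamVF_eq, hP, hQ, ← combination_single]
  simp only [dx_EM_combination, dy_EM_combination]
  apply Prod.ext <;> funext i <;> fin_cases i <;> simp [gradX, gradY]

/-- Where a combination involving `G` is critical, `X_G` is a combination of `X_H` and `X_J`, so
that it suffices to know `π` on these two. -/
theorem hamVF_mem_kerSpace {c : Fin 3 → ℝ} {l : ℝ} (hp : p ∈ phaseSpace (axes α₀ α₁ α₃))
    (hc : ∀ i, gradX α₀ α₁ α₃ c i p = 2 * l * (p.1 i / axes α₀ α₁ α₃ i) ∧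
      gradY α₀ α₁ α₃ c i p = 0) (hc2 : c 2 ≠ 0) {ι : Type*} (π : Phase →ₗ[ℝ] (ι → ℝ))
    (hπH : ∀ Q : ℝ, π (p.2, fun i => Q * (p.1 i / axes α₀ α₁ α₃ i)) = 0)
    (hπJ : π (![0, -p.1 2, p.1 1, 0], ![0, -p.2 2, p.2 1, 0]) = 0) (i : Fin 3) :
    hamVF (axes α₀ α₁ α₃) (fun q => EM α₀ α₁ α₃ q i) p ∈
      kerSpace (axes α₀ α₁ α₃) (EM α₀ α₁ α₃) p ⊓ LinearMap.ker π := by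
  have hD := diracD_ne_zero hp
  have hcc := mem_critSpace_of_multiplier hc
  obtain ⟨m1, m2⟩ := mem_phaseSpace_axes.1 hp
  have e0 : hamVF (axes α₀ α₁ α₃) (fun q => EM α₀ α₁ α₃ q 0) p ∈
      kerSpace (axes α₀ α₁ α₃) (EM α₀ α₁ α₃) p ⊓ LinearMap.ker π := by
    refine ⟨(mem_kerSpace_iff hcc hc2).2 ⟨hamVF_mem_tangent hD, ?_, ?_⟩, ?_⟩
    · obtain ⟨Q, hQ⟩ := hamVF_H (α₀ := α₀) (α₁ := α₁) (α₃ := α₃) hp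
      rw [hQ]
      simp only [axes, Matrix.cons_val]
      linear_combination Q * m2
    · obtain ⟨Q, hQ⟩ := hamVF_H (α₀ := α₀) (α₁ := α₁) (α₃ := α₃) hp
      rw [hQ]
      simp only [axes, Matrix.cons_val, angMomD]
      ring
    · obtain ⟨Q, hQ⟩ := hamVF_H (α₀ := α₀) (α₁ := α₁) (α₃ := α₃) hp
      rw [hQ]
      exact hπH Q
  have e1 : hamVF (axes α₀ α₁ α₃) (fun q => EM α₀ α₁ α₃ q 1) p ∈
      kerSpace (axes α₀ α₁ α₃) (EM α₀ α₁ α₃) p ⊓ LinearMap.ker π := by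
    refine ⟨(mem_kerSpace_iff hcc hc2).2 ⟨hamVF_mem_tangent hD, ?_, ?_⟩, ?_⟩
    · rw [hamVF_J]
      simp only [Matrix.cons_val]
      ring
    · rw [hamVF_J]
      simp only [Matrix.cons_val, angMomD]
      ring
    · rw [hamVF_J]
      exact hπJ
  have e2 : hamVF (axes α₀ α₁ α₃) (fun q => EM α₀ α₁ α₃ q 2) p =
      (-(c 0 / c 2)) • hamVF (axes α₀ α₁ α₃) (fun q => EM α₀ α₁ α₃ q 0) p +
      (-(c 1 / c 2)) • hamVF (axes α₀ α₁ α₃) (fun q => EM α₀ α₁ α₃ q 1) p := by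
    have h := hamVF_combination_eq_zero hD hc
    rw [hamVF_combination (differentiable_EM _ _ _ p), Fin.sum_univ_three] at h
    have := congrArg (fun w => (c 2)⁻¹ • w) (eq_neg_of_add_eq_zero_right h)
    simp only [smul_smul, inv_mul_cancel₀ hc2, one_smul] at this
    rw [this]
    module
  fin_cases i
  · exact e0
  · exact e1
  · simp only [Fin.reduceFinMk]
    rw [e2]
    exact Submodule.add_mem _ (Submodule.smul_mem _ _ e0) (Submodule.smul_mem _ _ e1)

/-- `v` lies in the sum of those among the coordinate spaces `(x₀, y₀)`, `(x₃, y₃)` and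
`(x₁, x₂, y₁, y₂)` in which `p` vanishes. -/
def IsTransversal (p v : Phase) : Prop :=
  ((p.1 0 = 0 ∧ p.2 0 = 0) ∨ (v.1 0 = 0 ∧ v.2 0 = 0)) ∧
  ((p.1 3 = 0 ∧ p.2 3 = 0) ∨ (v.1 3 = 0 ∧ v.2 3 = 0)) ∧
  ((p.1 1 = 0 ∧ p.1 2 = 0 ∧ p.2 1 = 0 ∧ p.2 2 = 0) ∨
    (v.1 1 = 0 ∧ v.1 2 = 0 ∧ v.2 1 = 0 ∧ v.2 2 = 0))

theorem IsTransversal.mem_kerSpace {c : Fin 3 → ℝ}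
    (hc : c ∈ critSpace (axes α₀ α₁ α₃) (EM α₀ α₁ α₃) p) (hc2 : c 2 ≠ 0) {v : Phase}
    (h : IsTransversal p v) : v ∈ kerSpace (axes α₀ α₁ α₃) (EM α₀ α₁ α₃) p := by
  rw [mem_kerSpace_iff hc hc2, mem_tangent_axes, angMomD]
  obtain ⟨⟨a, b⟩ | ⟨a, b⟩, ⟨c, d⟩ | ⟨c, d⟩, ⟨e, f, g, h⟩ | ⟨e, f, g, h⟩⟩ := h <;>
    simp [a, b, c, d, e, f, g, h]

/-- The linearisation of a critical combination from its Hessian, if that is transversal to `p` up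
to the contribution of the multipliers. -/
theorem fderiv_hamVF_EM {c : Fin 3 → ℝ} {l : ℝ} (hp : p ∈ phaseSpace (axes α₀ α₁ α₃))
    (hc : ∀ i, gradX α₀ α₁ α₃ c i p = 2 * l * (p.1 i / axes α₀ α₁ α₃ i) ∧
      gradY α₀ α₁ α₃ c i p = 0) {u : Phase} (l' : ℝ) {β γ : Fin 4 → ℝ}
    (hx : ∀ i, hessX α₀ α₁ α₃ c p u i = 2 * l * (u.1 i / axes α₀ α₁ α₃ i)
      + 2 * l' * (p.1 i / axes α₀ α₁ α₃ i) + γ i)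
    (hy : ∀ i, hessY α₀ α₁ α₃ c p u i = β i) (h : IsTransversal p (β, -γ)) :
    fderiv ℝ (hamVF (axes α₀ α₁ α₃) (combination (EM α₀ α₁ α₃) c)) p u = (β, -γ) := by
  have hβγ : ∀ i, (β i * p.1 i = 0 ∧ β i * p.2 i = 0) ∧ γ i * p.1 i = 0 := by
    obtain ⟨h1, h2, h3⟩ := h
    simp only [Pi.neg_apply, neg_eq_zero] at h1 h2 h3
    intro i
    fin_cases i
    · rcases h1 with ⟨a, b⟩ | ⟨a, b⟩ <;> simp [a, b]
    · rcases h3 with ⟨a, -, b, -⟩ | ⟨a, -, b, -⟩ <;> simp [a, b]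
    · rcases h3 with ⟨-, a, -, b⟩ | ⟨-, a, -, b⟩ <;> simp [a, b]
    · rcases h2 with ⟨a, b⟩ | ⟨a, b⟩ <;> simp [a, b]
  refine fderiv_hamVF (diracD_ne_zero hp) (l := l) (l' := l') (fun i => ?_) (fun i => ?_)
    (fun i => ?_) (fun i => ?_) (fun i => ?_) (fun i => ?_) (fun i => (hβγ i).1)
    (fun i => (hβγ i).2)
  · rw [dx_EM_combination]; exact differentiable_gradX _ _ _ _ i p
  · rw [dy_EM_combination]; exact differentiable_gradY _ _ _ _ i p
  · rw [dx_EM_combination]; exact (hc i).1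
  · rw [dy_EM_combination]; exact (hc i).2
  · rw [dx_EM_combination, fderiv_gradX]; exact hx i
  · rw [dy_EM_combination, fderiv_gradY]; exact hy i

/-- `isNondegenerateOfType_of_model` for the energy-momentum map at a point with critical
combinations `cb` and multipliers `l`. The Hessians have to be computed on `kerSpace` only, which
the hypotheses of `hlin` describe in coordinates. -/
theorem isNondegenerateOfType_EM {k : ℕ} {cb : Fin k → Fin 3 → ℝ} {l : Fin k → ℝ}
    (hp : p ∈ phaseSpace (axes α₀ α₁ α₃)) (hcb : LinearIndependent ℝ cb)
    (hc : ∀ m i, gradX α₀ α₁ α₃ (cb m) i p = 2 * l m * (p.1 i / axes α₀ α₁ α₃ i) ∧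
      gradY α₀ α₁ α₃ (cb m) i p = 0)
    (hspan : critSpace (axes α₀ α₁ α₃) (EM α₀ α₁ α₃) p ≤ Submodule.span ℝ (range cb))
    {n : Fin k} (hn : cb n 2 ≠ 0) {ι : Type*} [Fintype ι] [DecidableEq ι]
    (hι : Fintype.card ι = 2 * k) (π : Phase →ₗ[ℝ] (ι → ℝ))
    (hπH : ∀ Q : ℝ, π (p.2, fun i => Q * (p.1 i / axes α₀ α₁ α₃ i)) = 0)
    (hπJ : π (![0, -p.1 2, p.1 1, 0], ![0, -p.2 2, p.2 1, 0]) = 0)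
    (hsurj : ∀ w, ∃ u, IsTransversal p u ∧ π u = w)
    {M : Fin k → Matrix ι ι ℝ} (hM : LinearIndependent ℝ M)
    (hcomm : ∀ i j, Commute (M i) (M j))
    (hlin : ∀ u : Phase,
      p.1 0 * u.1 0 / α₀ + (p.1 1 * u.1 1 + p.1 2 * u.1 2) / α₁ + p.1 3 * u.1 3 / α₃ = 0 →
      (p.2 0 * u.1 0 + p.1 0 * u.2 0) / α₀ + (p.2 1 * u.1 1 + p.1 1 * u.2 1 + p.2 2 * u.1 2
        + p.1 2 * u.2 2) / α₁ + (p.2 3 * u.1 3 + p.1 3 * u.2 3) / α₃ = 0 →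
      p.2 0 * u.2 0 + p.2 1 * u.2 1 + p.2 2 * u.2 2 + p.2 3 * u.2 3 = 0 →
      angMomD 1 2 p u = 0 → ∀ m, ∃ (l' : ℝ) (β γ : Fin 4 → ℝ),
        (∀ i, hessX α₀ α₁ α₃ (cb m) p u i = 2 * l m * (u.1 i / axes α₀ α₁ α₃ i)
          + 2 * l' * (p.1 i / axes α₀ α₁ α₃ i) + γ i) ∧
        (∀ i, hessY α₀ α₁ α₃ (cb m) p u i = β i) ∧ IsTransversal p (β, -γ) ∧
        π (β, -γ) = (M m).mulVec (π u))
    {A : Matrix ι ι ℝ} (hA : A ∈ Submodule.span ℝ (range M)) {ke kh kf : ℕ}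
    (hE : (matrixEigenvalues A).ncard = 2 * k)
    (he : {z ∈ matrixEigenvalues A | z.re = 0 ∧ 0 < z.im}.ncard = ke)
    (hh : {z ∈ matrixEigenvalues A | 0 < z.re ∧ z.im = 0}.ncard = kh)
    (hf : {z ∈ matrixEigenvalues A | 0 < z.re ∧ 0 < z.im}.ncard = kf) :
    rankAt (axes α₀ α₁ α₃) (EM α₀ α₁ α₃) p = 3 - k ∧
      IsNondegenerateOfType (axes α₀ α₁ α₃) (EM α₀ α₁ α₃) p ke kh kf := by
  have hD := diracD_ne_zero hp
  have hcn := mem_critSpace_of_multiplier (hc n)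
  refine isNondegenerateOfType_of_model hD (differentiable_EM _ _ _)
    (differentiableAt_hamVF_EM _ _ _ hD) hcb (le_antisymm hspan ?_) hι π
    (hamVF_mem_kerSpace hp (hc n) hn π hπH hπJ) ?_ hM hcomm ?_ hA hE he hh hf
  · rw [Submodule.span_le]
    rintro _ ⟨m, rfl⟩
    exact mem_critSpace_of_multiplier (hc m)
  · intro w
    obtain ⟨u, hu, rfl⟩ := hsurj w
    exact ⟨u, hu.mem_kerSpace hcn hn, rfl⟩
  · intro m u hu
    rw [mem_kerSpace_iff hcn hn, mem_tangent_axes] at hu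
    obtain ⟨⟨t1, t2⟩, t3, t4⟩ := hu
    obtain ⟨l', β, γ, hx, hy, ht, hπ⟩ := hlin u t1 t2 t3 t4 m
    rw [fderiv_hamVF_EM hp (hc m) l' hx hy ht]
    exact ⟨ht.mem_kerSpace hcn hn, hπ⟩

/-- The combinations of `H` and `J` alone are critical only on the equator `z₀ = z₃ = 0` (where
the geodesic is a circle) and on the fixed points `z₁ = z₂ = 0` of the rotation. -/
theorem critSpace_classification_of_G_coeff_zero (h0 : 0 < α₀) (h01 : α₀ < α₁) (h13 : α₁ < α₃)
    (hp : p ∈ phaseSpace (axes α₀ α₁ α₃)) (hH : 0 < H p) {c : Fin 3 → ℝ} (hc2 : c 2 = 0)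
    (hc : c ∈ critSpace (axes α₀ α₁ α₃) (EM α₀ α₁ α₃) p) :
    c = 0 ∨ (p.1 0 = 0 ∧ p.2 0 = 0 ∧ p.1 3 = 0 ∧ p.2 3 = 0) ∨
      (p.1 1 = 0 ∧ p.1 2 = 0 ∧ p.2 1 = 0 ∧ p.2 2 = 0) := by
  have h1 : 0 < α₁ := h0.trans h01
  have h3 : 0 < α₃ := h1.trans h13
  obtain ⟨l, hl⟩ := critSpace_multiplier h01.ne h13.ne h0.ne' h1.ne' h3.ne' hp hc
  have x0 := (hl 0).1
  have x1 := (hl 1).1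
  have x2 := (hl 2).1
  have x3 := (hl 3).1
  have y0 := (hl 0).2
  have y1 := (hl 1).2
  have y2 := (hl 2).2
  have y3 := (hl 3).2
  simp only [gradX, gradY, axes, angMom, Matrix.cons_val, hc2] at x0 x1 x2 x3 y0 y1 y2 y3
  simp [h0.ne', h3.ne'] at x0 x1 x2 x3 y0 y1 y2 y3
  by_cases c0 : c 0 = 0
  · by_cases c1 : c 1 = 0
    · left
      funext i
      fin_cases i <;> assumption
    · simp [c0, c1] at y1 y2
      simp [c1, y1, y2] at x1 x2
      exact Or.inr (Or.inr ⟨y2, y1, x2, x1⟩)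
  · simp [c0] at y0 y3
    have hy : ¬(p.2 1 = 0 ∧ p.2 2 = 0) := fun ⟨a, b⟩ => by
      simp [H, y0, y3, a, b] at hH
    by_cases hl0 : l = 0
    · exfalso
      simp [hl0] at x1 x2
      by_cases c1 : c 1 = 0
      · simp [c1, c0] at y1 y2
        exact hy ⟨y1, y2⟩
      · simp [c1] at x1 x2
        exact hy ⟨x2, x1⟩
    · simp [hl0] at x0 x3
      exact Or.inr (Or.inl ⟨x0, y0, x3, y3⟩)

theorem IsCriticalPt.classification (h0 : 0 < α₀) (h01 : α₀ < α₁) (h13 : α₁ < α₃)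
    (hp : IsCriticalPt (axes α₀ α₁ α₃) (EM α₀ α₁ α₃) p) (hH : 0 < H p) :
    (p.1 3 = 0 ∧ p.2 3 = 0) ∨ (p.1 0 = 0 ∧ p.2 0 = 0) ∨
      (p.1 1 = 0 ∧ p.1 2 = 0 ∧ p.2 1 = 0 ∧ p.2 2 = 0) := by
  have hr := rankAt_add_finrank_critSpace (axes α₀ α₁ α₃) (EM α₀ α₁ α₃) p
  have hr' := hp.2
  have : critSpace (axes α₀ α₁ α₃) (EM α₀ α₁ α₃) p ≠ ⊥ := by
    intro h
    rw [h, finrank_bot] at hr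
    omega
  obtain ⟨c, hc, hc0⟩ := Submodule.exists_mem_ne_zero_of_ne_bot this
  by_cases hc2 : c 2 = 0
  · rcases critSpace_classification_of_G_coeff_zero h0 h01 h13 hp.1 hH hc2 hc with h | h | h
    · exact absurd h hc0
    · exact Or.inl h.2.2
    · exact Or.inr (Or.inr h)
  · exact critical_classification h0 h01 h13 hp.1 hH hc2 hc

end Singular

/-! ### The three families of critical points -/

section Cases

variable {α₀ α₁ α₃ : ℝ} {p : Phase}

/-- The projection to the coordinate plane `(x_i, y_i)`. -/
def planeProj (i : Fin 4) : Phase →ₗ[ℝ] (Fin 2 → ℝ) where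
  toFun v := ![v.1 i, v.2 i]
  map_add' v w := by ext k; fin_cases k <;> simp
  map_smul' t v := by ext k; fin_cases k <;> simp

theorem planeProj_apply (i : Fin 4) (v : Phase) : planeProj i v = ![v.1 i, v.2 i] := rfl

/-- The determinant of the linearisation in the elliptic case; `r`, `m`, `s` stand for the scalar
products of `(x₁, x₂)` and `(y₁, y₂)`. -/
theorem elliptic_det_pos {b w r m s L : ℝ} (hw : w < 0) (hb : 0 < b) (hL : 0 < L) (hr : 0 ≤ r)
    (hm : 0 ≤ m) (hs : s ^ 2 ≤ r * m) :
    0 < (-2 * b ^ 2 + 2 * w * r) * (2 * w * m - 2 * L) - (2 * w * s) ^ 2 := by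
  have e : (-2 * b ^ 2 + 2 * w * r) * (2 * w * m - 2 * L) - (2 * w * s) ^ 2 =
      4 * b ^ 2 * L + 4 * b ^ 2 * -w * m + 4 * -w * r * L + 4 * w ^ 2 * (r * m - s ^ 2) := by ring
  rw [e]
  have hw' : 0 < -w := by linarith
  have : 0 ≤ r * m - s ^ 2 := by linarith
  positivity

theorem inner_sq_le (x y : Fin 4 → ℝ) : (x 1 * y 1 + x 2 * y 2) ^ 2 ≤
    (x 1 ^ 2 + x 2 ^ 2) * (y 1 ^ 2 + y 2 ^ 2) := by
  nlinarith [sq_nonneg (x 1 * y 2 - x 2 * y 1)]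

/-- The points over the upper arc and off the lower one. -/
theorem upper_elliptic (h0 : 0 < α₀) (h01 : α₀ < α₁) (h13 : α₁ < α₃)
    (hp : p ∈ phaseSpace (axes α₀ α₁ α₃)) (hH : 0 < H p) (hx3 : p.1 3 = 0) (hy3 : p.2 3 = 0)
    (hz0 : ¬(p.1 0 = 0 ∧ p.2 0 = 0)) :
    rankAt (axes α₀ α₁ α₃) (EM α₀ α₁ α₃) p = 2 ∧
      IsNondegenerateOfType (axes α₀ α₁ α₃) (EM α₀ α₁ α₃) p 1 0 0 := by
  have h1 : 0 < α₁ := h0.trans h01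
  have h3 : 0 < α₃ := h1.trans h13
  have k0 : α₁ - α₀ ≠ 0 := by linarith
  have hcl := fun c => critSpace_classification_of_G_coeff_zero h0 h01 h13 hp hH (c := c)
  obtain ⟨m1, m2⟩ := mem_phaseSpace_axes.1 hp
  have hHy : 0 < p.2 0 ^ 2 + p.2 1 ^ 2 + p.2 2 ^ 2 + p.2 3 ^ 2 := by
    rw [H] at hH; linarith
  clear hH
  obtain ⟨x, y⟩ := p
  simp only at *
  have hA : α₀ * α₀⁻¹ = 1 := mul_inv_cancel₀ h0.ne'
  have hB : α₁ * α₁⁻¹ = 1 := mul_inv_cancel₀ h1.ne'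
  have e0 : (α₁ - α₀)⁻¹ * (α₁ - α₀) = 1 := inv_mul_cancel₀ k0
  simp only [div_eq_mul_inv, hx3, hy3] at m1 m2
  have hr : x 1 ^ 2 + x 2 ^ 2 = α₁ - α₁ * x 0 ^ 2 * α₀⁻¹ := by
    linear_combination α₁ * m1 - (x 1 ^ 2 + x 2 ^ 2) * hB
  have hs : x 1 * y 1 + x 2 * y 2 = -α₁ * (x 0 * y 0) * α₀⁻¹ := by
    linear_combination α₁ * m2 - (x 1 * y 1 + x 2 * y 2) * hB
  -- The combination `c` has the differential of `f = α₁ * (α₁ - α₀) * (G - upperCurve)`, and `l` is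
  -- the factor for which `f - l * C₁` vanishes to second order, cf. `upperCurve_sub_G`.
  let l : ℝ := α₁ * (α₀ * (y 1 ^ 2 + y 2 ^ 2) + α₁ * y 0 ^ 2)
  have hl : 0 < l := by
    rw [hy3] at hHy
    have : 0 < α₀ * (y 1 ^ 2 + y 2 ^ 2) + α₁ * y 0 ^ 2 := by
      rcases eq_or_ne (y 0) 0 with h | h
      · have : 0 < y 1 ^ 2 + y 2 ^ 2 := by rw [h] at hHy; linarith
        positivity
      · positivity
    positivity
  let c : Fin 3 → ℝ := ![-2 * α₁ ^ 2, 2 * α₀ * (x 1 * y 2 - x 2 * y 1), α₁ * (α₁ - α₀)]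
  have hc2 : c 2 ≠ 0 := mul_ne_zero h1.ne' k0
  have hc : ∀ i, gradX α₀ α₁ α₃ c i (x, y) = 2 * l * (x i / axes α₀ α₁ α₃ i) ∧
      gradY α₀ α₁ α₃ c i (x, y) = 0 := by
    simp only [Fin.forall_fin_succ, IsEmpty.forall_iff, and_true]
    simp [gradX, gradY, angMom, axes, c, l, div_eq_mul_inv, hx3, hy3]
    refine ⟨?_, ?_, ?_⟩
    · constructor
      · linear_combination -2 * α₁ * y 0 * hs
          - 2 * α₁ * (y 1 ^ 2 + y 2 ^ 2) * x 0 * hA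
          + 2 * α₁ * ((x 0 * y 1 - x 1 * y 0) * y 1 + (x 0 * y 2 - x 2 * y 0) * y 2) * e0
      · linear_combination -2 * α₁ * x 0 * hs + 2 * α₁ * y 0 * hr
          - 2 * α₁ * ((x 0 * y 1 - x 1 * y 0) * x 1 + (x 0 * y 2 - x 2 * y 0) * x 2) * e0
    · constructor
      · linear_combination -2 * α₀ * y 1 * hs + 2 * α₁ * (x 0 * y 0) * y 1 * hA
          - 2 * α₁ * y 0 * (x 0 * y 1 - x 1 * y 0) * e0
          - 2 * (α₀ * (y 1 ^ 2 + y 2 ^ 2) + α₁ * y 0 ^ 2) * x 1 * hB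
      · linear_combination 2 * α₀ * y 1 * hr - 2 * α₀ * x 1 * hs
          + (-2 * α₁ * x 0 ^ 2 * y 1 + 2 * α₁ * (x 0 * y 0) * x 1) * hA
          + 2 * α₁ * x 0 * (x 0 * y 1 - x 1 * y 0) * e0
    · constructor
      · linear_combination -2 * α₀ * y 2 * hs + 2 * α₁ * (x 0 * y 0) * y 2 * hA
          - 2 * α₁ * y 0 * (x 0 * y 2 - x 2 * y 0) * e0
          - 2 * (α₀ * (y 1 ^ 2 + y 2 ^ 2) + α₁ * y 0 ^ 2) * x 2 * hB
      · linear_combination 2 * α₀ * y 2 * hr - 2 * α₀ * x 2 * hs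
          + (-2 * α₁ * x 0 ^ 2 * y 2 + 2 * α₁ * (x 0 * y 0) * x 2) * hA
          + 2 * α₁ * x 0 * (x 0 * y 2 - x 2 * y 0) * e0
  -- the linearisation in the coordinates `(x_3, y_3)`
  let w : ℝ := (α₁ - α₃)⁻¹ * c 2
  have hw : w < 0 := by
    have b0 : (α₁ - α₃)⁻¹ < 0 := inv_neg''.2 (by linarith)
    exact mul_neg_of_neg_of_pos b0 (mul_pos h1 (by linarith))
  let M : Matrix (Fin 2) (Fin 2) ℝ := !![-(2 * w * (x 1 * y 1 + x 2 * y 2)),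
    -2 * α₁ ^ 2 + 2 * w * (x 1 ^ 2 + x 2 ^ 2);
    -(2 * w * (y 1 ^ 2 + y 2 ^ 2) - 2 * (l / α₃)), 2 * w * (x 1 * y 1 + x 2 * y 2)]
  have hdet := elliptic_det_pos hw h1 (div_pos hl h3) (by positivity) (by positivity)
    (inner_sq_le x y)
  have hM0 : M ≠ 0 := by
    intro h
    have a := congrFun (congrFun h 0) 0
    have b := congrFun (congrFun h 0) 1
    simp only [M, Matrix.of_apply, Matrix.cons_val, Matrix.zero_apply] at a b
    rw [b, neg_eq_zero.1 a] at hdet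
    simp at hdet
  have hc0 : c ≠ 0 := fun h => hc2 (congrFun h 2)
  obtain ⟨n1, n2, n3, n4⟩ := elliptic_counts hdet (matrixEigenvalues_two _ _ _)
  refine isNondegenerateOfType_EM (k := 1) (cb := fun _ => c) (l := fun _ => l) (M := fun _ => M)
    (A := M) (n := 0) hp (linearIndependent_unique_iff.2 hc0) (fun _ => hc) ?_ hc2 (by simp)
    (planeProj 3) ?_ ?_ ?_ (linearIndependent_unique_iff.2 hM0) (fun _ _ => Commute.refl _) ?_
    (Submodule.subset_span ⟨0, rfl⟩) n1 n2 n3 n4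
  · intro d hd
    -- subtracting a multiple of `c` removes `G`
    have hd' := hcl (d - (d 2 / c 2) • c) (by simp [hc2]) (Submodule.sub_mem _ hd
      (Submodule.smul_mem _ _ (mem_critSpace_of_multiplier hc)))
    rcases hd' with h | h | ⟨a1, a2, a3, a4⟩
    · rw [sub_eq_zero.1 h]
      exact Submodule.smul_mem _ _ (Submodule.subset_span ⟨0, rfl⟩)
    · exact absurd ⟨h.1, h.2.1⟩ hz0
    · exfalso
      simp [a1, a2, a3, a4, hy3] at m1 m2 hHy
      rcases m2 with (h | h) | h <;> simp [h] at m1 hHy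
  · intro Q
    ext i
    fin_cases i <;> simp [planeProj_apply, hx3, hy3]
  · ext i
    fin_cases i <;> simp [planeProj_apply]
  · intro v
    refine ⟨(Pi.single 3 (v 0), Pi.single 3 (v 1)), ?_, ?_⟩
    · simp [IsTransversal, hx3, hy3]
    · ext i
      fin_cases i <;> simp [planeProj_apply]
  · rintro ⟨ξ, η⟩ t1 t2 t3 t4 -
    simp only [div_eq_mul_inv, hx3, hy3, angMomD] at t1 t2 t3 t4
    have d1 : x 1 * ξ 1 + x 2 * ξ 2 = -α₁ * (x 0 * ξ 0) * α₀⁻¹ := by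
      linear_combination α₁ * t1 - (x 1 * ξ 1 + x 2 * ξ 2) * hB
    have d2 : y 1 * ξ 1 + x 1 * η 1 + y 2 * ξ 2 + x 2 * η 2 =
        -α₁ * (y 0 * ξ 0 + x 0 * η 0) * α₀⁻¹ := by
      linear_combination α₁ * t2 - (y 1 * ξ 1 + x 1 * η 1 + y 2 * ξ 2 + x 2 * η 2) * hB
    have d3 : y 1 * η 1 + y 2 * η 2 = -(y 0 * η 0) := by linear_combination t3
    -- in the other coordinates the Hessian is the contribution of the multipliers
    have hyx : ∀ i, i ≠ 3 → hessX α₀ α₁ α₃ c (x, y) (ξ, η) i =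
        2 * l * (ξ i / axes α₀ α₁ α₃ i) +
          2 * (2 * α₁ * (α₁ - α₀) * (y 0 * η 0)) * (x i / axes α₀ α₁ α₃ i) ∧
        hessY α₀ α₁ α₃ c (x, y) (ξ, η) i = 0 := by
      simp only [Fin.forall_fin_succ, IsEmpty.forall_iff, and_true]
      simp [hessX, hessY, angMom, angMomD, axes, c, l, div_eq_mul_inv, hx3, hy3]
      refine ⟨?_, ?_, ?_⟩
      · constructor
        · linear_combination 4 * α₁ * x 0 * d3 - 2 * α₁ * η 0 * hs - 2 * α₁ * y 0 * d2
            + (-2 * α₁ * (y 1 ^ 2 + y 2 ^ 2) * ξ 0 + 4 * α₁ * x 0 * y 0 * η 0) * hA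
            + 2 * α₁ * ((ξ 0 * y 1 + x 0 * η 1 - ξ 1 * y 0 - x 1 * η 0) * y 1
              + (x 0 * y 1 - x 1 * y 0) * η 1
              + (ξ 0 * y 2 + x 0 * η 2 - ξ 2 * y 0 - x 2 * η 0) * y 2
              + (x 0 * y 2 - x 2 * y 0) * η 2) * e0
        · linear_combination -2 * α₁ * ξ 0 * hs - 2 * α₁ * x 0 * d2 + 2 * α₁ * η 0 * hr
            + 4 * α₁ * y 0 * d1
            - 2 * α₁ * ((ξ 0 * y 1 + x 0 * η 1 - ξ 1 * y 0 - x 1 * η 0) * x 1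
              + (x 0 * y 1 - x 1 * y 0) * ξ 1
              + (ξ 0 * y 2 + x 0 * η 2 - ξ 2 * y 0 - x 2 * η 0) * x 2
              + (x 0 * y 2 - x 2 * y 0) * ξ 2) * e0
      · constructor
        · linear_combination 4 * α₀ * x 1 * d3 - 2 * α₀ * y 1 * d2 - 2 * α₀ * η 1 * hs
            - 2 * α₀ * y 2 * t4
            + 2 * α₁ * ((y 0 * ξ 0 + x 0 * η 0) * y 1 + x 0 * y 0 * η 1) * hA
            - 2 * α₁ * (η 0 * (x 0 * y 1 - x 1 * y 0)
              + y 0 * (ξ 0 * y 1 + x 0 * η 1 - ξ 1 * y 0 - x 1 * η 0)) * e0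
            - (2 * (α₀ * (y 1 ^ 2 + y 2 ^ 2) + α₁ * y 0 ^ 2) * ξ 1
              + 4 * (α₁ - α₀) * (y 0 * η 0) * x 1) * hB
        · linear_combination 4 * α₀ * y 1 * d1 + 2 * α₀ * η 1 * hr - 2 * α₀ * x 1 * d2
            - 2 * α₀ * ξ 1 * hs + 2 * α₀ * x 2 * t4
            + (-4 * α₁ * x 0 * ξ 0 * y 1 - 2 * α₁ * x 0 ^ 2 * η 1
              + 2 * α₁ * x 1 * (y 0 * ξ 0 + x 0 * η 0) + 2 * α₁ * ξ 1 * (x 0 * y 0)) * hA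
            + 2 * α₁ * (ξ 0 * (x 0 * y 1 - x 1 * y 0)
              + x 0 * (ξ 0 * y 1 + x 0 * η 1 - ξ 1 * y 0 - x 1 * η 0)) * e0
      · constructor
        · linear_combination 4 * α₀ * x 2 * d3 - 2 * α₀ * y 2 * d2 - 2 * α₀ * η 2 * hs
            + 2 * α₀ * y 1 * t4
            + 2 * α₁ * ((y 0 * ξ 0 + x 0 * η 0) * y 2 + x 0 * y 0 * η 2) * hA
            - 2 * α₁ * (η 0 * (x 0 * y 2 - x 2 * y 0)
              + y 0 * (ξ 0 * y 2 + x 0 * η 2 - ξ 2 * y 0 - x 2 * η 0)) * e0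
            - (2 * (α₀ * (y 1 ^ 2 + y 2 ^ 2) + α₁ * y 0 ^ 2) * ξ 2
              + 4 * (α₁ - α₀) * (y 0 * η 0) * x 2) * hB
        · linear_combination 4 * α₀ * y 2 * d1 + 2 * α₀ * η 2 * hr - 2 * α₀ * x 2 * d2
            - 2 * α₀ * ξ 2 * hs - 2 * α₀ * x 1 * t4
            + (-4 * α₁ * x 0 * ξ 0 * y 2 - 2 * α₁ * x 0 ^ 2 * η 2
              + 2 * α₁ * x 2 * (y 0 * ξ 0 + x 0 * η 0) + 2 * α₁ * ξ 2 * (x 0 * y 0)) * hA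
            + 2 * α₁ * (ξ 0 * (x 0 * y 2 - x 2 * y 0)
              + x 0 * (ξ 0 * y 2 + x 0 * η 2 - ξ 2 * y 0 - x 2 * η 0)) * e0
    refine ⟨2 * α₁ * (α₁ - α₀) * (y 0 * η 0),
      Pi.single 3 (hessY α₀ α₁ α₃ c (x, y) (ξ, η) 3),
      Pi.single 3 (hessX α₀ α₁ α₃ c (x, y) (ξ, η) 3 - 2 * l * (ξ 3 / α₃)), ?_, ?_, ?_, ?_⟩
    · intro i
      by_cases hi : i = 3
      · subst hi
        simp [hx3, axes]
      · simp [hi, (hyx i hi).1]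
    · intro i
      by_cases hi : i = 3
      · subst hi
        simp
      · simp [hi, (hyx i hi).2]
    · simp [IsTransversal, hx3, hy3]
    · ext i
      fin_cases i
      · simp [planeProj_apply, M, hessY, hx3, hy3, angMom, angMomD, w, Matrix.mulVec,
          dotProduct, Fin.sum_univ_two]
        simp [c]
        ring
      · simp [planeProj_apply, M, hessX, hx3, hy3, angMom, angMomD, w, Matrix.mulVec,
          dotProduct, Fin.sum_univ_two]
        ring

/-- The points over the lower arc and off the upper one. -/
theorem lower_elliptic (h0 : 0 < α₀) (h01 : α₀ < α₁) (h13 : α₁ < α₃)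
    (hp : p ∈ phaseSpace (axes α₀ α₁ α₃)) (hH : 0 < H p) (hx0 : p.1 0 = 0) (hy0 : p.2 0 = 0)
    (hz3 : ¬(p.1 3 = 0 ∧ p.2 3 = 0)) :
    rankAt (axes α₀ α₁ α₃) (EM α₀ α₁ α₃) p = 2 ∧
      IsNondegenerateOfType (axes α₀ α₁ α₃) (EM α₀ α₁ α₃) p 1 0 0 := by
  have h1 : 0 < α₁ := h0.trans h01
  have h3 : 0 < α₃ := h1.trans h13
  have k3 : α₁ - α₃ ≠ 0 := by linarith
  have hcl := fun c => critSpace_classification_of_G_coeff_zero h0 h01 h13 hp hH (c := c)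
  obtain ⟨m1, m2⟩ := mem_phaseSpace_axes.1 hp
  have hHy : 0 < p.2 0 ^ 2 + p.2 1 ^ 2 + p.2 2 ^ 2 + p.2 3 ^ 2 := by
    rw [H] at hH; linarith
  clear hH
  obtain ⟨x, y⟩ := p
  simp only at *
  have hA : α₃ * α₃⁻¹ = 1 := mul_inv_cancel₀ h3.ne'
  have hB : α₁ * α₁⁻¹ = 1 := mul_inv_cancel₀ h1.ne'
  have e0 : (α₁ - α₃)⁻¹ * (α₁ - α₃) = 1 := inv_mul_cancel₀ k3
  simp only [div_eq_mul_inv, hx0, hy0] at m1 m2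
  have hr : x 1 ^ 2 + x 2 ^ 2 = α₁ - α₁ * x 3 ^ 2 * α₃⁻¹ := by
    linear_combination α₁ * m1 - (x 1 ^ 2 + x 2 ^ 2) * hB
  have hs : x 1 * y 1 + x 2 * y 2 = -α₁ * (x 3 * y 3) * α₃⁻¹ := by
    linear_combination α₁ * m2 - (x 1 * y 1 + x 2 * y 2) * hB
  -- The combination `c` has the differential of `f = α₁ * (α₁ - α₃) * (G - lowerCurve)`, and `l` is
  -- the factor for which `f - l * C₁` vanishes to second order, cf. `G_sub_lowerCurve`.
  let l : ℝ := α₁ * (α₃ * (y 1 ^ 2 + y 2 ^ 2) + α₁ * y 3 ^ 2)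
  have hl : 0 < l := by
    rw [hy0] at hHy
    have : 0 < α₃ * (y 1 ^ 2 + y 2 ^ 2) + α₁ * y 3 ^ 2 := by
      rcases eq_or_ne (y 3) 0 with h | h
      · have : 0 < y 1 ^ 2 + y 2 ^ 2 := by rw [h] at hHy; linarith
        positivity
      · positivity
    positivity
  let c : Fin 3 → ℝ := ![-2 * α₁ ^ 2, 2 * α₃ * (x 1 * y 2 - x 2 * y 1), α₁ * (α₁ - α₃)]
  have hc2 : c 2 ≠ 0 := mul_ne_zero h1.ne' k3
  have hc : ∀ i, gradX α₀ α₁ α₃ c i (x, y) = 2 * l * (x i / axes α₀ α₁ α₃ i) ∧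
      gradY α₀ α₁ α₃ c i (x, y) = 0 := by
    simp only [Fin.forall_fin_succ, IsEmpty.forall_iff, and_true]
    simp [gradX, gradY, angMom, axes, c, l, div_eq_mul_inv, hx0, hy0]
    refine ⟨?_, ?_, ?_⟩
    · constructor
      · linear_combination -2 * α₃ * y 1 * hs + 2 * α₁ * (x 3 * y 3) * y 1 * hA
          - 2 * α₁ * y 3 * (x 3 * y 1 - x 1 * y 3) * e0
          - 2 * (α₃ * (y 1 ^ 2 + y 2 ^ 2) + α₁ * y 3 ^ 2) * x 1 * hB
      · linear_combination 2 * α₃ * y 1 * hr - 2 * α₃ * x 1 * hs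
          + (-2 * α₁ * x 3 ^ 2 * y 1 + 2 * α₁ * (x 3 * y 3) * x 1) * hA
          + 2 * α₁ * x 3 * (x 3 * y 1 - x 1 * y 3) * e0
    · constructor
      · linear_combination -2 * α₃ * y 2 * hs + 2 * α₁ * (x 3 * y 3) * y 2 * hA
          - 2 * α₁ * y 3 * (x 3 * y 2 - x 2 * y 3) * e0
          - 2 * (α₃ * (y 1 ^ 2 + y 2 ^ 2) + α₁ * y 3 ^ 2) * x 2 * hB
      · linear_combination 2 * α₃ * y 2 * hr - 2 * α₃ * x 2 * hs
          + (-2 * α₁ * x 3 ^ 2 * y 2 + 2 * α₁ * (x 3 * y 3) * x 2) * hA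
          + 2 * α₁ * x 3 * (x 3 * y 2 - x 2 * y 3) * e0
    · constructor
      · linear_combination -2 * α₁ * y 3 * hs
          - 2 * α₁ * (y 1 ^ 2 + y 2 ^ 2) * x 3 * hA
          + 2 * α₁ * ((x 3 * y 1 - x 1 * y 3) * y 1 + (x 3 * y 2 - x 2 * y 3) * y 2) * e0
      · linear_combination -2 * α₁ * x 3 * hs + 2 * α₁ * y 3 * hr
          - 2 * α₁ * ((x 3 * y 1 - x 1 * y 3) * x 1 + (x 3 * y 2 - x 2 * y 3) * x 2) * e0
  -- the linearisation in the coordinates `(x_0, y_0)`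
  let w : ℝ := (α₁ - α₀)⁻¹ * c 2
  have hw : w < 0 := by
    have b0 : 0 < (α₁ - α₀)⁻¹ := inv_pos.2 (by linarith)
    exact mul_neg_of_pos_of_neg b0 (mul_neg_of_pos_of_neg h1 (by linarith))
  let M : Matrix (Fin 2) (Fin 2) ℝ := !![-(2 * w * (x 1 * y 1 + x 2 * y 2)),
    -2 * α₁ ^ 2 + 2 * w * (x 1 ^ 2 + x 2 ^ 2);
    -(2 * w * (y 1 ^ 2 + y 2 ^ 2) - 2 * (l / α₀)), 2 * w * (x 1 * y 1 + x 2 * y 2)]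
  have hdet := elliptic_det_pos hw h1 (div_pos hl h0) (by positivity) (by positivity)
    (inner_sq_le x y)
  have hM0 : M ≠ 0 := by
    intro h
    have a := congrFun (congrFun h 0) 0
    have b := congrFun (congrFun h 0) 1
    simp only [M, Matrix.of_apply, Matrix.cons_val, Matrix.zero_apply] at a b
    rw [b, neg_eq_zero.1 a] at hdet
    simp at hdet
  have hc0 : c ≠ 0 := fun h => hc2 (congrFun h 2)
  obtain ⟨n1, n2, n3, n4⟩ := elliptic_counts hdet (matrixEigenvalues_two _ _ _)
  refine isNondegenerateOfType_EM (k := 1) (cb := fun _ => c) (l := fun _ => l) (M := fun _ => M)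
    (A := M) (n := 0) hp (linearIndependent_unique_iff.2 hc0) (fun _ => hc) ?_ hc2 (by simp)
    (planeProj 0) ?_ ?_ ?_ (linearIndependent_unique_iff.2 hM0) (fun _ _ => Commute.refl _) ?_
    (Submodule.subset_span ⟨0, rfl⟩) n1 n2 n3 n4
  · intro d hd
    -- subtracting a multiple of `c` removes `G`
    have hd' := hcl (d - (d 2 / c 2) • c) (by simp [hc2]) (Submodule.sub_mem _ hd
      (Submodule.smul_mem _ _ (mem_critSpace_of_multiplier hc)))
    rcases hd' with h | h | ⟨a1, a2, a3, a4⟩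
    · rw [sub_eq_zero.1 h]
      exact Submodule.smul_mem _ _ (Submodule.subset_span ⟨0, rfl⟩)
    · exact absurd ⟨h.2.2.1, h.2.2.2⟩ hz3
    · exfalso
      simp [a1, a2, a3, a4, hy0] at m1 m2 hHy
      rcases m2 with (h | h) | h <;> simp [h] at m1 hHy
  · intro Q
    ext i
    fin_cases i <;> simp [planeProj_apply, hx0, hy0]
  · ext i
    fin_cases i <;> simp [planeProj_apply]
  · intro v
    refine ⟨(Pi.single 0 (v 0), Pi.single 0 (v 1)), ?_, ?_⟩
    · simp [IsTransversal, hx0, hy0]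
    · ext i
      fin_cases i <;> simp [planeProj_apply]
  · rintro ⟨ξ, η⟩ t1 t2 t3 t4 -
    simp only [div_eq_mul_inv, hx0, hy0, angMomD] at t1 t2 t3 t4
    have d1 : x 1 * ξ 1 + x 2 * ξ 2 = -α₁ * (x 3 * ξ 3) * α₃⁻¹ := by
      linear_combination α₁ * t1 - (x 1 * ξ 1 + x 2 * ξ 2) * hB
    have d2 : y 1 * ξ 1 + x 1 * η 1 + y 2 * ξ 2 + x 2 * η 2 =
        -α₁ * (y 3 * ξ 3 + x 3 * η 3) * α₃⁻¹ := by
      linear_combination α₁ * t2 - (y 1 * ξ 1 + x 1 * η 1 + y 2 * ξ 2 + x 2 * η 2) * hB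
    have d3 : y 1 * η 1 + y 2 * η 2 = -(y 3 * η 3) := by linear_combination t3
    -- in the other coordinates the Hessian is the contribution of the multipliers
    have hyx : ∀ i, i ≠ 0 → hessX α₀ α₁ α₃ c (x, y) (ξ, η) i =
        2 * l * (ξ i / axes α₀ α₁ α₃ i) +
          2 * (2 * α₁ * (α₁ - α₃) * (y 3 * η 3)) * (x i / axes α₀ α₁ α₃ i) ∧
        hessY α₀ α₁ α₃ c (x, y) (ξ, η) i = 0 := by
      simp only [Fin.forall_fin_succ, IsEmpty.forall_iff, and_true]
      simp [hessX, hessY, angMom, angMomD, axes, c, l, div_eq_mul_inv, hx0, hy0]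
      refine ⟨?_, ?_, ?_⟩
      · constructor
        · linear_combination 4 * α₃ * x 1 * d3 - 2 * α₃ * y 1 * d2 - 2 * α₃ * η 1 * hs
            - 2 * α₃ * y 2 * t4
            + 2 * α₁ * ((y 3 * ξ 3 + x 3 * η 3) * y 1 + x 3 * y 3 * η 1) * hA
            - 2 * α₁ * (η 3 * (x 3 * y 1 - x 1 * y 3)
              + y 3 * (ξ 3 * y 1 + x 3 * η 1 - ξ 1 * y 3 - x 1 * η 3)) * e0
            - (2 * (α₃ * (y 1 ^ 2 + y 2 ^ 2) + α₁ * y 3 ^ 2) * ξ 1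
              + 4 * (α₁ - α₃) * (y 3 * η 3) * x 1) * hB
        · linear_combination 4 * α₃ * y 1 * d1 + 2 * α₃ * η 1 * hr - 2 * α₃ * x 1 * d2
            - 2 * α₃ * ξ 1 * hs + 2 * α₃ * x 2 * t4
            + (-4 * α₁ * x 3 * ξ 3 * y 1 - 2 * α₁ * x 3 ^ 2 * η 1
              + 2 * α₁ * x 1 * (y 3 * ξ 3 + x 3 * η 3) + 2 * α₁ * ξ 1 * (x 3 * y 3)) * hA
            + 2 * α₁ * (ξ 3 * (x 3 * y 1 - x 1 * y 3)
              + x 3 * (ξ 3 * y 1 + x 3 * η 1 - ξ 1 * y 3 - x 1 * η 3)) * e0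
      · constructor
        · linear_combination 4 * α₃ * x 2 * d3 - 2 * α₃ * y 2 * d2 - 2 * α₃ * η 2 * hs
            + 2 * α₃ * y 1 * t4
            + 2 * α₁ * ((y 3 * ξ 3 + x 3 * η 3) * y 2 + x 3 * y 3 * η 2) * hA
            - 2 * α₁ * (η 3 * (x 3 * y 2 - x 2 * y 3)
              + y 3 * (ξ 3 * y 2 + x 3 * η 2 - ξ 2 * y 3 - x 2 * η 3)) * e0
            - (2 * (α₃ * (y 1 ^ 2 + y 2 ^ 2) + α₁ * y 3 ^ 2) * ξ 2
              + 4 * (α₁ - α₃) * (y 3 * η 3) * x 2) * hB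
        · linear_combination 4 * α₃ * y 2 * d1 + 2 * α₃ * η 2 * hr - 2 * α₃ * x 2 * d2
            - 2 * α₃ * ξ 2 * hs - 2 * α₃ * x 1 * t4
            + (-4 * α₁ * x 3 * ξ 3 * y 2 - 2 * α₁ * x 3 ^ 2 * η 2
              + 2 * α₁ * x 2 * (y 3 * ξ 3 + x 3 * η 3) + 2 * α₁ * ξ 2 * (x 3 * y 3)) * hA
            + 2 * α₁ * (ξ 3 * (x 3 * y 2 - x 2 * y 3)
              + x 3 * (ξ 3 * y 2 + x 3 * η 2 - ξ 2 * y 3 - x 2 * η 3)) * e0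
      · constructor
        · linear_combination 4 * α₁ * x 3 * d3 - 2 * α₁ * η 3 * hs - 2 * α₁ * y 3 * d2
            + (-2 * α₁ * (y 1 ^ 2 + y 2 ^ 2) * ξ 3 + 4 * α₁ * x 3 * y 3 * η 3) * hA
            + 2 * α₁ * ((ξ 3 * y 1 + x 3 * η 1 - ξ 1 * y 3 - x 1 * η 3) * y 1
              + (x 3 * y 1 - x 1 * y 3) * η 1
              + (ξ 3 * y 2 + x 3 * η 2 - ξ 2 * y 3 - x 2 * η 3) * y 2
              + (x 3 * y 2 - x 2 * y 3) * η 2) * e0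
        · linear_combination -2 * α₁ * ξ 3 * hs - 2 * α₁ * x 3 * d2 + 2 * α₁ * η 3 * hr
            + 4 * α₁ * y 3 * d1
            - 2 * α₁ * ((ξ 3 * y 1 + x 3 * η 1 - ξ 1 * y 3 - x 1 * η 3) * x 1
              + (x 3 * y 1 - x 1 * y 3) * ξ 1
              + (ξ 3 * y 2 + x 3 * η 2 - ξ 2 * y 3 - x 2 * η 3) * x 2
              + (x 3 * y 2 - x 2 * y 3) * ξ 2) * e0
    refine ⟨2 * α₁ * (α₁ - α₃) * (y 3 * η 3),
      Pi.single 0 (hessY α₀ α₁ α₃ c (x, y) (ξ, η) 0),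
      Pi.single 0 (hessX α₀ α₁ α₃ c (x, y) (ξ, η) 0 - 2 * l * (ξ 0 / α₀)), ?_, ?_, ?_, ?_⟩
    · intro i
      by_cases hi : i = 0
      · subst hi
        simp [hx0, axes]
      · simp [hi, (hyx i hi).1]
    · intro i
      by_cases hi : i = 0
      · subst hi
        simp
      · simp [hi, (hyx i hi).2]
    · simp [IsTransversal, hx0, hy0]
    · ext i
      fin_cases i
      · simp [planeProj_apply, M, hessY, hx0, hy0, angMom, angMomD, w, Matrix.mulVec,
          dotProduct, Fin.sum_univ_two]
        simp [c]
        ring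
      · simp [planeProj_apply, M, hessX, hx0, hy0, angMom, angMomD, w, Matrix.mulVec,
          dotProduct, Fin.sum_univ_two]
        ring

/-- The projection to the coordinates `(x₀, y₀, x₃, y₃)`. -/
def outerProj : Phase →ₗ[ℝ] (Fin 4 → ℝ) where
  toFun v := ![v.1 0, v.2 0, v.1 3, v.2 3]
  map_add' v w := by ext k; fin_cases k <;> simp
  map_smul' t v := by ext k; fin_cases k <;> simp

theorem outerProj_apply (v : Phase) : outerProj v = ![v.1 0, v.2 0, v.1 3, v.2 3] := rfl

/-- The projection to the coordinates `(x₁, x₂, y₁, y₂)`. -/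
def middleProj : Phase →ₗ[ℝ] (Fin 4 → ℝ) where
  toFun v := ![v.1 1, v.1 2, v.2 1, v.2 2]
  map_add' v w := by ext k; fin_cases k <;> simp
  map_smul' t v := by ext k; fin_cases k <;> simp

theorem middleProj_apply (v : Phase) : middleProj v = ![v.1 1, v.1 2, v.2 1, v.2 2] := rfl

/-- The points over the intersections of the arcs, where the geodesic is the circle
`x₀ = x₃ = 0`. -/
theorem equator_elliptic_elliptic (h0 : 0 < α₀) (h01 : α₀ < α₁) (h13 : α₁ < α₃)
    (hp : p ∈ phaseSpace (axes α₀ α₁ α₃)) (hH : 0 < H p) (hx0 : p.1 0 = 0) (hy0 : p.2 0 = 0)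
    (hx3 : p.1 3 = 0) (hy3 : p.2 3 = 0) :
    rankAt (axes α₀ α₁ α₃) (EM α₀ α₁ α₃) p = 1 ∧
      IsNondegenerateOfType (axes α₀ α₁ α₃) (EM α₀ α₁ α₃) p 2 0 0 := by
  have h1 : 0 < α₁ := h0.trans h01
  have h3 : 0 < α₃ := h1.trans h13
  obtain ⟨m1, m2⟩ := mem_phaseSpace_axes.1 hp
  have hmult := fun c => critSpace_multiplier h01.ne h13.ne h0.ne' h1.ne' h3.ne' hp (c := c)
  have hm : 0 < p.2 1 ^ 2 + p.2 2 ^ 2 := by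
    rw [H, hy0, hy3] at hH; linarith
  clear hH
  obtain ⟨x, y⟩ := p
  simp only at *
  have hB : α₁ * α₁⁻¹ = 1 := mul_inv_cancel₀ h1.ne'
  have e0 : (α₁ - α₀)⁻¹ * (α₁ - α₀) = 1 := inv_mul_cancel₀ (by linarith)
  have e3 : (α₁ - α₃)⁻¹ * (α₁ - α₃) = 1 := inv_mul_cancel₀ (by linarith)
  simp only [div_eq_mul_inv, hx0, hx3, hy0, hy3] at m1 m2
  have hr : x 1 ^ 2 + x 2 ^ 2 = α₁ := by
    linear_combination α₁ * m1 - (x 1 ^ 2 + x 2 ^ 2) * hB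
  have hs : x 1 * y 1 + x 2 * y 2 = 0 := by
    linear_combination α₁ * m2 - (x 1 * y 1 + x 2 * y 2) * hB
  obtain ⟨m, hmm⟩ : ∃ m, m = y 1 ^ 2 + y 2 ^ 2 := ⟨_, rfl⟩
  obtain ⟨j, hj⟩ : ∃ j, j = x 1 * y 2 - x 2 * y 1 := ⟨_, rfl⟩
  rw [← hmm] at hm
  -- `y` is proportional to the rotation of `x`
  have jx1 : j * x 1 = α₁ * y 2 := by rw [hj]; linear_combination y 2 * hr - x 2 * hs
  have jx2 : j * x 2 = -(α₁ * y 1) := by rw [hj]; linear_combination -y 1 * hr + x 1 * hs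
  have jy1 : j * y 1 = -(m * x 2) := by rw [hj, hmm]; linear_combination y 2 * hs
  have jy2 : j * y 2 = m * x 1 := by rw [hj, hmm]; linear_combination -y 1 * hs
  -- the critical combinations `G - 2 * H` and `H - (j / α₁) * J`
  let cb : Fin 2 → Fin 3 → ℝ := ![![-2, 0, 1], ![1, -(j / α₁), 0]]
  let l : Fin 2 → ℝ := ![0, -(m / 2)]
  have hc : ∀ n i, gradX α₀ α₁ α₃ (cb n) i (x, y) = 2 * l n * (x i / axes α₀ α₁ α₃ i) ∧
      gradY α₀ α₁ α₃ (cb n) i (x, y) = 0 := by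
    simp only [Fin.forall_fin_succ, IsEmpty.forall_iff, and_true]
    simp [gradX, gradY, angMom, axes, cb, l, div_eq_mul_inv, hx0, hx3, hy0, hy3]
    refine ⟨⟨?_, ?_⟩, ?_, ?_⟩
    · linear_combination α₁⁻¹ * jy2
    · linear_combination α₁⁻¹ * jx2 - y 1 * hB
    · linear_combination α₁⁻¹ * jy1
    · linear_combination -α₁⁻¹ * jx1 - y 2 * hB
  have hcb : LinearIndependent ℝ cb := by
    rw [LinearIndependent.pair_iff]
    intro s t hst
    have a := congrFun hst 2
    have b := congrFun hst 0
    simp at a b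
    simp [a] at b
    exact ⟨a, b⟩
  let P : ℝ := 2 * (α₁ - α₀)⁻¹ * α₀
  let Q : ℝ := 2 * (α₁ - α₃)⁻¹ * α₃
  have hP : 0 < P := mul_pos (mul_pos two_pos (inv_pos.2 (by linarith))) h0
  have hQ : Q < 0 := mul_neg_of_neg_of_pos
    (mul_neg_of_pos_of_neg two_pos (inv_neg''.2 (by linarith))) h3
  have hPm : P * (m / α₀) = 2 * (α₁ - α₀)⁻¹ * m := by simp only [P]; field_simp
  have hQm : Q * (m / α₃) = 2 * (α₁ - α₃)⁻¹ * m := by simp only [Q]; field_simp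
  let M : Fin 2 → Matrix (Fin 4) (Fin 4) ℝ := ![
    !![0, P, 0, 0; -(P * (m / α₀)), 0, 0, 0; 0, 0, 0, Q; 0, 0, -(Q * (m / α₃)), 0],
    !![0, 1, 0, 0; -(m / α₀), 0, 0, 0; 0, 0, 0, 1; 0, 0, -(m / α₃), 0]]
  have hM : LinearIndependent ℝ M := by
    rw [LinearIndependent.pair_iff]
    intro s t hst
    have a := congrFun (congrFun hst 0) 1
    have b := congrFun (congrFun hst 2) 3
    simp at a b
    have hs0 : s * (P - Q) = 0 := by linear_combination a - b
    have hs0 : s = 0 := (mul_eq_zero.1 hs0).resolve_right (by linarith)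
    exact ⟨hs0, by simpa [hs0] using a⟩
  have hcomm : Commute (M 0) (M 1) := by
    ext i k
    fin_cases i <;> fin_cases k <;> simp [M, Matrix.mul_apply, Fin.sum_univ_four, mul_comm]
  have hde : m / α₀ ≠ m / α₃ := by
    rw [Ne, div_eq_div_iff h0.ne' h3.ne']
    intro h
    have := mul_left_cancel₀ hm.ne' h
    linarith
  obtain ⟨n1, n2, n3, n4⟩ := elliptic_elliptic_counts (div_pos hm h0) (div_pos hm h3) hde
    (matrixEigenvalues_oscillators _ _)
  refine isNondegenerateOfType_EM (k := 2) (cb := cb) (l := l) (M := M) (A := M 1) (n := 0) hp hcb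
    hc ?_ one_ne_zero (by simp) outerProj ?_ ?_ ?_ hM ?_ ?_ (Submodule.subset_span ⟨1, rfl⟩)
    n1 n2 n3 n4
  · intro d hd
    obtain ⟨l', hl'⟩ := hmult d hd
    have g1 := (hl' 1).2
    have g2 := (hl' 2).2
    simp [gradY, angMom, hx0, hx3] at g1 g2
    rw [Submodule.mem_span_range_iff_exists_fun]
    refine ⟨![d 2, d 0 + 2 * d 2], ?_⟩
    ext i
    fin_cases i
    · simp [cb]; ring
    · simp [cb]
      have : α₁ * d 1 = -((d 0 + 2 * d 2) * j) := by
        rw [hj]; linear_combination x 1 * g2 - x 2 * g1 - d 1 * hr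
      field_simp
      linear_combination -this
    · simp [cb]
  · intro Q
    ext i
    fin_cases i <;> simp [outerProj_apply, hx0, hx3, hy0, hy3]
  · ext i
    fin_cases i <;> simp [outerProj_apply]
  · intro v
    refine ⟨(![v 0, 0, 0, v 2], ![v 1, 0, 0, v 3]), ?_, ?_⟩
    · simp [IsTransversal, hx0, hx3, hy0, hy3]
    · ext i
      fin_cases i <;> simp [outerProj_apply]
  · intro i k
    fin_cases i <;> fin_cases k
    · exact Commute.refl _
    · exact hcomm
    · exact hcomm.symm
    · exact Commute.refl _
  · rintro ⟨ξ, η⟩ t1 t2 t3 t4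
    simp only [div_eq_mul_inv, hx0, hx3, hy0, hy3, angMomD] at t1 t2 t3 t4
    have d1 : x 1 * ξ 1 + x 2 * ξ 2 = 0 := by
      linear_combination α₁ * t1 - (x 1 * ξ 1 + x 2 * ξ 2) * hB
    have d2 : y 1 * ξ 1 + x 1 * η 1 + y 2 * ξ 2 + x 2 * η 2 = 0 := by
      linear_combination α₁ * t2 - (y 1 * ξ 1 + x 1 * η 1 + y 2 * ξ 2 + x 2 * η 2) * hB
    -- the components `(ξ, η)` along the equator are those of a multiple of `X_J`
    have p1 : x 1 * (α₁ * η 1 + j * ξ 2) + x 2 * (α₁ * η 2 - j * ξ 1) = 0 := by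
      linear_combination α₁ * d2 + ξ 2 * jx1 - ξ 1 * jx2
    have p2 : x 1 * (α₁ * η 2 - j * ξ 1) - x 2 * (α₁ * η 1 + j * ξ 2) = 0 := by
      linear_combination α₁ * t4 - 2 * j * d1 + ξ 1 * jx1 + ξ 2 * jx2
    have w1 : α₁ * η 1 = -(j * ξ 2) := by
      apply mul_left_cancel₀ h1.ne'
      linear_combination x 1 * p1 - x 2 * p2 - (α₁ * η 1 + j * ξ 2) * hr
    have w2 : α₁ * η 2 = j * ξ 1 := by
      apply mul_left_cancel₀ h1.ne'
      linear_combination x 2 * p1 + x 1 * p2 - (α₁ * η 2 - j * ξ 1) * hr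
    have hjj : j ^ 2 = α₁ * m := by
      rw [hj, hmm]
      linear_combination (y 1 ^ 2 + y 2 ^ 2) * hr - (x 1 * y 1 + x 2 * y 2) * hs
    have jη1 : j * η 1 = -(m * ξ 2) := by
      apply mul_left_cancel₀ h1.ne'
      linear_combination j * w1 - ξ 2 * hjj
    have jη2 : j * η 2 = m * ξ 1 := by
      apply mul_left_cancel₀ h1.ne'
      linear_combination j * w2 + ξ 1 * hjj
    simp only [Fin.forall_fin_succ, IsEmpty.forall_iff, and_true]
    refine ⟨⟨0, ![P * η 0, 0, 0, Q * η 3], ![P * (m / α₀) * ξ 0, 0, 0, Q * (m / α₃) * ξ 3],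
      ?_, ?_, ?_, ?_⟩, ⟨0, ![η 0, 0, 0, η 3], ![m / α₀ * ξ 0, 0, 0, m / α₃ * ξ 3],
      ?_, ?_, ?_, ?_⟩⟩
    · simp [hessX, angMom, angMomD, axes, cb, l, hx0, hx3, hy0, hy3]
      rw [hPm, hQm]
      constructor
      · linear_combination -2 * (α₁ - α₀)⁻¹ * (ξ 0 * hmm + η 0 * hs)
      · linear_combination -2 * (α₁ - α₃)⁻¹ * (ξ 3 * hmm + η 3 * hs)
    · simp [hessY, angMom, angMomD, cb, hx0, hx3, hy0, hy3]
      simp only [P, Q]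
      constructor
      · linear_combination -2 * (α₁ - α₀)⁻¹ * ξ 0 * hs + 2 * (α₁ - α₀)⁻¹ * η 0 * hr + 2 * η 0 * e0
      · linear_combination 2 * (α₁ - α₃)⁻¹ * η 3 * hr - 2 * (α₁ - α₃)⁻¹ * ξ 3 * hs + 2 * η 3 * e3
    · simp [IsTransversal, hx0, hx3, hy0, hy3]
    · ext i
      fin_cases i <;> simp [outerProj_apply, M, Matrix.mulVec, dotProduct, Fin.sum_univ_four]
    · simp [hessX, angMom, angMomD, axes, cb, l, hx0, hx3, hy0, hy3]
      refine ⟨by ring, ?_, ?_, by ring⟩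
      · linear_combination α₁⁻¹ * jη2
      · linear_combination α₁⁻¹ * jη1
    · simp [hessY, angMom, angMomD, cb, hx0, hx3, hy0, hy3]
      constructor
      · linear_combination α₁⁻¹ * w1 - η 1 * hB
      · linear_combination α₁⁻¹ * w2 - η 2 * hB
    · simp [IsTransversal, hx0, hx3, hy0, hy3]
    · ext i
      fin_cases i <;> simp [outerProj_apply, M, Matrix.mulVec, dotProduct, Fin.sum_univ_four]

/-- The discriminant of the Hessian of `G` in the focus-focus case; it equals
`α₁ * (y₀² + y₃²) / ((α₁ - α₀) * (α₃ - α₁))`. -/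
theorem focus_discr_pos (h0 : 0 < α₀) (h01 : α₀ < α₁) (h13 : α₁ < α₃) {x₀ x₃ y₀ y₃ : ℝ}
    (m1 : x₀ ^ 2 / α₀ + x₃ ^ 2 / α₃ = 1) (m2 : x₀ * y₀ / α₀ + x₃ * y₃ / α₃ = 0)
    (hy : 0 < y₀ ^ 2 + y₃ ^ 2) :
    0 < ((α₁ - α₀)⁻¹ * (x₀ * y₀) + (α₁ - α₃)⁻¹ * (x₃ * y₃)) ^ 2 -
      (1 + (α₁ - α₀)⁻¹ * x₀ ^ 2 + (α₁ - α₃)⁻¹ * x₃ ^ 2) *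
        ((α₁ - α₀)⁻¹ * y₀ ^ 2 + (α₁ - α₃)⁻¹ * y₃ ^ 2) := by
  have h1 : 0 < α₁ := h0.trans h01
  have h3 : 0 < α₃ := h1.trans h13
  have k0 : 0 < α₁ - α₀ := by linarith
  have k3 : 0 < α₃ - α₁ := by linarith
  have hk3 : (α₁ - α₃)⁻¹ = -(α₃ - α₁)⁻¹ := by rw [← inv_neg, neg_sub]
  -- the determinant of the orthogonal vectors `(x₀, x₃)`, of length one, and `(y₀, y₃)`, for the
  -- scalar product `u₀ v₀ / α₀ + u₃ v₃ / α₃`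
  have hw : (x₀ * y₃ - x₃ * y₀) ^ 2 = α₃ * y₀ ^ 2 + α₀ * y₃ ^ 2 := by
    field_simp at m1 m2
    have : (α₀ * α₃) * ((x₀ * y₃ - x₃ * y₀) ^ 2) =
        (α₀ * α₃) * (α₃ * y₀ ^ 2 + α₀ * y₃ ^ 2) := by
      linear_combination (α₃ * y₀ ^ 2 + α₀ * y₃ ^ 2) * m1 - (x₀ * y₀ * α₃ + α₀ * x₃ * y₃) * m2
    exact mul_left_cancel₀ (mul_pos h0 h3).ne' this
  have e : ((α₁ - α₀)⁻¹ * (x₀ * y₀) + (α₁ - α₃)⁻¹ * (x₃ * y₃)) ^ 2 -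
      (1 + (α₁ - α₀)⁻¹ * x₀ ^ 2 + (α₁ - α₃)⁻¹ * x₃ ^ 2) *
        ((α₁ - α₀)⁻¹ * y₀ ^ 2 + (α₁ - α₃)⁻¹ * y₃ ^ 2) =
      (α₁ - α₀)⁻¹ * (α₃ - α₁)⁻¹ * (α₁ * (y₀ ^ 2 + y₃ ^ 2)) := by
    rw [hk3]
    have f0 := inv_mul_cancel₀ k0.ne'
    have f3 := inv_mul_cancel₀ k3.ne'
    linear_combination (α₁ - α₀)⁻¹ * (α₃ - α₁)⁻¹ * hw + (α₁ - α₀)⁻¹ * y₀ ^ 2 * f3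
      - (α₃ - α₁)⁻¹ * y₃ ^ 2 * f0
  rw [e]
  have := inv_pos.2 k0
  have := inv_pos.2 k3
  positivity

/-- The geodesics on the ellipse in the plane of the coordinates `0`, `3`. -/
theorem outer_focus_focus (h0 : 0 < α₀) (h01 : α₀ < α₁) (h13 : α₁ < α₃)
    (hp : p ∈ phaseSpace (axes α₀ α₁ α₃)) (hH : 0 < H p) (hx1 : p.1 1 = 0) (hx2 : p.1 2 = 0)
    (hy1 : p.2 1 = 0) (hy2 : p.2 2 = 0) :
    rankAt (axes α₀ α₁ α₃) (EM α₀ α₁ α₃) p = 1 ∧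
      IsNondegenerateOfType (axes α₀ α₁ α₃) (EM α₀ α₁ α₃) p 0 0 1 := by
  have h1 : 0 < α₁ := h0.trans h01
  have h3 : 0 < α₃ := h1.trans h13
  obtain ⟨m1, m2⟩ := mem_phaseSpace_axes.1 hp
  have hmult := fun c => critSpace_multiplier h01.ne h13.ne h0.ne' h1.ne' h3.ne' hp (c := c)
  have hm : 0 < p.2 0 ^ 2 + p.2 3 ^ 2 := by
    rw [H, hy1, hy2] at hH; linarith
  clear hH
  obtain ⟨x, y⟩ := p
  simp only at *
  simp [hx1, hx2, hy1] at m1 m2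
  have hdisc := focus_discr_pos h0 h01 h13 m1 m2 hm
  -- In the transversal directions, `G` has the second-order part
  -- `A * (η₁² + η₂²) - 2 * B * (ξ₁ η₁ + ξ₂ η₂) + C * (ξ₁² + ξ₂²)`.
  let A : ℝ := 1 + (α₁ - α₀)⁻¹ * x 0 ^ 2 + (α₁ - α₃)⁻¹ * x 3 ^ 2
  let B : ℝ := (α₁ - α₀)⁻¹ * (x 0 * y 0) + (α₁ - α₃)⁻¹ * (x 3 * y 3)
  let C : ℝ := (α₁ - α₀)⁻¹ * y 0 ^ 2 + (α₁ - α₃)⁻¹ * y 3 ^ 2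
  replace hdisc : 0 < B ^ 2 - A * C := hdisc
  let cb : Fin 2 → Fin 3 → ℝ := ![![0, 1, 0], ![0, 0, 1]]
  have hc : ∀ n i, gradX α₀ α₁ α₃ (cb n) i (x, y) = 2 * 0 * (x i / axes α₀ α₁ α₃ i) ∧
      gradY α₀ α₁ α₃ (cb n) i (x, y) = 0 := by
    simp only [Fin.forall_fin_succ, IsEmpty.forall_iff, and_true]
    simp [gradX, gradY, angMom, cb, hx1, hx2, hy1, hy2]
  have hcb : LinearIndependent ℝ cb := by
    rw [LinearIndependent.pair_iff]
    intro s t hst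
    have a := congrFun hst 1
    have b := congrFun hst 2
    simp at a b
    exact ⟨a, b⟩
  let MJ : Matrix (Fin 4) (Fin 4) ℝ := !![0, -1, 0, 0; 1, 0, 0, 0; 0, 0, 0, -1; 0, 0, 1, 0]
  let MG : Matrix (Fin 4) (Fin 4) ℝ := !![-2 * B, 0, 2 * A, 0; 0, -2 * B, 0, 2 * A;
    -2 * C, 0, 2 * B, 0; 0, -2 * C, 0, 2 * B]
  have hM : LinearIndependent ℝ ![MJ, MG] := by
    rw [LinearIndependent.pair_iff]
    intro s t hst
    have a := congrFun (congrFun hst 0) 1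
    have b := congrFun (congrFun hst 0) 0
    have d := congrFun (congrFun hst 0) 2
    simp [MJ, MG] at a b d
    refine ⟨a, ?_⟩
    by_contra ht
    simp [ht] at b d
    rw [b, d] at hdisc
    simp at hdisc
  have hcomm : Commute MJ MG := by
    ext i k
    fin_cases i <;> fin_cases k <;> simp [MJ, MG, Matrix.mul_apply, Fin.sum_univ_four]
  have hsum : MJ + MG = !![-2 * B, -1, 2 * A, 0; 1, -2 * B, 0, 2 * A;
      -2 * C, 0, 2 * B, -1; 0, -2 * C, 1, 2 * B] := by
    ext i k
    fin_cases i <;> fin_cases k <;> simp [MJ, MG]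
  obtain ⟨n1, n2, n3, n4⟩ := focus_focus_counts (mul_pos four_pos hdisc)
    ((congrArg matrixEigenvalues hsum).trans (matrixEigenvalues_focus _ _ _))
  refine isNondegenerateOfType_EM (k := 2) (cb := cb) (l := fun _ => 0) (M := ![MJ, MG])
    (A := MJ + MG) (n := 1) hp hcb
    hc ?_ one_ne_zero (by simp) middleProj ?_ ?_ ?_ hM ?_ ?_ (Submodule.add_mem _
      (Submodule.subset_span ⟨0, rfl⟩) (Submodule.subset_span ⟨1, rfl⟩))
    n1 n2 n3 n4
  · intro d hd
    obtain ⟨l', hl'⟩ := hmult d hd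
    have g1 := (hl' 0).2
    have g2 := (hl' 3).2
    simp [gradY, hx1, hx2] at g1 g2
    have d0 : d 0 = 0 := by
      by_contra hd0
      simp [hd0] at g1 g2
      simp [g1, g2] at hm
    rw [Submodule.mem_span_range_iff_exists_fun]
    refine ⟨![d 1, d 2], ?_⟩
    ext i
    fin_cases i <;> simp [cb, d0]
  · intro Q
    ext i
    fin_cases i <;> simp [middleProj_apply, hx1, hx2, hy1, hy2]
  · ext i
    fin_cases i <;> simp [middleProj_apply, hx1, hx2, hy1, hy2]
  · intro v
    refine ⟨(![0, v 0, v 1, 0], ![0, v 2, v 3, 0]), ?_, ?_⟩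
    · simp [IsTransversal, hx1, hx2, hy1, hy2]
    · ext i
      fin_cases i <;> simp [middleProj_apply]
  · intro i k
    fin_cases i <;> fin_cases k
    · exact Commute.refl _
    · exact hcomm
    · exact hcomm.symm
    · exact Commute.refl _
  · rintro ⟨ξ, η⟩ - - - - n
    refine ⟨0, hessY α₀ α₁ α₃ (cb n) (x, y) (ξ, η), hessX α₀ α₁ α₃ (cb n) (x, y) (ξ, η),
      fun i => by simp, fun i => rfl, ?_, ?_⟩
    · fin_cases n <;>
      simp [IsTransversal, hx1, hx2, hy1, hy2, hessX, hessY, angMom, cb]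
    · ext i
      fin_cases n <;> fin_cases i <;>
        simp [middleProj_apply, MJ, MG, Matrix.mulVec, dotProduct, Fin.sum_univ_four, hessX,
          hessY, cb, angMom, angMomD, hx1, hx2, hy1, hy2, A, B, C] <;> ring

end Cases

/-! ### The image and its boundary -/

section Image

variable {α₀ α₁ α₃ h : ℝ}

theorem upperCurve_sub_lowerCurve (h1 : α₁ ≠ 0) (h01 : α₁ - α₀ ≠ 0) (h13 : α₁ - α₃ ≠ 0) (j : ℝ) :
    (α₁ - α₀) * (α₁ - α₃) * (upperCurve α₀ α₁ h j - lowerCurve α₁ α₃ h j) =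
      (α₀ - α₃) * (2 * α₁ * h - j ^ 2) := by
  rw [upperCurve, lowerCurve]
  field_simp
  ring

theorem image_eq_region (h0 : 0 < α₀) (h01 : α₀ < α₁) (h13 : α₁ < α₃) :
    (fun p => (J p, G α₀ α₁ α₃ p)) '' {p | p ∈ phaseSpace (axes α₀ α₁ α₃) ∧ H p = h} =
      region α₀ α₁ α₃ h := by
  have h1 : 0 < α₁ := h0.trans h01
  have h3 : 0 < α₃ := h1.trans h13
  have k0 : 0 < α₁ - α₀ := by linarith
  have k3 : 0 < α₃ - α₁ := by linarith
  have k3' : α₁ - α₃ ≠ 0 := by linarith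
  have k : 0 < α₃ - α₀ := by linarith
  apply Subset.antisymm
  · rintro _ ⟨p, ⟨hp, rfl⟩, rfl⟩
    exact mem_region_of_mem_phaseSpace h0 h01 h13 hp
  · rintro ⟨j, g⟩ ⟨hl, hu⟩
    simp only at hl hu
    -- a geodesic through `(0, √α₁, 0, 0)`, with momentum `(u, 0, j / √α₁, v)`
    have hdiff := upperCurve_sub_lowerCurve (h := h) h1.ne' k0.ne' k3' j
    set U := upperCurve α₀ α₁ h j with hU
    set V := lowerCurve α₁ α₃ h j with hV
    -- the factor for which `u² + v²` is twice the energy left for the two outer components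
    let κ : ℝ := (α₁ - α₀) * (α₃ - α₁) / (α₁ * (α₃ - α₀))
    have hκ : 0 < κ := by positivity
    have hu2 := Real.sq_sqrt (mul_nonneg hκ.le (sub_nonneg.2 hl))
    have hv2 := Real.sq_sqrt (mul_nonneg hκ.le (sub_nonneg.2 hu))
    set u := √(κ * (g - V)) with hu_def
    set v := √(κ * (U - g)) with hv_def
    have hq := Real.sq_sqrt h1.le
    have hq0 : √α₁ ≠ 0 := (Real.sqrt_pos.2 h1).ne'
    set q := √α₁ with hq_def
    have hs : u ^ 2 + v ^ 2 = 2 * h - j ^ 2 / α₁ := by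
      rw [hu2, hv2]
      have : κ * (U - V) = 2 * h - j ^ 2 / α₁ := by
        simp only [κ]
        field_simp
        linear_combination -hdiff
      linear_combination this
    refine ⟨(![0, q, 0, 0], ![u, 0, j / q, v]), ⟨?_, ?_⟩, ?_⟩
    · rw [mem_phaseSpace_axes]
      simp [hq, h1.ne']
    · simp [H, div_pow, hq]
      linear_combination hs / 2
    · simp only [Prod.mk.injEq]
      constructor
      · simp [J]
        field_simp
      · rw [G_eq]
        simp [angMom, div_pow, mul_pow, hq]
        rw [hu2, hv2]
        have e : j ^ 2 / α₁ + α₁ * (κ * (g - V)) / (α₁ - α₀) - α₁ * (κ * (U - g)) / (α₃ - α₁) =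
            j ^ 2 / α₁ + g - ((α₃ - α₁) * V + (α₁ - α₀) * U) / (α₃ - α₀) := by
          simp only [κ]
          field_simp
          ring
        rw [e, hU, hV, upperCurve, lowerCurve]
        field_simp
        ring

theorem continuous_upperCurve : Continuous (upperCurve α₀ α₁ h) := by
  unfold upperCurve; fun_prop

theorem continuous_lowerCurve : Continuous (lowerCurve α₁ α₃ h) := by
  unfold lowerCurve; fun_prop

theorem isClosed_region : IsClosed (region α₀ α₁ α₃ h) :=
  (isClosed_le (continuous_lowerCurve.comp continuous_fst) continuous_snd).inter
    (isClosed_le continuous_snd (continuous_upperCurve.comp continuous_fst))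

theorem isClosed_boundaryCurves : IsClosed (boundaryCurves α₀ α₁ α₃ h) :=
  isClosed_region.inter
    ((isClosed_eq continuous_snd (continuous_lowerCurve.comp continuous_fst)).union
      (isClosed_eq continuous_snd (continuous_upperCurve.comp continuous_fst)))

theorem frontier_region : frontier (region α₀ α₁ α₃ h) = boundaryCurves α₀ α₁ α₃ h := by
  rw [isClosed_region.frontier_eq]
  ext ⟨j, g⟩
  simp only [Set.mem_sdiff, boundaryCurves, mem_ofPred_eq]
  refine and_congr_right fun hq => ?_
  constructor
  · intro hint
    by_contra hne
    push Not at hne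
    apply hint
    let S : Set (ℝ × ℝ) := {q | lowerCurve α₁ α₃ h q.1 < q.2 ∧ q.2 < upperCurve α₀ α₁ h q.1}
    have hopen : IsOpen S :=
      (isOpen_lt (continuous_lowerCurve.comp continuous_fst) continuous_snd).inter
        (isOpen_lt continuous_snd (continuous_upperCurve.comp continuous_fst))
    have hsub : S ⊆ region α₀ α₁ α₃ h := fun q hq => ⟨hq.1.le, hq.2.le⟩
    have hmem : ((j, g) : ℝ × ℝ) ∈ S :=
      ⟨lt_of_le_of_ne hq.1 (Ne.symm hne.1), lt_of_le_of_ne hq.2 hne.2⟩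
    exact interior_maximal hsub hopen hmem
  · intro heq hint
    -- a vertical line through an interior point stays in the region for a while
    have hcont : Continuous fun t : ℝ => ((j, t) : ℝ × ℝ) := by fun_prop
    have hmem : ∀ᶠ t in 𝓝 g, ((j, t) : ℝ × ℝ) ∈ region α₀ α₁ α₃ h :=
      hcont.continuousAt.eventually (mem_interior_iff_mem_nhds.1 hint)
    rcases heq with heq | heq
    · obtain ⟨t, ht, ht'⟩ := ((hmem.filter_mono nhdsWithin_le_nhds).and
        (self_mem_nhdsWithin : Iio g ∈ 𝓝[<] g)).exists
      have := ht.1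
      simp only at this heq
      exact absurd (mem_Iio.1 ht') (by linarith)
    · obtain ⟨t, ht, ht'⟩ := ((hmem.filter_mono nhdsWithin_le_nhds).and
        (self_mem_nhdsWithin : Ioi g ∈ 𝓝[>] g)).exists
      have := ht.2
      simp only at this heq
      exact absurd (mem_Ioi.1 ht') (by linarith)

theorem lowerCurve_zero_neg (h1 : 0 < α₁) (h13 : α₁ < α₃) (hh : 0 < h) :
    lowerCurve α₁ α₃ h 0 < 0 := by
  have : 2 * α₁ / (α₁ - α₃) < 0 := div_neg_of_pos_of_neg (by linarith) (by linarith)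
  simp only [lowerCurve]
  nlinarith

theorem upperCurve_zero_pos (h1 : 0 < α₁) (h01 : α₀ < α₁) (hh : 0 < h) :
    0 < upperCurve α₀ α₁ h 0 := by
  have : 0 < 2 * α₁ / (α₁ - α₀) := div_pos (by linarith) (by linarith)
  simp only [upperCurve]
  nlinarith

theorem zero_notMem_boundaryCurves (h1 : 0 < α₁) (h01 : α₀ < α₁) (h13 : α₁ < α₃) (hh : 0 < h) :
    (0, 0) ∉ boundaryCurves α₀ α₁ α₃ h := by
  rintro ⟨-, h | h⟩
  · exact (lowerCurve_zero_neg h1 h13 hh).ne h.symm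
  · exact (upperCurve_zero_pos h1 h01 hh).ne h

end Image

section Summary

variable {α₀ α₁ α₃ : ℝ} {p : Phase}

theorem isCriticalPt_of_coordinates (h0 : 0 < α₀) (h01 : α₀ < α₁) (h13 : α₁ < α₃)
    (hp : p ∈ phaseSpace (axes α₀ α₁ α₃)) (hH : 0 < H p)
    (h : (p.1 3 = 0 ∧ p.2 3 = 0) ∨ (p.1 0 = 0 ∧ p.2 0 = 0) ∨
      (p.1 1 = 0 ∧ p.1 2 = 0 ∧ p.2 1 = 0 ∧ p.2 2 = 0)) :
    IsCriticalPt (axes α₀ α₁ α₃) (EM α₀ α₁ α₃) p := by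
  refine ⟨hp, ?_⟩
  by_cases hz0 : p.1 0 = 0 ∧ p.2 0 = 0
  · by_cases hz3 : p.1 3 = 0 ∧ p.2 3 = 0
    · rw [(equator_elliptic_elliptic h0 h01 h13 hp hH hz0.1 hz0.2 hz3.1 hz3.2).1]; omega
    · rw [(lower_elliptic h0 h01 h13 hp hH hz0.1 hz0.2 hz3).1]; omega
  · rcases h with h | h | ⟨a, b, c, d⟩
    · rw [(upper_elliptic h0 h01 h13 hp hH h.1 h.2 hz0).1]; omega
    · exact absurd h hz0
    · rw [(outer_focus_focus h0 h01 h13 hp hH a b c d).1]; omega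

end Summary

end EllipsoidGeodesic

theorem mainTheorem3 (α₀ α₁ α₃ h : ℝ) (h0 : 0 < α₀) (h01 : α₀ < α₁) (h13 : α₁ < α₃)
    (hh : 0 < h) :
    -- the image at energy `h`
    (fun p => (J p, G α₀ α₁ α₃ p)) '' {p | p ∈ phaseSpace (axes α₀ α₁ α₃) ∧ H p = h} =
      region α₀ α₁ α₃ h ∧
    frontier (region α₀ α₁ α₃ h) = boundaryCurves α₀ α₁ α₃ h ∧
    -- the critical values at energy `h`, with the origin isolated among them
    criticalValues α₀ α₁ α₃ h = boundaryCurves α₀ α₁ α₃ h ∪ {(0, 0)} ∧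
    (0, 0) ∉ boundaryCurves α₀ α₁ α₃ h ∧
    ¬ AccPt ((0, 0) : ℝ × ℝ) (𝓟 (criticalValues α₀ α₁ α₃ h)) ∧
    -- the rank and the type of every critical point of energy `h`
    ∀ p, IsCriticalPt (axes α₀ α₁ α₃) (EM α₀ α₁ α₃) p → H p = h →
      -- over exactly one of the two boundary curves: elliptic
      (Xor (G α₀ α₁ α₃ p = lowerCurve α₁ α₃ h (J p)) (G α₀ α₁ α₃ p = upperCurve α₀ α₁ h (J p)) →
        rankAt (axes α₀ α₁ α₃) (EM α₀ α₁ α₃) p = 2 ∧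
        IsNondegenerateOfType (axes α₀ α₁ α₃) (EM α₀ α₁ α₃) p 1 0 0) ∧
      -- over an intersection of the boundary curves: elliptic-elliptic
      (G α₀ α₁ α₃ p = lowerCurve α₁ α₃ h (J p) ∧ G α₀ α₁ α₃ p = upperCurve α₀ α₁ h (J p) →
        rankAt (axes α₀ α₁ α₃) (EM α₀ α₁ α₃) p = 1 ∧
        IsNondegenerateOfType (axes α₀ α₁ α₃) (EM α₀ α₁ α₃) p 2 0 0) ∧
      -- over the origin: focus-focus
      (J p = 0 ∧ G α₀ α₁ α₃ p = 0 →
        rankAt (axes α₀ α₁ α₃) (EM α₀ α₁ α₃) p = 1 ∧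
        IsNondegenerateOfType (axes α₀ α₁ α₃) (EM α₀ α₁ α₃) p 0 0 1) := by
  have h1 : 0 < α₁ := h0.trans h01
  have himage := image_eq_region (h := h) h0 h01 h13
  have hzero := zero_notMem_boundaryCurves h1 h01 h13 hh
  have hcrit : criticalValues α₀ α₁ α₃ h = boundaryCurves α₀ α₁ α₃ h ∪ {(0, 0)} := by
    apply Subset.antisymm
    · rintro _ ⟨p, hp, rfl, rfl⟩
      have hreg := mem_region_of_mem_phaseSpace h0 h01 h13 hp.1
      rcases hp.classification h0 h01 h13 hh with h | h | ⟨a, b, c, d⟩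
      · exact Or.inl ⟨hreg, Or.inr ((eq_upperCurve_iff h0 h01 h13 hp.1 hh).2 h)⟩
      · exact Or.inl ⟨hreg, Or.inl ((eq_lowerCurve_iff h0 h01 h13 hp.1 hh).2 h)⟩
      · right
        simp [J, G, a, b, c, d]
    · rintro ⟨j, g⟩ (⟨hreg, hq⟩ | hq)
      · rw [← himage] at hreg
        obtain ⟨p, ⟨hp, rfl⟩, hpq⟩ := hreg
        obtain ⟨rfl, rfl⟩ := Prod.mk.inj hpq
        refine ⟨p, isCriticalPt_of_coordinates h0 h01 h13 hp hh ?_, rfl, rfl⟩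
        rcases hq with hq | hq
        · exact Or.inr (Or.inl ((eq_lowerCurve_iff h0 h01 h13 hp hh).1 hq))
        · exact Or.inl ((eq_upperCurve_iff h0 h01 h13 hp hh).1 hq)
      · -- the geodesics in the plane of the coordinates `x₀`, `x₃`
        have hH : H (![√α₀, 0, 0, 0], ![0, 0, 0, √(2 * h)]) = h := by
          simp only [H, Matrix.cons_val]
          rw [Real.sq_sqrt (by linarith)]
          ring
        refine ⟨(![√α₀, 0, 0, 0], ![0, 0, 0, √(2 * h)]),
          isCriticalPt_of_coordinates h0 h01 h13 ?_ (by rw [hH]; exact hh) ?_, hH, ?_⟩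
        · rw [mem_phaseSpace_axes]
          simp [Real.sq_sqrt h0.le, h0.ne']
        · simp
        · rw [mem_singleton_iff.1 hq]
          simp [J, G]
  refine ⟨himage, frontier_region, hcrit, hzero, ?_, ?_⟩
  · rw [hcrit, accPt_iff_nhds]
    intro hacc
    obtain ⟨q, ⟨hq, hq'⟩, hne⟩ := hacc _ (isClosed_boundaryCurves.isOpen_compl.mem_nhds hzero)
    exact hq'.elim hq hne
  · rintro p hp rfl
    have hlow := eq_lowerCurve_iff h0 h01 h13 hp.1 hh
    have hup := eq_upperCurve_iff h0 h01 h13 hp.1 hh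
    refine ⟨?_, ?_, ?_⟩
    · rw [hlow, hup]
      rintro (⟨a, b⟩ | ⟨a, b⟩)
      · exact lower_elliptic h0 h01 h13 hp.1 hh a.1 a.2 b
      · exact upper_elliptic h0 h01 h13 hp.1 hh a.1 a.2 b
    · rw [hlow, hup]
      rintro ⟨a, b⟩
      exact equator_elliptic_elliptic h0 h01 h13 hp.1 hh a.1 a.2 b.1 b.2
    · rintro ⟨hJ, hG⟩
      rw [hJ, hG] at hlow hup
      rcases hp.classification h0 h01 h13 hh with h | h | ⟨a, b, c, d⟩
      · exact absurd (hup.2 h) (upperCurve_zero_pos h1 h01 hh).ne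
      · exact absurd (hlow.2 h) (lowerCurve_zero_neg h1 h13 hh).ne'
      · exact outer_focus_focus h0 h01 h13 hp.1 hh a b c d
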